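/- Work over $\mathbb{C}$, let $\epsilon=e^{2\pi i/3}$, and put $$\Phi_6=x^6+y^6+z^6-10(x^3y^3+x^3z^3+y^3z^3),$$ $$\Phi_6'=(x^3+y^3+z^3)^2-36y^3z^3+24(z^4y^2+z^2y^4)-12(z^5y+zy^5)-12x^3(z^2y+zy^2).$$ Let $X$ be the K3 surface $w^2+\Phi_6(x,y,z)=0$ in $\mathbb{P}(1,1,1,3)$, i.e. the double cover of $\mathbb{P}^2$ branched along the smooth sextic $C_6:\Phi_6=0$. Let $Y'$ be the surface $w^2+\Phi_6'(x,y,z)=0$ in $\mathbb{P}(1,1,1,3)$, i.e. the double cover of $\mathbb{P}^2$ branched along the 8-cuspidal sextic $C_6':\Phi_6'=0$, and let the K3 surface $X'$ be the minimal resolution of singularities of $Y'$ (the resolution through which every resolution of $Y'$ factors uniquely). Let $G_{216}\subset \mathrm{PGL}(3,\mathbb{C})$ be the Hessian group, that is, the group of projective transformations preserving the Hesse pencil spanned by $x^3+y^3+z^3$ and $xyz$, and let $\Gamma\subset\mathrm{PGL}(3,\mathbb{C})$ be the subgroup generated by $g_1(x,y,z)=(y,z,x)$ and $g_2(x,y,z)=(x,\epsilon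 y,\epsilon^2z)$. The group $G_{216}$ acts on $X$ as follows: $g\in G_{216}$ acts by $(v,w)\mapsto (Av,cw)$, where $A\in \mathrm{SL}(3,\mathbb{C})$ represents $g$, $c^3=1$ and $\Phi_6(Av)=c^2\Phi_6(v)$. Then $\Gamma$ is contained in $G_{216}$ and isomorphic to $(\mathbb{Z}/3\mathbb{Z})^2$, it is normal in $G_{216}$, and there is an isomorphism $\theta:G_{216}/\Gamma\cong \mathrm{SL}(2,\mathbb{F}_3)$. The surface $X'$ is birationally isomorphic over $\mathbb{C}$ to the quotient surface $X/\Gamma$. Moreover there are a birational isomorphism $f: X/\Gamma\dashrightarrow X'$ and an injective homomorphism $\rho:\mathrm{SL}(2,\mathbb{F}_3)\to\mathrm{Aut}_{\mathbb{C}}(X')$ such that, for every $g\in G_{216}$, $f$ transforms the automorphism of $X/\Gamma$ induced by $g$ into $\rho(\theta(g\Gamma))$. In particular $\mathrm{SL}(2,\mathbb{F}_3)$ is isomorphic to a group of automorphisms of $X'$. -/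

import Mathlib

open CategoryTheory AlgebraicGeometry
open scoped MatrixGroups

noncomputable section

namespace Hesse

open MvPolynomial

/-! ### The grading on the quotient of a graded algebra by a homogeneous ideal -/

section QuotientGrading

variable {A : Type} [CommRing A] [Algebra ℂ A] (𝒜 : ℕ → Submodule ℂ A) [GradedAlgebra 𝒜]
  (I : Ideal A)

/-- The `n`-th graded piece of `A ⧸ I`: the image of the `n`-th graded piece of `A`. -/
def quotGrading (n : ℕ) : Submodule ℂ (A ⧸ I) :=
  (𝒜 n).map (Ideal.Quotient.mkₐ ℂ I).toLinearMap

variable {𝒜 I}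

instance : SetLike.GradedMonoid (quotGrading 𝒜 I) where
  one_mem := ⟨1, SetLike.GradedOne.one_mem, rfl⟩
  mul_mem := by
    rintro i j _ _ ⟨a, ha, rfl⟩ ⟨b, hb, rfl⟩
    exact ⟨a * b, SetLike.GradedMul.mul_mem ha hb, rfl⟩

variable (𝒜 I) in
/-- The map from a graded piece of `A` to the corresponding graded piece of `A ⧸ I`. -/
def quotPiece (n : ℕ) : 𝒜 n →ₗ[ℂ] quotGrading 𝒜 I n :=
  (Ideal.Quotient.mkₐ ℂ I).toLinearMap.restrict fun a ha => ⟨a, ha, rfl⟩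

variable (𝒜 I) in
/-- The homogeneous components of the class in `A ⧸ I` of an element of `A`. -/
def quotDecompose : A →ₗ[ℂ] DirectSum ℕ fun n => quotGrading 𝒜 I n :=
  (DirectSum.lmap (quotPiece 𝒜 I)).comp (DirectSum.decomposeLinearEquiv 𝒜).toLinearMap

theorem quotDecompose_apply (a : A) (n : ℕ) :
    ((quotDecompose 𝒜 I a n : quotGrading 𝒜 I n) : A ⧸ I) =
      Ideal.Quotient.mk I (DirectSum.decompose 𝒜 a n : A) := by
  rfl

theorem quotDecompose_congr (hI : I.IsHomogeneous 𝒜) {a b : A}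
    (h : Ideal.Quotient.mk I a = Ideal.Quotient.mk I b) :
    quotDecompose 𝒜 I a = quotDecompose 𝒜 I b := by
  refine DFinsupp.ext fun n => Subtype.ext ?_
  rw [quotDecompose_apply, quotDecompose_apply, Ideal.Quotient.eq]
  have := hI n (Ideal.Quotient.eq.mp h)
  rwa [DirectSum.decompose_sub, DirectSum.sub_apply, Submodule.coe_sub] at this

theorem coe_quotDecompose (a : A) :
    DirectSum.coeLinearMap (quotGrading 𝒜 I) (quotDecompose 𝒜 I a) =
      Ideal.Quotient.mk I a := by
  induction a using DirectSum.Decomposition.inductionOn 𝒜 with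
  | zero => simp
  | @homogeneous i m =>
    simp only [quotDecompose, LinearMap.comp_apply, LinearEquiv.coe_coe,
      DirectSum.decomposeLinearEquiv_apply, DirectSum.decompose_coe]
    erw [DirectSum.lmap_of, DirectSum.coeLinearMap_of]
    rfl
  | add m m' h h' => rw [map_add, map_add, h, h', map_add]

theorem quotDecompose_coe {n : ℕ} (a : 𝒜 n) :
    quotDecompose 𝒜 I a = DirectSum.of (fun n => quotGrading 𝒜 I n) n (quotPiece 𝒜 I n a) := by
  simp only [quotDecompose, LinearMap.comp_apply, LinearEquiv.coe_coe,
    DirectSum.decomposeLinearEquiv_apply, DirectSum.decompose_coe]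
  exact DirectSum.lmap_of _ _ _

/-- A quotient of a graded algebra by a homogeneous ideal is a graded algebra. -/
abbrev quotGradedAlgebra (hI : I.IsHomogeneous 𝒜) : GradedAlgebra (quotGrading 𝒜 I) where
  decompose' x := quotDecompose 𝒜 I (Function.surjInv Ideal.Quotient.mk_surjective x)
  left_inv x := by
    refine (coe_quotDecompose (𝒜 := 𝒜) (I := I) _).trans ?_
    exact Function.surjInv_eq Ideal.Quotient.mk_surjective x
  right_inv d := by
    have key : ∀ (a : A), Ideal.Quotient.mk I a = DirectSum.coeAddMonoidHom (quotGrading 𝒜 I) d →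
        quotDecompose 𝒜 I a = d := by
      induction d using DirectSum.induction_on with
      | zero =>
        intro a ha
        rw [map_zero] at ha
        rw [quotDecompose_congr hI (b := 0) (by rw [ha, map_zero]), map_zero]
      | of n y =>
        intro a ha
        obtain ⟨_, b, hb, rfl⟩ := y
        rw [DirectSum.coeAddMonoidHom_of] at ha
        rw [quotDecompose_congr hI (b := b) ha]
        exact quotDecompose_coe (⟨b, hb⟩ : 𝒜 n)
      | add d₁ d₂ h₁ h₂ =>
        intro a ha
        obtain ⟨a₁, ha₁⟩ := Ideal.Quotient.mk_surjective
          (DirectSum.coeAddMonoidHom (quotGrading 𝒜 I) d₁)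
        obtain ⟨a₂, ha₂⟩ := Ideal.Quotient.mk_surjective
          (DirectSum.coeAddMonoidHom (quotGrading 𝒜 I) d₂)
        rw [quotDecompose_congr hI (b := a₁ + a₂) (by rw [ha, map_add, map_add, ha₁, ha₂]),
          map_add, h₁ a₁ ha₁, h₂ a₂ ha₂]
    exact key _ (Function.surjInv_eq Ideal.Quotient.mk_surjective _)

end QuotientGrading

/-! ### Projective schemes over `ℂ` and their linear automorphisms -/

section ProjOver

variable {B : Type} [CommRing B] [Algebra ℂ B] (ℬ : ℕ → Submodule ℂ B) [GradedAlgebra ℬ]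

/-- `Proj` of a graded `ℂ`-algebra, as a scheme over `Spec ℂ`. -/
def projOver : Over (Spec (.of ℂ)) :=
  Over.mk (Y := Proj ℬ)
    (Proj.toSpecZero ℬ ≫ Spec.map (CommRingCat.ofHom (algebraMap ℂ (ℬ 0))))

variable {ℬ}

theorem irrelevant_le_map {f g : ℬ →+*ᵍ ℬ} (h : f.comp g = .id ℬ) :
    HomogeneousIdeal.irrelevant ℬ ≤ (HomogeneousIdeal.irrelevant ℬ).map f := by
  refine (HomogeneousIdeal.toIdeal_irrelevant_le ℬ).mpr ?_
  intro i hi x hx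
  have hx' : f (g x) = x := GradedRingHom.congr_fun h x
  rw [← hx']
  exact Ideal.mem_map_of_mem f
    (HomogeneousIdeal.mem_irrelevant_of_mem ℬ hi (g.map_mem hx))

theorem projMap_congr {f g : ℬ →+*ᵍ ℬ} (h : f = g)
    (hf : HomogeneousIdeal.irrelevant ℬ ≤ (HomogeneousIdeal.irrelevant ℬ).map f)
    (hg : HomogeneousIdeal.irrelevant ℬ ≤ (HomogeneousIdeal.irrelevant ℬ).map g) :
    Proj.map f hf = Proj.map g hg := by
  subst h
  rfl

theorem map_structure (f : ℬ →+*ᵍ ℬ)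
    (h : HomogeneousIdeal.irrelevant ℬ ≤ (HomogeneousIdeal.irrelevant ℬ).map f)
    (hf : ∀ r : ℂ, f (algebraMap ℂ B r) = algebraMap ℂ B r) :
    Proj.map f h ≫ Proj.toSpecZero ℬ ≫ Spec.map (CommRingCat.ofHom (algebraMap ℂ (ℬ 0))) =
      Proj.toSpecZero ℬ ≫ Spec.map (CommRingCat.ofHom (algebraMap ℂ (ℬ 0))) := by
  have key : ∀ (n : ℕ) (hn : 0 < n) (a : B) (ha : a ∈ ℬ n),
      Proj.awayι ℬ (f a) (f.2 ha) hn ≫ Proj.map f h ≫ Proj.toSpecZero ℬ ≫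
          Spec.map (CommRingCat.ofHom (algebraMap ℂ (ℬ 0))) =
        Proj.awayι ℬ (f a) (f.2 ha) hn ≫ Proj.toSpecZero ℬ ≫
          Spec.map (CommRingCat.ofHom (algebraMap ℂ (ℬ 0))) := by
    intro n hn a ha
    rw [Proj.awayι_comp_map_assoc f h hn _ ha, Proj.awayι_toSpecZero_assoc,
      Proj.awayι_toSpecZero_assoc, ← Spec.map_comp, ← Spec.map_comp, ← Spec.map_comp]
    congr 1
    ext r
    simp only [CommRingCat.hom_comp, CommRingCat.hom_ofHom, RingHom.comp_apply]
    change HomogeneousLocalization.val (HomogeneousLocalization.mk _) =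
      HomogeneousLocalization.val (HomogeneousLocalization.mk _)
    rw [HomogeneousLocalization.val_mk, HomogeneousLocalization.val_mk]
    congr 1
    · exact hf r
    · exact Subtype.ext (map_one f)
  exact (Proj.mapAffineOpenCover f h).openCover.hom_ext _ _ fun s => key _ s.1.2 _ s.2.2

/-- The morphism of `Proj` induced by an invertible degree-preserving `ℂ`-algebra map `f`. -/
def projHom (f g : ℬ →+*ᵍ ℬ) (h : f.comp g = .id ℬ)
    (hf : ∀ r : ℂ, f (algebraMap ℂ B r) = algebraMap ℂ B r) : projOver ℬ ⟶ projOver ℬ :=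
  Over.homMk (Proj.map f (irrelevant_le_map h)) (map_structure f _ hf)

end ProjOver

/-! ### Linear substitutions -/

/-- The linear form `∑ j, A i j * x_j`. -/
def linForm (A : Matrix (Fin 3) (Fin 3) ℂ) (i : Fin 3) : MvPolynomial (Fin 3) ℂ :=
  ∑ j, C (A i j) * X j

/-- The substitution `F(v) ↦ F(A v)` on polynomials in the coordinates of `v = (x, y, z)`. -/
def subst (A : Matrix (Fin 3) (Fin 3) ℂ) : MvPolynomial (Fin 3) ℂ →ₐ[ℂ] MvPolynomial (Fin 3) ℂ :=
  aeval (linForm A)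

/-- The substitution `P(v, w) ↦ P(A v, c w)` on polynomials in the coordinates `(v, w)`;
the variable `w` is `X 3`. -/
def coverSubst (A : Matrix (Fin 3) (Fin 3) ℂ) (c : ℂ) :
    MvPolynomial (Fin 4) ℂ →ₐ[ℂ] MvPolynomial (Fin 4) ℂ :=
  aeval (Fin.snoc (α := fun _ => MvPolynomial (Fin 4) ℂ)
    (fun i : Fin 3 => rename Fin.castSucc (linForm A i)) (C c * X 3))

theorem subst_mul (A B : Matrix (Fin 3) (Fin 3) ℂ) :
    subst (A * B) = (subst B).comp (subst A) := by
  refine MvPolynomial.algHom_ext fun i => ?_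
  simp only [subst, linForm, AlgHom.comp_apply, aeval_X, map_sum, map_mul, algHom_C,
    algebraMap_eq, Matrix.mul_apply, Finset.sum_mul, Finset.mul_sum, mul_assoc]
  exact Finset.sum_comm

theorem subst_one : subst 1 = AlgHom.id ℂ _ := by
  refine MvPolynomial.algHom_ext fun i => ?_
  simp [subst, linForm, Matrix.one_apply]

theorem coverSubst_rename (A : Matrix (Fin 3) (Fin 3) ℂ) (c : ℂ) (F : MvPolynomial (Fin 3) ℂ) :
    coverSubst A c (rename Fin.castSucc F) = rename Fin.castSucc (subst A F) := by
  have : (coverSubst A c).comp (rename Fin.castSucc) =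
      (rename (R := ℂ) (Fin.castSucc : Fin 3 → Fin 4)).comp (subst A) := by
    refine MvPolynomial.algHom_ext fun i => ?_
    simp only [AlgHom.comp_apply, rename_X, coverSubst, subst, aeval_X, Fin.snoc_castSucc]
  exact DFunLike.congr_fun this F

theorem coverSubst_X_three (A : Matrix (Fin 3) (Fin 3) ℂ) (c : ℂ) :
    coverSubst A c (X 3) = C c * X 3 := by
  rw [coverSubst, aeval_X]
  exact Fin.snoc_last (α := fun _ => MvPolynomial (Fin 4) ℂ) _ _

theorem coverSubst_ext {f g : MvPolynomial (Fin 4) ℂ →ₐ[ℂ] MvPolynomial (Fin 4) ℂ}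
    (h : ∀ i : Fin 3, f (rename Fin.castSucc (X i)) = g (rename Fin.castSucc (X i)))
    (h' : f (X 3) = g (X 3)) : f = g := by
  refine MvPolynomial.algHom_ext fun i => ?_
  induction i using Fin.lastCases with
  | last => exact h'
  | cast i => simpa only [rename_X] using h i

theorem coverSubst_mul (A B : Matrix (Fin 3) (Fin 3) ℂ) (c d : ℂ) :
    coverSubst (A * B) (c * d) = (coverSubst B d).comp (coverSubst A c) := by
  refine coverSubst_ext (fun i => ?_) ?_
  · simp only [AlgHom.comp_apply, coverSubst_rename, subst_mul]
  · simp only [AlgHom.comp_apply, coverSubst_X_three, map_mul, algHom_C, algebraMap_eq]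
    ring

theorem coverSubst_one : coverSubst 1 1 = AlgHom.id ℂ _ := by
  refine coverSubst_ext (fun i => ?_) ?_
  · simp only [coverSubst_rename, subst_one, AlgHom.id_apply]
  · simp only [coverSubst_X_three, map_one, one_mul, AlgHom.id_apply]

/-! ### Double planes `w² + F(x, y, z) = 0` in `ℙ(1, 1, 1, 3)` -/

/-- The weights `(1, 1, 1, 3)` of the coordinates `(x, y, z, w)`. -/
def weight : Fin 4 → ℕ := ![1, 1, 1, 3]

instance : GradedAlgebra (weightedHomogeneousSubmodule ℂ weight) :=
  weightedGradedAlgebra ℂ weight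

theorem weight_castSucc (i : Fin 3) : weight i.castSucc = 1 := by
  fin_cases i <;> rfl

theorem linForm_mem (A : Matrix (Fin 3) (Fin 3) ℂ) (i : Fin 3) :
    IsWeightedHomogeneous weight (rename Fin.castSucc (linForm A i)) 1 := by
  rw [linForm, map_sum]
  refine IsWeightedHomogeneous.sum _ _ _ fun j _ => ?_
  have := (isWeightedHomogeneous_C weight (A i j)).mul
    (isWeightedHomogeneous_X ℂ weight j.castSucc)
  rw [weight_castSucc, zero_add] at this
  rwa [map_mul, rename_C, rename_X]

/-- Substituting weighted homogeneous polynomials for the variables. -/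
theorem aeval_mem {σ τ : Type} {v : σ → ℕ} {u : τ → ℕ} {f : σ → MvPolynomial τ ℂ}
    (hf : ∀ i, IsWeightedHomogeneous u (f i) (v i)) {n : ℕ} {P : MvPolynomial σ ℂ}
    (hP : IsWeightedHomogeneous v P n) : IsWeightedHomogeneous u (aeval f P) n := by
  rw [aeval_def, eval₂_eq]
  refine IsWeightedHomogeneous.sum _ _ _ fun d hd => ?_
  have hd' := hP (mem_support_iff.mp hd)
  rw [Finsupp.weight_apply, Finsupp.sum] at hd'
  rw [← zero_add n, ← hd']
  refine (isWeightedHomogeneous_C u _).mul ?_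
  refine IsWeightedHomogeneous.prod _ _ _ fun i _ => ?_
  exact (hf i).pow (d i)

theorem rename_mem {n : ℕ} {F : MvPolynomial (Fin 3) ℂ}
    (hF : F ∈ homogeneousSubmodule (Fin 3) ℂ n) :
    rename Fin.castSucc F ∈ weightedHomogeneousSubmodule ℂ weight n := by
  have h : rename Fin.castSucc = aeval (R := ℂ) fun i : Fin 3 =>
      (X i.castSucc : MvPolynomial (Fin 4) ℂ) :=
    MvPolynomial.algHom_ext fun i => by rw [rename_X, aeval_X]
  rw [h]
  refine aeval_mem (v := 1) (fun i => ?_) hF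
  rw [Pi.one_apply, ← weight_castSucc i]
  exact isWeightedHomogeneous_X ℂ weight _

theorem coverSubst_mem (A : Matrix (Fin 3) (Fin 3) ℂ) (c : ℂ) {n : ℕ} {P : MvPolynomial (Fin 4) ℂ}
    (hP : P ∈ weightedHomogeneousSubmodule ℂ weight n) :
    coverSubst A c P ∈ weightedHomogeneousSubmodule ℂ weight n := by
  refine aeval_mem (fun i => ?_) hP
  induction i using Fin.lastCases with
  | last =>
    rw [Fin.snoc_last, ← zero_add (weight (Fin.last 3))]
    exact (isWeightedHomogeneous_C weight c).mul (isWeightedHomogeneous_X ℂ weight 3)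
  | cast i =>
    rw [Fin.snoc_castSucc, weight_castSucc]
    exact linForm_mem A i

/-- Ternary forms of degree six. -/
abbrev Sextic : Type := homogeneousSubmodule (Fin 3) ℂ 6

/-- The weighted homogeneous polynomial `w² + F(x, y, z)`. -/
def coverEq (F : Sextic) : MvPolynomial (Fin 4) ℂ :=
  X 3 ^ 2 + rename Fin.castSucc F.1

theorem coverEq_mem (F : Sextic) :
    coverEq F ∈ weightedHomogeneousSubmodule ℂ weight 6 :=
  Submodule.add_mem _ ((isWeightedHomogeneous_X ℂ weight 3).pow 2) (rename_mem F.2)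

/-- The ideal generated by `w² + F(x, y, z)`. -/
def coverIdeal (F : Sextic) : Ideal (MvPolynomial (Fin 4) ℂ) :=
  Ideal.span {coverEq F}

theorem coverIdeal_isHomogeneous (F : Sextic) :
    (coverIdeal F).IsHomogeneous (weightedHomogeneousSubmodule ℂ weight) := by
  refine Ideal.homogeneous_span _ _ ?_
  rintro _ rfl
  exact ⟨6, coverEq_mem F⟩

/-- The weighted homogeneous coordinate ring `ℂ[x, y, z, w] / (w² + F)`, with its grading. -/
abbrev coverGrading (F : Sextic) : ℕ → Submodule ℂ (MvPolynomial (Fin 4) ℂ ⧸ coverIdeal F) :=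
  quotGrading (weightedHomogeneousSubmodule ℂ weight) (coverIdeal F)

instance (F : Sextic) : GradedAlgebra (coverGrading F) :=
  quotGradedAlgebra (coverIdeal_isHomogeneous F)

/-- The double cover of the projective plane branched along the sextic curve `F = 0`:
the hypersurface `w² + F(x, y, z) = 0` of the weighted projective space `ℙ(1, 1, 1, 3)`. -/
def doublePlane (F : Sextic) : Over (Spec (.of ℂ)) :=
  projOver (coverGrading F)

/-- The group of pairs `(A, c)` with `F(A v) = c² F(v)`; such a pair acts on the double plane
by `(v, w) ↦ (A v, c w)`. -/
def coverSymm (F : Sextic) : Subgroup (GL (Fin 3) ℂ × ℂˣ) where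
  carrier := {g | subst g.1.1 F.1 = C ((g.2 : ℂ) ^ 2) * F.1}
  mul_mem' := by
    intro g h hg hh
    simp only [Set.mem_ofPred_eq] at hg hh ⊢
    simp only [Prod.fst_mul, Prod.snd_mul, Units.val_mul, subst_mul, AlgHom.comp_apply, hg,
      map_mul, algHom_C, algebraMap_eq, hh, mul_pow, mul_assoc]
  one_mem' := by
    simp [subst_one]
  inv_mem' := by
    intro g hg
    simp only [Set.mem_ofPred_eq] at hg ⊢
    have h1 : subst g⁻¹.1.1 (subst g.1.1 F.1) = F.1 := by
      rw [← AlgHom.comp_apply, ← subst_mul, Prod.fst_inv, Units.mul_inv, subst_one,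
        AlgHom.id_apply]
    rw [hg, map_mul, algHom_C, algebraMap_eq] at h1
    calc subst g⁻¹.1.1 F.1
        = C ((g⁻¹.2 : ℂ) ^ 2) * (C ((g.2 : ℂ) ^ 2) * subst g⁻¹.1.1 F.1) := by
          rw [← mul_assoc, ← C_mul, ← mul_pow, Prod.snd_inv, Units.inv_mul, one_pow, C_1,
            one_mul]
      _ = C ((g⁻¹.2 : ℂ) ^ 2) * F.1 := by rw [h1]

theorem coverSubst_coverEq {F : Sextic} (g : coverSymm F) :
    coverSubst g.1.1.1 g.1.2 (coverEq F) = C ((g.1.2 : ℂ) ^ 2) * coverEq F := by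
  have hg : subst g.1.1.1 F.1 = C ((g.1.2 : ℂ) ^ 2) * F.1 := g.2
  rw [coverEq, map_add, map_pow, coverSubst_X_three, coverSubst_rename, hg, map_mul, rename_C,
    C_pow]
  ring

/-- The automorphism of the coordinate ring of the double plane given by `(v, w) ↦ (A v, c w)`. -/
def coverRingMap {F : Sextic} (g : coverSymm F) : coverGrading F →+*ᵍ coverGrading F where
  toRingHom := Ideal.quotientMap (coverIdeal F) (coverSubst g.1.1.1 g.1.2).toRingHom (by
    rw [coverIdeal, Ideal.span_le, Set.singleton_subset_iff]
    change coverSubst g.1.1.1 g.1.2 (coverEq F) ∈ coverIdeal F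
    rw [coverSubst_coverEq]
    exact Ideal.mul_mem_left _ _ (Ideal.mem_span_singleton_self _))
  map_mem := by
    rintro n _ ⟨P, hP, rfl⟩
    exact ⟨_, coverSubst_mem g.1.1.1 g.1.2 hP, rfl⟩

theorem coverRingMap_mul {F : Sextic} (g h : coverSymm F) :
    coverRingMap (g * h) = (coverRingMap h).comp (coverRingMap g) := by
  refine GradedRingHom.ext fun x => ?_
  obtain ⟨P, rfl⟩ := Ideal.Quotient.mk_surjective x
  exact congrArg (Ideal.Quotient.mk (coverIdeal F))
    (DFunLike.congr_fun (coverSubst_mul g.1.1.1 h.1.1.1 g.1.2 h.1.2) P)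

theorem coverRingMap_one (F : Sextic) : coverRingMap (1 : coverSymm F) = .id _ := by
  refine GradedRingHom.ext fun x => ?_
  obtain ⟨P, rfl⟩ := Ideal.Quotient.mk_surjective x
  exact congrArg (Ideal.Quotient.mk (coverIdeal F)) (DFunLike.congr_fun coverSubst_one P)

theorem coverRingMap_comp_inv {F : Sextic} (g : coverSymm F) :
    (coverRingMap g).comp (coverRingMap g⁻¹) = .id _ := by
  rw [← coverRingMap_mul, inv_mul_cancel, coverRingMap_one]

/-- The morphism `(v, w) ↦ (A v, c w)` of the double plane. -/
def coverHom {F : Sextic} (g : coverSymm F) : doublePlane F ⟶ doublePlane F :=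
  projHom (coverRingMap g) (coverRingMap g⁻¹) (coverRingMap_comp_inv g) fun r =>
    congrArg (Ideal.Quotient.mk (coverIdeal F)) ((coverSubst g.1.1.1 g.1.2).commutes r)

theorem coverHom_mul {F : Sextic} (g h : coverSymm F) :
    coverHom (g * h) = coverHom h ≫ coverHom g := by
  refine Over.OverMorphism.ext ?_
  refine Eq.trans ?_ (Proj.map_comp (coverRingMap g) (coverRingMap h) _ _)
  exact projMap_congr (coverRingMap_mul g h) _ _

theorem coverHom_one (F : Sextic) : coverHom (1 : coverSymm F) = 𝟙 _ := by
  refine Over.OverMorphism.ext ?_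
  refine Eq.trans ?_ (Proj.map_id (𝒜 := coverGrading F))
  exact projMap_congr (coverRingMap_one F) _ _

/-- The action of the group of pairs `(A, c)` on the double plane by `(v, w) ↦ (A v, c w)`. -/
def coverAct (F : Sextic) : coverSymm F →* Aut (doublePlane F) where
  toFun g :=
    { hom := coverHom g
      inv := coverHom g⁻¹
      hom_inv_id := by rw [← coverHom_mul, inv_mul_cancel, coverHom_one]
      inv_hom_id := by rw [← coverHom_mul, mul_inv_cancel, coverHom_one] }
  map_one' := Iso.ext (coverHom_one F)
  map_mul' g h := Iso.ext (coverHom_mul g h)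

/-! ### The two sextics, the surface `X` and the double plane of the cuspidal sextic -/

theorem isHomogeneous_ofNat (n : ℕ) [n.AtLeastTwo] :
    (ofNat(n) : MvPolynomial (Fin 3) ℂ).IsHomogeneous 0 := by
  rw [← map_ofNat (C : ℂ →+* MvPolynomial (Fin 3) ℂ) n]
  exact isHomogeneous_C _ _

/-- `Φ₆ = x⁶ + y⁶ + z⁶ - 10 (x³y³ + x³z³ + y³z³)`. -/
def phiSix : Sextic :=
  ⟨X 0 ^ 6 + X 1 ^ 6 + X 2 ^ 6
      - 10 * (X 0 ^ 3 * X 1 ^ 3 + X 0 ^ 3 * X 2 ^ 3 + X 1 ^ 3 * X 2 ^ 3), by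
    have h (i : Fin 3) (n : ℕ) := isHomogeneous_X_pow (R := ℂ) i n
    have hm (i j : Fin 3) := (h i 3).mul (h j 3)
    exact (((h 0 6).add (h 1 6)).add (h 2 6)).sub
      ((isHomogeneous_ofNat 10).mul (((hm 0 1).add (hm 0 2)).add (hm 1 2)))⟩

/-- `Φ₆' = (x³ + y³ + z³)² - 36 y³z³ + 24 (z⁴y² + z²y⁴) - 12 (z⁵y + zy⁵) - 12 x³ (z²y + zy²)`. -/
def phiSix' : Sextic :=
  ⟨(X 0 ^ 3 + X 1 ^ 3 + X 2 ^ 3) ^ 2 - 36 * X 1 ^ 3 * X 2 ^ 3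
      + 24 * (X 2 ^ 4 * X 1 ^ 2 + X 2 ^ 2 * X 1 ^ 4)
      - 12 * (X 2 ^ 5 * X 1 + X 2 * X 1 ^ 5)
      - 12 * X 0 ^ 3 * (X 2 ^ 2 * X 1 + X 2 * X 1 ^ 2), by
    have h (i : Fin 3) (n : ℕ) := isHomogeneous_X_pow (R := ℂ) i n
    have h1 (i : Fin 3) := isHomogeneous_X ℂ i
    have hn (n : ℕ) [n.AtLeastTwo] := isHomogeneous_ofNat n
    exact ((((((h 0 3).add (h 1 3)).add (h 2 3)).pow 2).sub
      (((hn 36).mul (h 1 3)).mul (h 2 3))).add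
      ((hn 24).mul (((h 2 4).mul (h 1 2)).add ((h 2 2).mul (h 1 4))))).sub
      ((hn 12).mul (((h 2 5).mul (h1 1)).add ((h1 2).mul (h 1 5)))) |>.sub
      (((hn 12).mul (h 0 3)).mul (((h 2 2).mul (h1 1)).add ((h1 2).mul (h 1 2))))⟩

/-- The K3 surface `X`: the double plane `w² + Φ₆(x, y, z) = 0`. -/
def surfaceX : Over (Spec (.of ℂ)) := doublePlane phiSix

/-- The singular double plane `w² + Φ₆'(x, y, z) = 0` branched along the 8-cuspidal sextic. -/
def cuspidalDoublePlane : Over (Spec (.of ℂ)) := doublePlane phiSix'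

/-! ### The Hessian group and its action on `X` -/

/-- The Hesse pencil, spanned by `x³ + y³ + z³` and `xyz`. -/
def hessePencil : Submodule ℂ (MvPolynomial (Fin 3) ℂ) :=
  Submodule.span ℂ {X 0 ^ 3 + X 1 ^ 3 + X 2 ^ 3, X 0 * X 1 * X 2}

/-- The linear transformations preserving the Hesse pencil. -/
def linearHessianGroup : Subgroup (GL (Fin 3) ℂ) where
  carrier := {A | hessePencil.map (subst A.1).toLinearMap = hessePencil}
  mul_mem' := by
    intro A B hA hB
    simp only [Set.mem_ofPred_eq] at hA hB ⊢
    rw [Units.val_mul, subst_mul, AlgHom.comp_toLinearMap, Submodule.map_comp, hA, hB]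
  one_mem' := by
    simp only [Set.mem_ofPred_eq]
    rw [Units.val_one, subst_one, AlgHom.toLinearMap_id, Submodule.map_id]
  inv_mem' := by
    intro A hA
    simp only [Set.mem_ofPred_eq] at hA ⊢
    conv_lhs => rw [← hA]
    rw [← Submodule.map_comp, ← AlgHom.comp_toLinearMap, ← subst_mul, Units.mul_inv, subst_one,
      AlgHom.toLinearMap_id, Submodule.map_id]

/-- The Hessian group `G₂₁₆`: the projective transformations of the plane preserving the
Hesse pencil. -/
def G216 : Subgroup PGL(3, ℂ) := linearHessianGroup.map Matrix.ProjGenLinGroup.mk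

/-- The primitive cube root of unity `ε = exp (2πi / 3)`. -/
def eps : ℂ := Complex.exp (2 * Real.pi * Complex.I / 3)

/-- `g₁ (x, y, z) = (y, z, x)`. -/
def g1 : GL (Fin 3) ℂ :=
  Matrix.GeneralLinearGroup.mkOfDetNeZero !![0, 1, 0; 0, 0, 1; 1, 0, 0]
    (by simp [Matrix.det_fin_three])

/-- `g₂ (x, y, z) = (x, ε y, ε² z)`. -/
def g2 : GL (Fin 3) ℂ :=
  Matrix.GeneralLinearGroup.mkOfDetNeZero !![1, 0, 0; 0, eps, 0; 0, 0, eps ^ 2]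
    (by simp [Matrix.det_fin_three, eps, Complex.exp_ne_zero])

/-- The subgroup `Γ` generated by `g₁` and `g₂` in `PGL(3, ℂ)`. -/
def Gam : Subgroup PGL(3, ℂ) :=
  Subgroup.closure {Matrix.ProjGenLinGroup.mk g1, Matrix.ProjGenLinGroup.mk g2}

/-- The lifts `(A, c)` of elements of the Hessian group through which it acts on `X`:
`A` has determinant one and represents an element of `G₂₁₆`, `c³ = 1`, and
`Φ₆(A v) = c² Φ₆(v)`. -/
def hessianLift : Subgroup (coverSymm phiSix) :=
  ((Matrix.GeneralLinearGroup.det.ker ⊓ G216.comap Matrix.ProjGenLinGroup.mk).prod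
    (rootsOfUnity 3 ℂ)).subgroupOf (coverSymm phiSix)

/-- The projective transformation underlying a pair `(A, c)`. -/
def liftToPGL : coverSymm phiSix →* PGL(3, ℂ) :=
  (Matrix.ProjGenLinGroup.mk.comp (MonoidHom.fst _ _)).comp (coverSymm phiSix).subtype

/-- The group of automorphisms of `X` by which `Γ` acts. -/
def gamOnX : Subgroup (Aut surfaceX) :=
  (hessianLift ⊓ Gam.comap liftToPGL).map (coverAct phiSix)

end Hesse

/-! ### Quotients by finite groups, resolutions, birational maps -/

/-- `q : X ⟶ Q` is the quotient of `X` by the group `H` of automorphisms of `X`: it is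
`H`-invariant, `Q` is the topological space of orbits, and the functions on an open set of `Q` are
the `H`-invariant functions on its preimage. -/
structure IsQuotientBy {X Q : Over (Spec (.of ℂ))} (H : Subgroup (Aut X)) (q : X ⟶ Q) : Prop where
  invariant : ∀ g ∈ H, g.hom ≫ q = q
  isQuotientMap : Topology.IsQuotientMap q.left
  orbit : ∀ x y : X.left, q.left x = q.left y → ∃ g ∈ H, g.hom.left x = y
  sections : ∀ (U : Q.left.Opens) (s : Γ(X.left, q.left ⁻¹ᵁ U)),
    (∀ g ∈ H, ∃ e : q.left ⁻¹ᵁ U ≤ g.hom.left ⁻¹ᵁ q.left ⁻¹ᵁ U,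
      g.hom.left.appLE (q.left ⁻¹ᵁ U) (q.left ⁻¹ᵁ U) e s = s) →
    ∃! t : Γ(Q.left, U), q.left.app U t = s

/-- `π : Z ⟶ Y` is a resolution of singularities: `Z` is integral and smooth over `ℂ`, and `π` is
proper and birational. -/
structure IsResolution {Z Y : Over (Spec (.of ℂ))} (π : Z ⟶ Y) : Prop where
  integral : IsIntegral Z.left
  smooth : Smooth Z.hom
  proper : IsProper π.left
  birational : ∃ U : Y.left.Opens, Dense (U : Set Y.left) ∧
    Dense ((π.left ⁻¹ᵁ U : Z.left.Opens) : Set Z.left) ∧ IsIso (π.left ∣_ U)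

/-- `π` is the minimal resolution: a resolution through which every resolution factors. -/
structure IsMinimalResolution {Z Y : Over (Spec (.of ℂ))} (π : Z ⟶ Y) : Prop where
  isResolution : IsResolution π
  factors : ∀ (W : Over (Spec (.of ℂ))) (ρ : W ⟶ Y), IsResolution ρ → ∃! σ : W ⟶ Z, σ ≫ π = ρ

/-- The birational isomorphism `f : S ⇢ T` transforms the automorphism `a` of `S` into the
automorphism `b` of `T`: `f ∘ a = b ∘ f` as rational maps. -/
def Intertwines {S T : Over (Spec (.of ℂ))} (f : S.left.PartialIso T.left)
    (a : Aut S) (b : Aut T) : Prop :=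
  ((Scheme.PartialIso.ofIso ((Over.forget _).mapIso a)).trans f).toRationalMap =
    (f.trans (Scheme.PartialIso.ofIso ((Over.forget _).mapIso b))).toRationalMap

end

noncomputable section

/-! ### Functions on affine open sets -/

namespace AlgebraicGeometry

/-! The quotient map is explicit. Put a = x³ + y³ + z³, e = x³y³ + x³z³ + y³z³ and V = (x³ − y³)(y³
− z³)(z³ − x³), so that Φ₆ = a² − 12e, and hence 12e = a² + w² on X. The functions xyz, a, w, V are
Γ-invariant. They satisfy the relation that writes V² as the discriminant of the cubic with roots
x³, y³, z³, with e eliminated. In the coordinates x' = −3xyz, y' and z' = (a ± w/√3)/2, w' = 3√3 V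
this relation is w'² + Φ₆'(x', y', z') = 0 (`sq_add_phiSixAt'_eq_zero`). The result is a ring
homomorphism `heisMap` from the coordinate ring of Y' to that of X, multiplying degrees by three. It
is injective because it is surjective on points of the affine cones (`exists_aeval_heisPoly_eq`). In
degrees divisible by three its image contains every element fixed by g₁ and g₂
(`exists_heisMap_eq`), which is seen by averaging monomials over Γ.

Consequently the functions on the chart w' ≠ 0 of Y' are the Γ-invariant functions on its preimage
in X (`gamChartMap_fixed_iff`). For a finite group acting on an affine chart, the spectrum of the
invariants is an open subscheme of any quotient Q (`IsQuotientBy.exists_isOpenImmersion`). The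
resolution X' → Y' is an isomorphism over a dense open set, so Q and X' share a dense open subscheme
of this chart. This gives f (`exists_partialIso_intertwines`).

On the group side, g₁ and g₂ commute up to the scalar ε, so commutators of lifts put a symplectic
form on Γ ≅ 𝔽₃². Conjugation by the Hessian group preserves it, which defines `conjMatrix` with
values in SL(2, 𝔽₃). The kernel is Γ, because a matrix commuting with g₁ and g₂ is scalar.
Surjectivity holds because the discrete Fourier transform and a diagonal matrix map to generators.

These two elements act linearly on (x', y', z') and fix w'. Hence every element of the Hessian group
has a lift to X compatible with a symmetry of Y' (`compatibleToG216_surjective`). Since Γ acts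
trivially on the invariants, the action on Y' factors through SL(2, 𝔽₃) (`slAct`), and it lifts to
X' by the unique factorization of resolutions. A lift acting trivially on X' fixes every ratio of a
cubic form to w'. It therefore multiplies x', y', z' by a common cube root of unity, hence also the
cubics of the Hesse pencil, and so it lies over Γ (`mk_mem_Gam`). -/

theorem mem_basicOpen_prod {X : Scheme} {U : X.Opens} {ι : Type*} (s : Finset ι) (f : ι → Γ(X, U))
    {x : X} (hx : x ∈ U) (h : ∀ i ∈ s, x ∈ X.basicOpen (f i)) :
    x ∈ X.basicOpen (∏ i ∈ s, f i) := by
  classical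
  induction s using Finset.induction_on with
  | empty =>
    rw [Finset.prod_empty, X.basicOpen_of_isUnit isUnit_one]
    exact hx
  | insert i s hi ih =>
    rw [Finset.prod_insert hi, Scheme.basicOpen_mul]
    exact ⟨h i (Finset.mem_insert_self _ _), ih fun j hj => h j (Finset.mem_insert_of_mem hj)⟩

/-- Finitely many points of an open subset `W` of an affine open set lie in a common basic open
subset of `W`. -/
theorem IsAffineOpen.exists_basicOpen_le_of_finite {X : Scheme} {U W : X.Opens}
    (hU : IsAffineOpen U) (hW : W ≤ U) {ι : Type*} [Fintype ι] (x : ι → X) (hx : ∀ i, x i ∈ W) :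
    ∃ f : Γ(X, U), X.basicOpen f ≤ W ∧ ∀ i, x i ∈ X.basicOpen f := by
  classical
  -- The functions whose nonvanishing locus lies in `W` form an ideal. If each of them vanished at
  -- some `x i`, prime avoidance would put this ideal inside the prime of a single point, although
  -- basic open sets form a basis of the affine `U`.
  let I : Ideal Γ(X, U) :=
    { carrier := {f | X.basicOpen f ≤ W}
      add_mem' := fun {a b} ha hb => (X.basicOpen_add_le a b).trans (sup_le ha hb)
      zero_mem' := by
        change X.basicOpen 0 ≤ W
        rw [Scheme.basicOpen_zero]
        exact bot_le
      smul_mem' := fun c f hf => by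
        change X.basicOpen (c * f) ≤ W
        rw [Scheme.basicOpen_mul]
        exact inf_le_right.trans hf }
  let P (i : ι) : Ideal Γ(X, U) :=
    (IsLocalRing.maximalIdeal (X.presheaf.stalk (x i))).comap
      (X.presheaf.germ U (x i) (hW (hx i))).hom
  have hP (i : ι) (f : Γ(X, U)) : f ∈ P i ↔ x i ∉ X.basicOpen f := by
    rw [Scheme.mem_basicOpen _ _ _ (hW (hx i)), Ideal.mem_comap, IsLocalRing.mem_maximalIdeal,
      mem_nonunits_iff]
  by_contra! hcon
  rcases isEmpty_or_nonempty ι with hι | ⟨⟨i₀⟩⟩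
  · obtain ⟨i, -⟩ := hcon 0 (by rw [Scheme.basicOpen_zero]; exact bot_le)
    exact hι.false i
  have hsub : (I : Set Γ(X, U)) ⊆ ⋃ i ∈ ((Finset.univ : Finset ι) : Set ι), (P i : Set _) := by
    intro f hf
    obtain ⟨i, hi⟩ := hcon f hf
    exact Set.mem_biUnion (Finset.mem_coe.mpr (Finset.mem_univ i)) ((hP i f).mpr hi)
  -- The two arguments `i₀` are the indices exempted from primality. All the ideals are prime here,
  -- so any index serves.
  obtain ⟨i, -, hi⟩ := (Ideal.subset_union_prime i₀ i₀ fun i _ _ _ => inferInstance).mp hsub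
  obtain ⟨f, hf, hxf⟩ := hU.exists_basicOpen_le ⟨x i, hx i⟩ (hW (hx i))
  exact (hP i f).mp (hi hf) hxf

end AlgebraicGeometry

/-! ### Quotients by groups of automorphisms -/

namespace IsQuotientBy

open TopologicalSpace

variable {X Q : Over (Spec (.of ℂ))} {H : Subgroup (Aut X)} {q : X ⟶ Q}

theorem left_invariant (hq : IsQuotientBy H q) {g : Aut X} (hg : g ∈ H) :
    g.hom.left ≫ q.left = q.left :=
  congrArg CommaMorphism.left (hq.invariant g hg)

theorem preimage_le (hq : IsQuotientBy H q) {g : Aut X} (hg : g ∈ H) (U : Q.left.Opens) :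
    q.left ⁻¹ᵁ U ≤ g.hom.left ⁻¹ᵁ q.left ⁻¹ᵁ U := by
  rw [← Scheme.Hom.comp_preimage, hq.left_invariant hg]

/-- The action of the group on the sections over the preimage of an open set of the quotient. -/
def act (hq : IsQuotientBy H q) (U : Q.left.Opens) (g : H) :
    Γ(X.left, q.left ⁻¹ᵁ U) →+* Γ(X.left, q.left ⁻¹ᵁ U) :=
  (g.1.hom.left.appLE _ _ (hq.preimage_le g.2 U)).hom

theorem act_app (hq : IsQuotientBy H q) (U : Q.left.Opens) (g : H) (t : Γ(Q.left, U)) :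
    hq.act U g (q.left.app U t) = q.left.app U t := by
  have := Scheme.Hom.comp_appLE g.1.hom.left q.left U (q.left ⁻¹ᵁ U) (hq.preimage_le g.2 U)
  simp only [hq.left_invariant g.2] at this
  rw [← Scheme.Hom.app_eq_appLE] at this
  exact (congrArg (fun f => f.hom t) this).symm

/-- The order is reversed: `g * h` is `h` followed by `g`, and pullback of functions is
contravariant. -/
theorem act_mul (hq : IsQuotientBy H q) (U : Q.left.Opens) (g h : H)
    (s : Γ(X.left, q.left ⁻¹ᵁ U)) : hq.act U (g * h) s = hq.act U h (hq.act U g s) := by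
  have := Scheme.Hom.appLE_comp_appLE (f := h.1.hom.left) (g := g.1.hom.left) (q.left ⁻¹ᵁ U)
    (q.left ⁻¹ᵁ U) (q.left ⁻¹ᵁ U) (hq.preimage_le g.2 U) (hq.preimage_le h.2 U)
  exact (congrArg (fun f => f.hom s) this).symm

theorem app_injective (hq : IsQuotientBy H q) (U : Q.left.Opens) :
    Function.Injective (q.left.app U) := by
  intro t t' h
  refine (hq.sections U (q.left.app U t) fun g hg => ⟨hq.preimage_le hg U, ?_⟩).unique rfl h.symm
  exact hq.act_app U ⟨g, hg⟩ t

theorem exists_app_eq (hq : IsQuotientBy H q) (U : Q.left.Opens) (s : Γ(X.left, q.left ⁻¹ᵁ U))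
    (hs : ∀ g, hq.act U g s = s) : ∃ t, q.left.app U t = s :=
  (hq.sections U s fun g hg => ⟨hq.preimage_le hg U, hs ⟨g, hg⟩⟩).exists

theorem surjective (hq : IsQuotientBy H q) : Function.Surjective q.left :=
  hq.isQuotientMap.surjective

/-- A quotient morphism is an epimorphism of schemes. -/
theorem hom_ext (hq : IsQuotientBy H q) {T : Scheme} {f g : Q.left ⟶ T}
    (h : q.left ≫ f = q.left ≫ g) : f = g := by
  have hb : f.base = g.base := by
    ext y
    obtain ⟨x, rfl⟩ := hq.surjective y
    exact congrArg (fun k : X.left ⟶ T => k.base x) h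
  refine Scheme.Hom.ext hb fun U => ?_
  have key : (f.app U ≫ Q.left.presheaf.map (eqToHom congr((Opens.map $hb.symm).obj U)).op) ≫
      q.left.app (g ⁻¹ᵁ U) = g.app U ≫ q.left.app (g ⁻¹ᵁ U) := by
    rw [Scheme.Hom.app_eq_appLE f, Scheme.Hom.appLE_map, Scheme.Hom.app_eq_appLE q.left,
      Scheme.Hom.appLE_comp_appLE, Scheme.Hom.app_eq_appLE g, Scheme.Hom.appLE_comp_appLE]
    simp only [h]
  ext s
  exact hq.app_injective _ (congrArg (fun k => k.hom s) key)

/-! ### Descent of invariant morphisms to the quotient. -/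

section Desc

variable {T : Scheme} (f : X.left ⟶ T)

theorem factorsThrough (hq : IsQuotientBy H q) (hf : ∀ g ∈ H, g.hom.left ≫ f = f) :
    Function.FactorsThrough f q.left := by
  intro x y hxy
  obtain ⟨g, hg, rfl⟩ := hq.orbit x y hxy
  rw [← Scheme.Hom.comp_apply, hf g hg]

/-- The continuous map underlying the factorization of an invariant morphism. -/
def descBase (hq : IsQuotientBy H q) (hf : ∀ g ∈ H, g.hom.left ≫ f = f) :
    C(Q.left, T) :=
  hq.isQuotientMap.lift (f := ⟨q.left, q.left.continuous⟩) ⟨f, f.continuous⟩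
    (hq.factorsThrough f hf)

theorem descBase_apply (hq : IsQuotientBy H q) (hf : ∀ g ∈ H, g.hom.left ≫ f = f) (x : X.left) :
    hq.descBase f hf (q.left x) = f x :=
  congrArg (fun k => k x) (hq.isQuotientMap.lift_comp (f := ⟨q.left, q.left.continuous⟩)
    ⟨f, f.continuous⟩ (hq.factorsThrough f hf))

/-- The preimage of an open set under the factorization of an invariant morphism. -/
def descOpens (hq : IsQuotientBy H q) (hf : ∀ g ∈ H, g.hom.left ≫ f = f) (V : T.Opens) :
    Q.left.Opens :=
  V.comap (hq.descBase f hf)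

theorem preimage_descOpens_le (hq : IsQuotientBy H q) (hf : ∀ g ∈ H, g.hom.left ≫ f = f)
    (V : T.Opens) : q.left ⁻¹ᵁ hq.descOpens f hf V ≤ f ⁻¹ᵁ V := by
  intro x hx
  have hx' : hq.descBase f hf (q.left x) ∈ V := hx
  rwa [descBase_apply] at hx'

/-- The pullback of a section under an invariant morphism is an invariant section, hence descends.
Uniqueness of the descended section makes the choice in `descApp` a ring homomorphism. -/
theorem exists_desc_section (hq : IsQuotientBy H q) (hf : ∀ g ∈ H, g.hom.left ≫ f = f)
    (V : T.Opens) (t : Γ(T, V)) : ∃ s : Γ(Q.left, hq.descOpens f hf V),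
      q.left.app _ s = f.appLE V _ (hq.preimage_descOpens_le f hf V) t := by
  refine hq.exists_app_eq _ _ fun g => ?_
  have := Scheme.Hom.appLE_comp_appLE g.1.hom.left f V _ _ (hq.preimage_descOpens_le f hf V)
    (hq.preimage_le g.2 _)
  simp only [hf g.1 g.2] at this
  exact congrArg (fun k => k.hom t) this

/-- The map on sections of the factorization of an invariant morphism. -/
def descApp (hq : IsQuotientBy H q) (hf : ∀ g ∈ H, g.hom.left ≫ f = f) (V : T.Opens) :
    Γ(T, V) →+* Γ(Q.left, hq.descOpens f hf V) where
  toFun t := (hq.exists_desc_section f hf V t).choose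
  map_one' := hq.app_injective _ <| by
    rw [(hq.exists_desc_section f hf V 1).choose_spec, map_one, map_one]
  map_mul' s t := hq.app_injective _ <| by
    rw [(hq.exists_desc_section f hf V (s * t)).choose_spec, map_mul, map_mul,
      (hq.exists_desc_section f hf V s).choose_spec, (hq.exists_desc_section f hf V t).choose_spec]
  map_zero' := hq.app_injective _ <| by
    rw [(hq.exists_desc_section f hf V 0).choose_spec, map_zero, map_zero]
  map_add' s t := hq.app_injective _ <| by
    rw [(hq.exists_desc_section f hf V (s + t)).choose_spec, map_add, map_add,
      (hq.exists_desc_section f hf V s).choose_spec, (hq.exists_desc_section f hf V t).choose_spec]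

theorem app_descApp (hq : IsQuotientBy H q) (hf : ∀ g ∈ H, g.hom.left ≫ f = f) (V : T.Opens)
    (t : Γ(T, V)) : q.left.app _ (hq.descApp f hf V t) =
      f.appLE V _ (hq.preimage_descOpens_le f hf V) t :=
  (hq.exists_desc_section f hf V t).choose_spec

/-- The morphism of sheafed spaces underlying the factorization of an invariant morphism. -/
def descPresheafed (hq : IsQuotientBy H q) (hf : ∀ g ∈ H, g.hom.left ≫ f = f) :
    Q.left.toPresheafedSpace ⟶ T.toPresheafedSpace where
  base := TopCat.ofHom (hq.descBase f hf)
  c :=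
    { app V := CommRingCat.ofHom (hq.descApp f hf V.unop)
      naturality V W i := by
        ext t
        refine hq.app_injective (hq.descOpens f hf W.unop) ?_
        refine (hq.app_descApp f hf W.unop (T.presheaf.map i t)).trans ?_
        have h1 := Scheme.Hom.map_appLE f (hq.preimage_descOpens_le f hf W.unop) i
        have h2 := Scheme.Hom.appLE_map f (hq.preimage_descOpens_le f hf V.unop)
          (homOfLE (show q.left ⁻¹ᵁ hq.descOpens f hf W.unop ≤ q.left ⁻¹ᵁ hq.descOpens f hf V.unop
            from fun x hx => i.unop.le hx)).op
        have h3 := congrArg (fun k => k.hom (hq.descApp f hf V.unop t)) (q.left.naturality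
          (homOfLE (show hq.descOpens f hf W.unop ≤ hq.descOpens f hf V.unop
            from fun x hx => i.unop.le hx)).op)
        refine Eq.trans ?_ h3.symm
        refine (congrArg (fun k => k.hom t) (h1.trans h2.symm)).trans ?_
        exact congrArg (X.left.presheaf.map _) (hq.app_descApp f hf V.unop t).symm }

/-- The factorization of an invariant morphism through the quotient. -/
def desc (hq : IsQuotientBy H q) (hf : ∀ g ∈ H, g.hom.left ≫ f = f) : Q.left ⟶ T where
  __ := hq.descPresheafed f hf
  prop y := by
    obtain ⟨x, rfl⟩ := hq.surjective y
    refine ⟨fun a ha => ?_⟩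
    obtain ⟨V, hV, t, rfl⟩ := T.presheaf.exists_germ_eq a
    have h1 := PresheafedSpace.stalkMap_germ_apply (hq.descPresheafed f hf) V (q.left x) hV t
    have h2 : IsUnit (Q.left.presheaf.germ (hq.descOpens f hf V) (q.left x) hV
        (hq.descApp f hf V t)) := by
      refine h1 ▸ ha
    -- Locality is inherited from `f`: invertibility at `q x` is pulled back to `x` through basic
    -- open sets and read there as invertibility of the pullback of `t` along `f`.
    have h3 : x ∈ q.left ⁻¹ᵁ Q.left.basicOpen (hq.descApp f hf V t) :=
      (Scheme.mem_basicOpen _ _ (q.left x) hV).mpr h2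
    rw [Scheme.Hom.preimage_basicOpen, hq.app_descApp, Scheme.basicOpen_appLE] at h3
    refine (Scheme.mem_basicOpen _ _ _ hV).mp ?_
    change hq.descBase f hf (q.left x) ∈ _
    rw [descBase_apply]
    exact h3.2

theorem fac (hq : IsQuotientBy H q) (hf : ∀ g ∈ H, g.hom.left ≫ f = f) :
    q.left ≫ hq.desc f hf = f := by
  have hb : (q.left ≫ hq.desc f hf).base = f.base := by
    ext x
    exact hq.descBase_apply f hf x
  refine Scheme.Hom.ext hb fun U => ?_
  ext t
  have h1 := congrArg (X.left.presheaf.map (eqToHom congr((Opens.map $hb.symm).obj U)).op)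
    (hq.app_descApp f hf U t)
  have h2 := Scheme.Hom.appLE_map f (hq.preimage_descOpens_le f hf U)
    (eqToHom (congr((Opens.map $hb.symm).obj U))).op
  refine h1.trans ((congrArg (fun k => k.hom t) h2).trans ?_)
  exact congrArg (fun k => k.hom t) (Scheme.Hom.appLE_eq_app f)

end Desc

/-- An automorphism normalizing the group descends to the quotient. -/
theorem exists_aut (hq : IsQuotientBy H q) (N : Subgroup (Aut X))
    (hN : ∀ n ∈ N, ∀ g ∈ H, n * g * n⁻¹ ∈ H) {h : Aut X} (hh : h ∈ N) :
    ∃ a : Aut Q, h.hom ≫ q = q ≫ a.hom := by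
  -- Since `N` normalizes `H`, moving `g` past `n` turns it into another element of `H`, which `q`
  -- absorbs.
  have inv (n : Aut X) (hn : n ∈ N) :
      ∀ g ∈ H, g.hom.left ≫ (n.hom.left ≫ q.left) = n.hom.left ≫ q.left := by
    intro g hg
    have h1 := hq.invariant _ (hN n hn g hg)
    have h2 : n.hom ≫ (n * g * n⁻¹).hom = g.hom ≫ n.hom :=
      congrArg Iso.hom (show n * g * n⁻¹ * n = n * g by group)
    have h3 : g.hom ≫ n.hom ≫ q = n.hom ≫ q := by
      rw [← reassoc_of% h2, h1]
    exact congrArg CommaMorphism.left h3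
  let a₁ := hq.desc _ (inv h hh)
  let a₂ := hq.desc _ (inv h⁻¹ (N.inv_mem hh))
  have e₁ : q.left ≫ a₁ = h.hom.left ≫ q.left := hq.fac _ _
  have e₂ : q.left ≫ a₂ = h⁻¹.hom.left ≫ q.left := hq.fac _ _
  have i₁ : h.hom.left ≫ h⁻¹.hom.left = 𝟙 _ := by
    rw [← Over.comp_left]; exact congrArg CommaMorphism.left h.hom_inv_id
  have i₂ : h⁻¹.hom.left ≫ h.hom.left = 𝟙 _ := by
    rw [← Over.comp_left]; exact congrArg CommaMorphism.left h.inv_hom_id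
  have w : a₁ ≫ Q.hom = Q.hom := hq.hom_ext (by
    rw [reassoc_of% e₁, Over.w, Over.w])
  refine ⟨Over.isoMk ⟨a₁, a₂, hq.hom_ext ?_, hq.hom_ext ?_⟩ w, ?_⟩
  · rw [reassoc_of% e₁, e₂, reassoc_of% i₁, Category.comp_id]
  · rw [reassoc_of% e₂, e₁, reassoc_of% i₂, Category.comp_id]
  · refine Over.OverMorphism.ext ?_
    exact e₁.symm

theorem act_preimage_basicOpen_le (hq : IsQuotientBy H q) (U : Q.left.Opens) (g : H)
    (s : Γ(X.left, q.left ⁻¹ᵁ U)) :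
    X.left.basicOpen (hq.act U g s) = q.left ⁻¹ᵁ U ⊓ g.1.hom.left ⁻¹ᵁ X.left.basicOpen s :=
  Scheme.basicOpen_appLE _ _ _ _ _

/-- A point of a quotient has a neighbourhood basis of sets defined by functions on a
given open set whose preimage is affine. -/
theorem exists_basicOpen_le (hq : IsQuotientBy H q) [Finite H] (U W : Q.left.Opens)
    (hU : IsAffineOpen (q.left ⁻¹ᵁ U)) (hW : W ≤ U) (y : Q.left) (hy : y ∈ W) :
    ∃ r : Γ(Q.left, U), Q.left.basicOpen r ≤ W ∧ y ∈ Q.left.basicOpen r := by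
  classical
  have := Fintype.ofFinite H
  obtain ⟨x, rfl⟩ := hq.surjective y
  have horb (g : H) : g.1.hom.left x ∈ q.left ⁻¹ᵁ W := by
    change q.left (g.1.hom.left x) ∈ W
    rwa [← Scheme.Hom.comp_apply, hq.left_invariant g.2]
  obtain ⟨f, hf, hxf⟩ : ∃ f : Γ(X.left, q.left ⁻¹ᵁ U), X.left.basicOpen f ≤ q.left ⁻¹ᵁ W ∧
      ∀ g : H, g.1.hom.left x ∈ X.left.basicOpen f :=
    hU.exists_basicOpen_le_of_finite (fun z hz => hW hz) _ horb
  -- The function `f` is nonzero along the whole orbit of `x`. Its norm is invariant, still nonzero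
  -- at `x`, and its nonvanishing locus lies in that of `f`.
  have hinv : ∀ h, hq.act U h (∏ g : H, hq.act U g f) = ∏ g : H, hq.act U g f := by
    intro h
    rw [map_prod]
    simp only [← act_mul]
    exact Fintype.prod_equiv (Equiv.mulRight h) _ _ fun g => rfl
  obtain ⟨r, hr⟩ := hq.exists_app_eq U _ hinv
  have hle : q.left ⁻¹ᵁ Q.left.basicOpen r ≤ X.left.basicOpen f := by
    rw [Scheme.Hom.preimage_basicOpen, hr, ← Finset.mul_prod_erase _ _ (Finset.mem_univ 1),
      Scheme.basicOpen_mul]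
    refine inf_le_left.trans ?_
    rw [act_preimage_basicOpen_le]
    exact inf_le_right
  refine ⟨r, ?_, ?_⟩
  · intro z hz
    obtain ⟨x', rfl⟩ := hq.surjective z
    exact hf (hle hz)
  · change x ∈ q.left ⁻¹ᵁ Q.left.basicOpen r
    rw [Scheme.Hom.preimage_basicOpen, hr]
    refine mem_basicOpen_prod _ _ (hW hy) fun g _ => ?_
    rw [act_preimage_basicOpen_le]
    exact ⟨hW hy, hxf g⟩

/-- An open set of a quotient by a finite group is affine if its preimage is. -/
theorem isAffineOpen (hq : IsQuotientBy H q) [Finite H] (U : Q.left.Opens)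
    (hU : IsAffineOpen (q.left ⁻¹ᵁ U))
    (hH : IsUnit ((Nat.card H : ℕ) : Γ(Q.left, U))) :
    IsAffineOpen U := by
  classical
  have := Fintype.ofFinite H
  refine isAffineOpen_of_isAffineOpen_basicOpen U
    {r | IsAffineOpen (Q.left.basicOpen r)} ?_ fun r hr => hr
  set I := Ideal.span {r : Γ(Q.left, U) | IsAffineOpen (Q.left.basicOpen r)} with hI
  -- Affineness of `U` reduces to `I` being the unit ideal. This is clear after pulling back to the
  -- affine preimage, where the basic open sets of functions from `I` form a cover. The trace then
  -- brings it down to `U`.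
  have hspan : I.map (q.left.app U).hom = ⊤ := by
    rw [hI, Ideal.map_span, ← hU.iSup_basicOpen_eq_self_iff]
    refine le_antisymm (iSup_le fun f => X.left.basicOpen_le _) fun x hx => ?_
    obtain ⟨_, ⟨V, hV, rfl⟩, hxV, hVU⟩ :=
      Q.left.isBasis_affineOpens.exists_subset_of_mem_open (show q.left x ∈ U from hx) U.2
    obtain ⟨r, hr, hxr⟩ := hq.exists_basicOpen_le U V hU hVU _ hxV
    have hr' : IsAffineOpen (Q.left.basicOpen r) := by
      have h := IsAffineOpen.basicOpen hV (Q.left.presheaf.map (homOfLE hVU).op r)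
      have e := Q.left.basicOpen_res r (homOfLE (show V ≤ U from hVU)).op
      exact (e.trans (inf_eq_right.mpr hr)) ▸ h
    refine Opens.mem_iSup.mpr ⟨⟨_, r, hr', rfl⟩, ?_⟩
    have : x ∈ q.left ⁻¹ᵁ Q.left.basicOpen r := hxr
    rwa [Scheme.Hom.preimage_basicOpen] at this
  -- The trace of an element of the extended ideal comes from `I`. The factor `c` is carried along
  -- so that the induction over the span survives multiplication by arbitrary functions upstairs.
  have htr : ∀ v ∈ I.map (q.left.app U).hom, ∀ c, ∃ i ∈ I,
      q.left.app U i = ∑ g : H, hq.act U g (c * v) := by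
    intro v hv
    refine Submodule.span_induction (p := fun v _ => ∀ c, ∃ i ∈ I,
      q.left.app U i = ∑ g : H, hq.act U g (c * v)) ?_ ?_ ?_ ?_ hv
    · rintro _ ⟨i, hi, rfl⟩ c
      obtain ⟨t, ht⟩ := hq.exists_app_eq U (∑ g : H, hq.act U g c) fun h => by
        rw [map_sum]
        simp only [← act_mul]
        exact Fintype.sum_equiv (Equiv.mulRight h) _ _ fun g => rfl
      refine ⟨t * i, I.mul_mem_left t hi, ?_⟩
      rw [map_mul, ht, Finset.sum_mul]
      refine Finset.sum_congr rfl fun g _ => ?_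
      rw [map_mul]
      congr 1
      exact (hq.act_app U g i).symm
    · intro c
      exact ⟨0, I.zero_mem, by simp⟩
    · intro v w _ _ hv hw c
      obtain ⟨i, hi, h⟩ := hv c
      obtain ⟨j, hj, h'⟩ := hw c
      exact ⟨i + j, I.add_mem hi hj, by simp only [map_add, h, h', mul_add, Finset.sum_add_distrib]⟩
    · intro a v _ hv c
      obtain ⟨i, hi, h⟩ := hv (c * a)
      exact ⟨i, hi, by rw [h, smul_eq_mul, mul_assoc]⟩
  -- The trace of 1 is the order of `H`, a unit.
  obtain ⟨i, hi, h⟩ := htr 1 (hspan ▸ Submodule.mem_top) 1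
  have h' : q.left.app U i = q.left.app U (Nat.card H : ℕ) := by
    rw [h, map_natCast]
    simp
  exact I.eq_top_of_isUnit_mem (hq.app_injective U h' ▸ hi) hH

end IsQuotientBy

/-! ### Affine charts of a quotient as spectra of rings of invariants. -/

namespace IsQuotientBy

open TopologicalSpace

variable {X Q : Over (Spec (.of ℂ))} {H : Subgroup (Aut X)} {q : X ⟶ Q}

/-- The scheme lies over ℂ, so nonzero integers are invertible in its rings of functions. This meets
the condition on the group order in `isAffineOpen`. -/
theorem isUnit_natCast (Q : Over (Spec (.of ℂ))) (U : Q.left.Opens) {n : ℕ} (hn : n ≠ 0) :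
    IsUnit (n : Γ(Q.left, U)) := by
  let c : ℂ →+* Γ(Q.left, U) :=
    (Q.hom.appLE ⊤ U le_top).hom.comp (Scheme.ΓSpecIso (.of ℂ)).inv.hom
  have h : IsUnit (n : ℂ) := (Nat.cast_ne_zero.mpr hn).isUnit
  have h' := h.map c
  rwa [map_natCast] at h'

theorem isIso_appLE_of_image_eq {Y Z : Scheme} (i : Y ⟶ Z) [IsOpenImmersion i] {W : Z.Opens}
    (hW : i.opensRange = W) (hle : ⊤ ≤ i ⁻¹ᵁ W) : IsIso (i.appLE W ⊤ hle) := by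
  rw [← Scheme.Hom.image_top_eq_opensRange] at hW
  subst hW
  rw [← Scheme.Hom.appIso_hom']
  infer_instance

/-- If a finite group acts on an affine open subscheme `Spec R` of `X` and `R'` is the ring of
invariants, then `Spec R'` is an open subscheme of the quotient. -/
theorem exists_isOpenImmersion (hq : IsQuotientBy H q) [Finite H] {R R' : CommRingCat}
    (i : Spec R ⟶ X.left) [IsOpenImmersion i] (α : H → (R ⟶ R))
    (hα : ∀ g : H, i ≫ g.1.hom.left = Spec.map (α g) ≫ i)
    (φ : R' ⟶ R) (hφ : Function.Injective φ) (hφα : ∀ r, (∀ g, α g r = r) ↔ ∃ r', φ r' = r) :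
    ∃ k : Spec R' ⟶ Q.left, IsOpenImmersion k ∧ Spec.map φ ≫ k = i ≫ q.left ∧
      Function.Surjective (Spec.map φ) := by
  -- The chart is stable under `H` and the fibres of `q` are orbits, so the chart is saturated and
  -- its image is open in the quotient topology.
  have hpre : q.left ⁻¹' (q.left '' Set.range i) = Set.range i := by
    refine Set.Subset.antisymm ?_ (Set.subset_preimage_image _ _)
    rintro x ⟨_, ⟨z, rfl⟩, hz⟩
    obtain ⟨g, hg, rfl⟩ := hq.orbit _ _ hz
    refine ⟨Spec.map (α ⟨g, hg⟩) z, ?_⟩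
    rw [← Scheme.Hom.comp_apply, ← hα ⟨g, hg⟩, Scheme.Hom.comp_apply]
  have hopen : IsOpen (q.left '' Set.range i) := by
    rw [← hq.isQuotientMap.isOpen_preimage, hpre]
    exact i.opensRange.isOpen
  let U : Q.left.Opens := ⟨q.left '' Set.range i, hopen⟩
  have hU : i.opensRange = q.left ⁻¹ᵁ U := Opens.ext hpre.symm
  have hUa : IsAffineOpen U :=
    hq.isAffineOpen U (hU ▸ isAffineOpen_opensRange i) (isUnit_natCast Q U Nat.card_pos.ne')
  have hle : (⊤ : (Spec R).Opens) ≤ i ⁻¹ᵁ q.left ⁻¹ᵁ U := fun z _ => ⟨i z, ⟨z, rfl⟩, rfl⟩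
  have hiso : IsIso (i.appLE (q.left ⁻¹ᵁ U) ⊤ hle) := isIso_appLE_of_image_eq i hU hle
  let τ : Γ(X.left, q.left ⁻¹ᵁ U) ⟶ R := i.appLE (q.left ⁻¹ᵁ U) ⊤ hle ≫ (Scheme.ΓSpecIso R).hom
  have hτ : Function.Bijective τ := ConcreteCategory.bijective_of_isIso τ
  have hτα (g : H) (s : Γ(X.left, q.left ⁻¹ᵁ U)) : τ (hq.act U g s) = α g (τ s) := by
    have h1 := Scheme.Hom.appLE_comp_appLE i g.1.hom.left _ _ _ (hq.preimage_le g.2 U) hle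
    have h2 := Scheme.Hom.appLE_comp_appLE (Spec.map (α g)) i _ _ ⊤ hle le_top
    simp only [hα] at h1
    have h3 : g.1.hom.left.appLE _ _ (hq.preimage_le g.2 U) ≫ τ = τ ≫ α g := by
      rw [← Category.assoc, h1, ← h2, Category.assoc, Category.assoc,
        ← Scheme.ΓSpecIso_naturality]
      congr 2
    exact congrArg (fun k => k.hom s) h3
  let ψ : Γ(Q.left, U) ⟶ R := q.left.app U ≫ τ
  have hψ : Function.Injective ψ := hτ.1.comp (hq.app_injective U)
  -- Both rings embed in `R` with the same image, the invariants. Hence functions on `U` are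
  -- identified with `R'`.
  have hrange : ψ.hom.range = φ.hom.range := by
    ext r
    refine Iff.trans ?_ (hφα r)
    constructor
    · rintro ⟨t, rfl⟩ g
      exact (hτα g _).symm.trans (congrArg τ (hq.act_app U g t))
    · intro h
      obtain ⟨s, rfl⟩ := hτ.2 r
      obtain ⟨t, rfl⟩ := hq.exists_app_eq U s fun g => hτ.1 ((hτα g s).trans (h g))
      exact ⟨t, rfl⟩
  let eψ := RingEquiv.ofBijective ψ.hom.rangeRestrict
    ⟨fun a b h => hψ (congrArg Subtype.val h), ψ.hom.rangeRestrict_surjective⟩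
  let eφ := RingEquiv.ofBijective φ.hom.rangeRestrict
    ⟨fun a b h => hφ (congrArg Subtype.val h), φ.hom.rangeRestrict_surjective⟩
  let e : Γ(Q.left, U) ≃+* R' := (eψ.trans (RingEquiv.subringCongr hrange)).trans eφ.symm
  have he : e.toCommRingCatIso.hom ≫ φ = ψ := by
    ext t
    exact congrArg Subtype.val (eφ.apply_symm_apply (RingEquiv.subringCongr hrange (eψ t)))
  have hk : Spec.map φ ≫ Spec.map e.toCommRingCatIso.hom ≫ hUa.fromSpec = i ≫ q.left := by
    have h1 : ψ = (i ≫ q.left).appLE U ⊤ hle ≫ (Scheme.ΓSpecIso R).hom :=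
      (Category.assoc _ _ _).symm.trans
        (congrArg (· ≫ _) (Scheme.Hom.comp_appLE i q.left U ⊤ hle).symm)
    have h2 := IsAffineOpen.SpecMap_appLE_fromSpec (i ≫ q.left) hUa (isAffineOpen_top (Spec R)) hle
    rw [← Spec.map_comp_assoc, he, h1, Spec.map_comp, Category.assoc, h2,
      IsAffineOpen.fromSpec_top, Scheme.isoSpec_Spec_inv, ← Spec.map_comp_assoc, Iso.inv_hom_id,
      Spec.map_id, Category.id_comp]
  refine ⟨Spec.map e.toCommRingCatIso.hom ≫ hUa.fromSpec, inferInstance, hk, fun z => ?_⟩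
  obtain ⟨_, ⟨x, rfl⟩, hx⟩ : (Spec.map e.toCommRingCatIso.hom ≫ hUa.fromSpec) z ∈ U := by
    rw [Scheme.Hom.comp_apply, ← SetLike.mem_coe, ← hUa.range_fromSpec]
    exact ⟨_, rfl⟩
  refine ⟨x, (Spec.map e.toCommRingCatIso.hom ≫ hUa.fromSpec).isOpenEmbedding.injective ?_⟩
  rw [← Scheme.Hom.comp_apply, hk, Scheme.Hom.comp_apply, hx]

end IsQuotientBy

/-! ### Partial isomorphisms evaluated on morphisms -/

namespace AlgebraicGeometry.Scheme.PartialIso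

variable {X Y Z T T' S : Scheme}

/-- The partial isomorphism `f` is defined along `t : T ⟶ X` and takes it to `s : T ⟶ Y`. -/
def Maps (f : X.PartialIso Y) (t : T ⟶ X) (s : T ⟶ Y) : Prop :=
  ∃ l : T ⟶ f.source.toScheme, l ≫ f.source.ι = t ∧ l ≫ f.iso.hom ≫ f.target.ι = s

theorem Maps.precomp {f : X.PartialIso Y} {t : T ⟶ X} {s : T ⟶ Y} (h : f.Maps t s) (l : T' ⟶ T) :
    f.Maps (l ≫ t) (l ≫ s) := by
  obtain ⟨m, rfl, rfl⟩ := h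
  exact ⟨l ≫ m, by simp, by simp⟩

theorem Maps.symm {f : X.PartialIso Y} {t : T ⟶ X} {s : T ⟶ Y} (h : f.Maps t s) :
    f.symm.Maps s t := by
  obtain ⟨m, rfl, rfl⟩ := h
  exact ⟨m ≫ f.iso.hom, by simp [PartialIso.symm], by simp [PartialIso.symm]⟩

theorem Maps.trans' {f : X.PartialIso Y} {g : Y.PartialIso Z} {t : T ⟶ X} {s : T ⟶ Y} {u : T ⟶ Z}
    (hf : f.Maps t s) (hg : g.Maps s u) (e : f.target = g.source) : (f.trans' g e).Maps t u := by
  obtain ⟨m, rfl, rfl⟩ := hf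
  obtain ⟨n, hn, rfl⟩ := hg
  refine ⟨m, rfl, ?_⟩
  have : m ≫ f.iso.hom ≫ (Y.isoOfEq e).hom = n := by
    rw [← cancel_mono g.source.ι, hn]
    simp
  simp only [PartialIso.trans', Iso.trans_hom, ← this, Category.assoc]

theorem Maps.restrictSource {f : X.PartialIso Y} {t : T ⟶ X} {s : T ⟶ Y} (h : f.Maps t s)
    (U : X.Opens) (hU : Dense (U : Set X)) (hU' : U ≤ f.source) (ht : ∀ x, t x ∈ U) :
    (f.restrictSource U hU hU').Maps t s := by
  obtain ⟨m, rfl, rfl⟩ := h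
  have hr : Set.range (m ≫ f.source.ι) ⊆ Set.range U.ι := by
    rintro _ ⟨x, rfl⟩
    rw [Opens.range_ι]
    exact ht x
  let l : T ⟶ U.toScheme := IsOpenImmersion.lift U.ι (m ≫ f.source.ι) hr
  have hl : l ≫ U.ι = m ≫ f.source.ι := IsOpenImmersion.lift_fac U.ι (m ≫ f.source.ι) hr
  have hm : l ≫ X.homOfLE hU' = m := by
    rw [← cancel_mono f.source.ι, Category.assoc, homOfLE_ι, hl]
  refine ⟨l, hl, ?_⟩
  have hi : (Opens.isoOfLE hU').inv ≫ (f.source.ι ⁻¹ᵁ U).ι = X.homOfLE hU' := by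
    rw [← cancel_mono f.source.ι]
    simp
  conv_rhs => rw [← hm]
  simp [PartialIso.restrictSource, reassoc_of% hi]

theorem Maps.restrictTarget {f : X.PartialIso Y} {t : T ⟶ X} {s : T ⟶ Y} (h : f.Maps t s)
    (U : Y.Opens) (hU : Dense (U : Set Y)) (hU' : U ≤ f.target) (hs : ∀ x, s x ∈ U) :
    (f.restrictTarget U hU hU').Maps t s :=
  (h.symm.restrictSource U hU hU' hs).symm

theorem Maps.mem_source {f : X.PartialIso Y} {t : T ⟶ X} {s : T ⟶ Y} (h : f.Maps t s) (x : T) :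
    t x ∈ f.source := by
  obtain ⟨m, rfl, rfl⟩ := h
  exact (m x).2

theorem Maps.mem_target {f : X.PartialIso Y} {t : T ⟶ X} {s : T ⟶ Y} (h : f.Maps t s) (x : T) :
    s x ∈ f.target :=
  h.symm.mem_source x

theorem Maps.trans {f : X.PartialIso Y} {g : Y.PartialIso Z} {t : T ⟶ X} {s : T ⟶ Y} {u : T ⟶ Z}
    (hf : f.Maps t s) (hg : g.Maps s u) : (f.trans g).Maps t u :=
  have hs (x : T) : s x ∈ f.target ⊓ g.source := ⟨hf.mem_target x, hg.mem_source x⟩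
  (hf.restrictTarget _ _ _ hs).trans' (hg.restrictSource _ _ _ hs) _

theorem maps_ofIso (a : X ≅ Y) (t : T ⟶ X) : (ofIso a).Maps t (t ≫ a.hom) :=
  ⟨t ≫ X.topIso.inv, by simp [ofIso], by simp [ofIso]⟩

/-- Partial isomorphisms agreeing on a dense open subscheme define the same rational map. -/
theorem Maps.toRationalMap_eq {f g : X.PartialIso Y} {t : T ⟶ X} {s : T ⟶ Y} [IsOpenImmersion t]
    [IsDominant t] (hf : f.Maps t s) (hg : g.Maps t s) : f.toRationalMap = g.toRationalMap := by
  rw [PartialMap.toRationalMap_eq_iff]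
  have hf' : t.opensRange ≤ f.source := by
    rintro _ ⟨x, rfl⟩
    exact hf.mem_source x
  have hg' : t.opensRange ≤ g.source := by
    rintro _ ⟨x, rfl⟩
    exact hg.mem_source x
  refine ⟨t.opensRange, t.denseRange, hf', hg', ?_⟩
  obtain ⟨m, hm, rfl⟩ := hf
  obtain ⟨n, hn, hs⟩ := hg
  have h1 : t.isoOpensRange.hom ≫ X.homOfLE hf' = m := by
    rw [← cancel_mono f.source.ι]
    simp [hm]
  have h2 : t.isoOpensRange.hom ≫ X.homOfLE hg' = n := by
    rw [← cancel_mono g.source.ι]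
    simp [hn]
  change X.homOfLE hf' ≫ f.iso.hom ≫ f.target.ι = X.homOfLE hg' ≫ g.iso.hom ≫ g.target.ι
  rw [← cancel_epi t.isoOpensRange.hom, reassoc_of% h1, reassoc_of% h2, hs]

/-- The partial isomorphism between two schemes having a common dense open subscheme. -/
def ofOpenImmersions (m : T ⟶ X) (n : T ⟶ Y) [IsOpenImmersion m] [IsDominant m]
    [IsOpenImmersion n] [IsDominant n] : X.PartialIso Y where
  source := m.opensRange
  dense_source := m.denseRange
  target := n.opensRange
  dense_target := n.denseRange
  iso := m.isoOpensRange.symm ≪≫ n.isoOpensRange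

theorem maps_ofOpenImmersions (m : T ⟶ X) (n : T ⟶ Y) [IsOpenImmersion m] [IsDominant m]
    [IsOpenImmersion n] [IsDominant n] : (ofOpenImmersions m n).Maps m n :=
  ⟨m.isoOpensRange.hom, by simp [ofOpenImmersions], by simp [ofOpenImmersions]⟩

theorem isOver_ofOpenImmersions (m : T ⟶ X) (n : T ⟶ Y) [IsOpenImmersion m] [IsDominant m]
    [IsOpenImmersion n] [IsDominant n] {sX : X ⟶ S} {sY : Y ⟶ S} (h : m ≫ sX = n ≫ sY) :
    (ofOpenImmersions m n).IsOver sX sY := by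
  simp only [IsOver, ofOpenImmersions, Iso.trans_hom, Iso.symm_hom, Category.assoc]
  rw [Hom.isoOpensRange_hom_ι_assoc, Iso.inv_comp_eq, Hom.isoOpensRange_hom_ι_assoc, h]

end AlgebraicGeometry.Scheme.PartialIso

/-! ### Automorphisms lift to the minimal resolution -/

/-- Used with `β` an automorphism of `Y`: the composite is one more resolution of `Y`, and its
factorization through the minimal one is the lift of `β`. The open set over which `π` is an
isomorphism is moved along `β`. -/
theorem IsResolution.comp_iso {Z Y Y' : Over (Spec (.of ℂ))} {π : Z ⟶ Y} (hπ : IsResolution π)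
    (β : Y ≅ Y') : IsResolution (π ≫ β.hom) where
  integral := hπ.integral
  smooth := hπ.smooth
  proper := by
    have := hπ.proper
    have : IsIso β.hom.left := inferInstanceAs (IsIso ((Over.forget _).map β.hom))
    rw [Over.comp_left]
    infer_instance
  birational := by
    obtain ⟨U, hU, hU', hi⟩ := hπ.birational
    have i₁ : IsIso β.hom.left := inferInstanceAs (IsIso ((Over.forget _).map β.hom))
    have i₂ : IsIso β.inv.left := inferInstanceAs (IsIso ((Over.forget _).map β.inv))
    have e : β.hom.left ⁻¹ᵁ β.inv.left ⁻¹ᵁ U = U := by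
      rw [← Scheme.Hom.comp_preimage, ← Over.comp_left, β.hom_inv_id]
      rfl
    refine ⟨β.inv.left ⁻¹ᵁ U, ?_, ?_, ?_⟩
    · exact hU.preimage β.inv.left.homeomorph.isOpenMap
    · change Dense ((π.left ⁻¹ᵁ β.hom.left ⁻¹ᵁ β.inv.left ⁻¹ᵁ U : Z.left.Opens) : Set Z.left)
      rwa [e]
    · have h : IsIso (π.left ∣_ (β.hom.left ⁻¹ᵁ β.inv.left ⁻¹ᵁ U)) := by rwa [e]
      have h' : IsIso (β.hom.left ∣_ (β.inv.left ⁻¹ᵁ U)) := inferInstance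
      rw [Over.comp_left, morphismRestrict_comp]
      exact IsIso.comp_isIso' h h'

namespace IsMinimalResolution

variable {Z Y : Over (Spec (.of ℂ))} {π : Z ⟶ Y}

theorem existsUnique_lift (h : IsMinimalResolution π) (β : Aut Y) :
    ∃! σ : Z ⟶ Z, σ ≫ π = π ≫ β.hom :=
  h.factors Z (π ≫ β.hom) (h.isResolution.comp_iso β)

theorem hom_ext (h : IsMinimalResolution π) {σ τ : Z ⟶ Z} (β : Aut Y) (hσ : σ ≫ π = π ≫ β.hom)
    (hτ : τ ≫ π = π ≫ β.hom) : σ = τ :=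
  (h.existsUnique_lift β).unique hσ hτ

/-- The lift of an automorphism to the minimal resolution. -/
def liftHom (h : IsMinimalResolution π) (β : Aut Y) : Z ⟶ Z :=
  (h.existsUnique_lift β).choose

theorem liftHom_comp (h : IsMinimalResolution π) (β : Aut Y) :
    h.liftHom β ≫ π = π ≫ β.hom :=
  (h.existsUnique_lift β).choose_spec.1

theorem liftHom_one (h : IsMinimalResolution π) : h.liftHom 1 = 𝟙 Z :=
  h.hom_ext 1 (h.liftHom_comp 1) ((Category.id_comp π).trans (Category.comp_id π).symm)

theorem liftHom_mul (h : IsMinimalResolution π) (β γ : Aut Y) :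
    h.liftHom (β * γ) = h.liftHom γ ≫ h.liftHom β := by
  refine h.hom_ext (β * γ) (h.liftHom_comp _) ?_
  rw [Category.assoc, h.liftHom_comp, reassoc_of% h.liftHom_comp γ]
  rfl

/-- The action of the automorphism group on the minimal resolution. -/
def lift (h : IsMinimalResolution π) : Aut Y →* Aut Z where
  toFun β :=
    { hom := h.liftHom β
      inv := h.liftHom β⁻¹
      hom_inv_id := by rw [← h.liftHom_mul, inv_mul_cancel, h.liftHom_one]
      inv_hom_id := by rw [← h.liftHom_mul, mul_inv_cancel, h.liftHom_one] }
  map_one' := Iso.ext h.liftHom_one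
  map_mul' β γ := Iso.ext (h.liftHom_mul β γ)

theorem lift_comp (h : IsMinimalResolution π) (β : Aut Y) :
    (h.lift β).hom ≫ π = π ≫ β.hom :=
  h.liftHom_comp β

end IsMinimalResolution

namespace IsResolution

variable {Z Y : Over (Spec (.of ℂ))} {π : Z ⟶ Y}

/-- Morphisms landing in the open set over which `π` is an isomorphism are equal if they become
equal after composition with `π`. -/
theorem eq_of_comp_eq {T : Scheme} {V : Y.left.Opens} (hV : IsIso (π.left ∣_ V))
    {u v : T ⟶ Z.left} (h : u ≫ π.left = v ≫ π.left) (hu : ∀ x, (u ≫ π.left) x ∈ V) : u = v := by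
  have aux (w : T ⟶ Z.left) (hw : ∀ x, (w ≫ π.left) x ∈ V) :
      ∃ l : T ⟶ (π.left ⁻¹ᵁ V).toScheme, l ≫ (π.left ⁻¹ᵁ V).ι = w := by
    have hr : Set.range w ⊆ Set.range (π.left ⁻¹ᵁ V).ι := by
      rintro _ ⟨x, rfl⟩
      rw [Scheme.Opens.range_ι]
      exact hw x
    exact ⟨IsOpenImmersion.lift _ w hr, IsOpenImmersion.lift_fac _ _ _⟩
  obtain ⟨l, rfl⟩ := aux u hu
  obtain ⟨m, rfl⟩ := aux v fun x => by rw [← h]; exact hu x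
  have : l = m := by
    rw [← cancel_mono (π.left ∣_ V), ← cancel_mono V.ι]
    simpa using h
  rw [this]

end IsResolution

/-- An open subscheme `j : S ⟶ Y` is, up to a dense open subset, an open subscheme of every
resolution of `Y`. -/
theorem IsResolution.exists_lift {Z Y : Over (Spec (.of ℂ))} {π : Z ⟶ Y} (hπ : IsResolution π)
    {S : Scheme} (j : S ⟶ Y.left) [IsOpenImmersion j] [Nonempty S] :
    ∃ V : Y.left.Opens, IsIso (π.left ∣_ V) ∧ ((j ⁻¹ᵁ V : S.Opens) : Set S).Nonempty ∧
      ∃ n : (j ⁻¹ᵁ V).toScheme ⟶ Z.left, IsOpenImmersion n ∧ IsDominant n ∧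
        n ≫ π.left = (j ⁻¹ᵁ V).ι ≫ j := by
  obtain ⟨V, hV, -, hi⟩ := hπ.birational
  obtain ⟨_, ⟨s, rfl⟩, hs⟩ : (Set.range j ∩ V).Nonempty := by
    rw [Set.inter_comm]
    exact hV.inter_open_nonempty _ j.opensRange.isOpen (Set.range_nonempty _) |>.mono
      (by rw [Set.inter_comm]; rfl)
  have hne : ((j ⁻¹ᵁ V : S.Opens) : Set S).Nonempty := ⟨s, hs⟩
  let n : (j ⁻¹ᵁ V).toScheme ⟶ Z.left := (j ∣_ V) ≫ inv (π.left ∣_ V) ≫ (π.left ⁻¹ᵁ V).ι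
  have hn : IsOpenImmersion n := inferInstance
  have := hπ.integral
  refine ⟨V, hi, hne, n, hn, ⟨?_⟩, ?_⟩
  · exact (n.opensRange.isOpen).dense ⟨n ⟨s, hs⟩, ⟨_, rfl⟩⟩
  · simp only [n, Category.assoc]
    rw [← morphismRestrict_ι, IsIso.inv_hom_id_assoc, morphismRestrict_ι]

/-! ### Comparison of a quotient with a resolution -/

section Comparison

open Scheme (PartialIso)

variable {X Q Y Z : Over (Spec (.of ℂ))} {H : Subgroup (Aut X)} {q : X ⟶ Q} {π : Z ⟶ Y}
  {R R' : CommRingCat}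

/-- Here `R'` is the ring of `H`-invariants of a chart `Spec R` of `X`, and it is also a chart of
`Y`. Then `Spec R'` is open in `Q`, and a dense open part of it is open in the resolution `Z`. The
partial isomorphism is the identity of this common part. Equivariance is checked on a smaller dense
open set, where it follows from the compatibility `hab` of the two actions on `R` and `R'`. -/
theorem exists_partialIso_intertwines (hq : IsQuotientBy H q) [Finite H]
    (hπ : IsMinimalResolution π)
    (i : Spec R ⟶ X.left) [IsOpenImmersion i] [IsDominant i]
    (j : Spec R' ⟶ Y.left) [IsOpenImmersion j] [IsDomain R']
    (φ : R' ⟶ R) (hφ : Function.Injective φ)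
    (hS : i ≫ X.hom = Spec.map φ ≫ j ≫ Y.hom)
    (α : H → (R ⟶ R)) (hα : ∀ g : H, i ≫ g.1.hom.left = Spec.map (α g) ≫ i)
    (hφα : ∀ r, (∀ g, α g r = r) ↔ ∃ r', φ r' = r)
    {N : Type} [Group N] (u : N →* Aut X) (v : N →* Aut Y)
    (hu : ∀ n, ∀ g ∈ H, u n * g * (u n)⁻¹ ∈ H)
    (a : N → (R ⟶ R)) (ha : ∀ n, i ≫ (u n).hom.left = Spec.map (a n) ≫ i)
    (b : N → (R' ⟶ R')) (hb : ∀ n, j ≫ (v n).hom.left = Spec.map (b n) ≫ j)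
    (hab : ∀ n, φ ≫ a n = b n ≫ φ) :
    ∃ f : Q.left.PartialIso Z.left, f.IsOver Q.hom Z.hom ∧
      ∀ n, ∃ c : Aut Q, (u n).hom ≫ q = q ≫ c.hom ∧ Intertwines f c (hπ.lift (v n)) := by
  obtain ⟨k, hk, hkq, hsurj⟩ := hq.exists_isOpenImmersion i α hα φ hφ hφα
  have hkd : IsDominant k := by
    refine ⟨?_⟩
    have h1 : DenseRange (i ≫ q.left) := by
      rw [Scheme.Hom.comp_base]
      exact hq.surjective.denseRange.comp i.denseRange q.left.continuous
    refine h1.mono ?_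
    rw [← hkq]
    rintro _ ⟨x, rfl⟩
    exact ⟨Spec.map φ x, (Scheme.Hom.comp_apply _ _ _).symm⟩
  have : Mono φ := ConcreteCategory.mono_of_injective φ hφ
  -- Morphisms into an affine scheme may be compared after composing with `Spec.map φ`, as `φ` is
  -- injective.
  have hkS : k ≫ Q.hom = j ≫ Y.hom := by
    refine eq_of_SpecMap_comp_eq_of_isAffineOpen φ hφ ⊤ (isAffineOpen_top _) rfl rfl ?_
    rw [reassoc_of% hkq, Over.w q, hS]
  obtain ⟨V, hV, hne, n, hn, hnd, hnπ⟩ := hπ.isResolution.exists_lift j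
  have hE : IsDominant (j ⁻¹ᵁ V).ι := Opens.isDominant_ι ((j ⁻¹ᵁ V).2.dense hne)
  let m := (j ⁻¹ᵁ V).ι ≫ k
  have hm : IsDominant m := inferInstance
  refine ⟨PartialIso.ofOpenImmersions m n, PartialIso.isOver_ofOpenImmersions m n ?_, fun g => ?_⟩
  · rw [← Over.w π, reassoc_of% hnπ, Category.assoc, hkS]
  obtain ⟨c, hc⟩ := hq.exists_aut u.range (by rintro _ ⟨n, rfl⟩; exact hu n) ⟨g, rfl⟩
  refine ⟨c, hc, ?_⟩
  have hc' : (u g).hom.left ≫ q.left = q.left ≫ c.hom.left := congrArg (·.left) hc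
  have hbφ : Spec.map (a g) ≫ Spec.map φ = Spec.map φ ≫ Spec.map (b g) := by
    rw [← Spec.map_comp, ← Spec.map_comp, hab]
  -- The same cancellation is applied with the affine image of `k` as target. Surjectivity of
  -- `Spec.map φ` shows that the left side also lands there.
  have hkc : k ≫ c.hom.left = Spec.map (b g) ≫ k := by
    have h : Spec.map φ ≫ k ≫ c.hom.left = Spec.map φ ≫ Spec.map (b g) ≫ k := by
      rw [reassoc_of% hkq, ← hc', reassoc_of% ha g, ← hkq, reassoc_of% hbφ]
    refine eq_of_SpecMap_comp_eq_of_isAffineOpen φ hφ k.opensRange (isAffineOpen_opensRange k)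
      ?_ ?_ h
    · refine top_le_iff.mp fun z _ => ?_
      obtain ⟨x, rfl⟩ := hsurj z
      have := congrArg (fun l : Spec R ⟶ Q.left => l x) h
      simp only [Scheme.Hom.comp_apply] at this
      exact ⟨_, this.symm⟩
    · refine top_le_iff.mp fun z _ => ⟨Spec.map (b g) z, rfl⟩
  have hbb : Spec.map (b g⁻¹) ≫ Spec.map (b g) = 𝟙 _ := by
    rw [← cancel_mono j, Category.assoc, ← hb, reassoc_of% (hb g⁻¹).symm, Category.id_comp,
      ← Over.comp_left]
    have : (v g⁻¹).hom ≫ (v g).hom = 𝟙 _ := by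
      rw [map_inv]
      exact (v g).inv_hom_id
    rw [this, Over.id_left, Category.comp_id]
  let E := j ⁻¹ᵁ V
  -- `E` need not be stable under `g`. On `E'` both a point and its translate lie in `E`, and `E'`
  -- is nonempty because `Spec R'` is irreducible and the translation is invertible.
  let E' : (Spec R').Opens := E ⊓ (Spec.map (b g)) ⁻¹ᵁ E
  have hne' : (E' : Set (Spec R')).Nonempty := by
    obtain ⟨e, he⟩ := hne
    refine nonempty_preirreducible_inter E.2 ((Spec.map (b g)) ⁻¹ᵁ E).2 ⟨e, he⟩
      ⟨Spec.map (b g⁻¹) e, ?_⟩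
    change Spec.map (b g) (Spec.map (b g⁻¹) e) ∈ E
    rw [← Scheme.Hom.comp_apply, hbb]
    exact he
  have hE' : IsDominant E'.ι := Opens.isDominant_ι (E'.2.dense hne')
  let l : E'.toScheme ⟶ E.toScheme := (Spec R').homOfLE inf_le_left
  have hl : l ≫ E.ι = E'.ι := Scheme.homOfLE_ι _ _
  have hr : Set.range (E'.ι ≫ Spec.map (b g)) ⊆ Set.range E.ι := by
    rintro _ ⟨x, rfl⟩
    rw [Scheme.Opens.range_ι]
    exact x.2.2
  let l' : E'.toScheme ⟶ E.toScheme := IsOpenImmersion.lift E.ι (E'.ι ≫ Spec.map (b g)) hr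
  have hl' : l' ≫ E.ι = E'.ι ≫ Spec.map (b g) := IsOpenImmersion.lift_fac _ _ _
  have hf : (PartialIso.ofOpenImmersions m n).Maps m n := PartialIso.maps_ofOpenImmersions m n
  have hlift : (hπ.lift (v g)).hom.left ≫ π.left = π.left ≫ (v g).hom.left :=
    congrArg (·.left) (hπ.lift_comp (v g))
  -- Both morphisms land in the locus where `π` is an isomorphism, so the comparison can be made on
  -- `Y`, where the lift becomes `v g`.
  have key : l' ≫ n = (l ≫ n) ≫ (hπ.lift (v g)).hom.left := by
    refine IsResolution.eq_of_comp_eq hV ?_ fun x => ?_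
    · rw [Category.assoc, Category.assoc, Category.assoc, hlift, reassoc_of% hnπ, hnπ, hb,
        reassoc_of% hl, reassoc_of% hl']
    · rw [Category.assoc, hnπ]
      exact (l' x).2
  have h2 : (E'.ι ≫ k) ≫ c.hom.left = l' ≫ m := by
    simp only [m, Category.assoc]
    rw [hkc, reassoc_of% hl']
  have h1 : (PartialIso.ofIso ((Over.forget _).mapIso c)).Maps (E'.ι ≫ k) (l' ≫ m) :=
    h2 ▸ PartialIso.maps_ofIso _ _
  have h3 := h1.trans (hf.precomp l')
  have h4 := hf.precomp l
  have hlm : l ≫ m = E'.ι ≫ k := by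
    simp only [m, ← Category.assoc]
    rw [hl]
  rw [hlm] at h4
  have h5 : (PartialIso.ofIso ((Over.forget _).mapIso (hπ.lift (v g)))).Maps (l ≫ n) (l' ≫ n) :=
    key ▸ PartialIso.maps_ofIso _ _
  exact PartialIso.Maps.toRationalMap_eq (X := Q.left) (Y := Z.left) (t := E'.ι ≫ k) h3
    (h4.trans h5)

/-- The automorphisms of `Y` acting trivially on the resolution act trivially on every integral
affine open subscheme. -/
theorem IsMinimalResolution.eq_id_of_lift_eq_one (hπ : IsMinimalResolution π)
    (j : Spec R' ⟶ Y.left) [IsOpenImmersion j] [IsDomain R'] {β : Aut Y} {b : R' ⟶ R'}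
    (hb : j ≫ β.hom.left = Spec.map b ≫ j) (h : hπ.lift β = 1) : b = 𝟙 R' := by
  obtain ⟨V, hV, hne, n, hn, hnd, hnπ⟩ := hπ.isResolution.exists_lift j
  have hE : IsDominant (j ⁻¹ᵁ V).ι := Opens.isDominant_ι ((j ⁻¹ᵁ V).2.dense hne)
  have h1 : π.left = π.left ≫ β.hom.left := by
    have := congrArg (·.left) (hπ.lift_comp β)
    rw [h] at this
    exact (Category.id_comp _).symm.trans this
  have h2 : (j ⁻¹ᵁ V).ι ≫ Spec.map b = (j ⁻¹ᵁ V).ι ≫ 𝟙 _ := by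
    rw [← cancel_mono j, Category.assoc, ← hb, ← reassoc_of% hnπ, ← h1, hnπ, Category.comp_id]
  have h3 : Spec.map b = 𝟙 _ := ext_of_isDominant (j ⁻¹ᵁ V).ι h2
  exact Spec.map_injective (h3.trans (Spec.map_id _).symm)

end Comparison

/-! ### Maps of affine charts of `Proj` -/

namespace HomogeneousLocalization

variable {A B : Type} [CommRing A] [CommRing B] [Algebra ℂ A] [Algebra ℂ B]
  {𝒜 : ℕ → Submodule ℂ A} {ℬ : ℕ → Submodule ℂ B} [GradedAlgebra 𝒜] [GradedAlgebra ℬ]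

/-- Powers of `s` cancel in a domain. This turns statements about fractions with a common
denominator into statements about homogeneous elements. -/
theorem away_mk_eq_mk_iff [IsDomain B] {s : B} (hs0 : s ≠ 0) {d : ℕ} (hs : s ∈ ℬ d) {n : ℕ}
    {x y : B} (hx : x ∈ ℬ (n • d)) (hy : y ∈ ℬ (n • d)) :
    Away.mk ℬ hs n x hx = Away.mk ℬ hs n y hy ↔ x = y := by
  refine ⟨fun h => ?_, fun h => by subst h; rfl⟩
  have h' := congrArg val h
  rw [Away.val_mk, Away.val_mk, Localization.mk_eq_mk_iff, Localization.r_iff_exists] at h'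
  obtain ⟨⟨_, k, rfl⟩, hk⟩ := h'
  simpa [hs0] using hk

theorem away_isDomain [IsDomain B] {s : B} (hs0 : s ≠ 0) : IsDomain (Away ℬ s) := by
  have : IsDomain (Localization.Away s) := IsLocalization.isDomain_localization
    (powers_le_nonZeroDivisors_of_noZeroDivisors hs0)
  exact Function.Injective.isDomain (algebraMap (Away ℬ s) (Localization.Away s))
    (val_injective _)

section AwayHom

variable (φ : A →+* B) {e : ℕ} (hφ : ∀ n, ∀ x ∈ 𝒜 n, φ x ∈ ℬ (e * n)) {f : A} {d : ℕ}
  (hf : f ∈ 𝒜 d)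

/-- Scaling all degrees by `e` preserves degree zero of fractions, so the map of full localizations
restricts. As `val` is injective, the ring axioms for the restriction can be checked in the full
localization. -/
theorem exists_val_eq_awayMap (φ : A →+* B) {e : ℕ} (hφ : ∀ n, ∀ x ∈ 𝒜 n, φ x ∈ ℬ (e * n))
    {f : A} {d : ℕ} (hf : f ∈ 𝒜 d) (x : Away 𝒜 f) :
    ∃ y : Away ℬ (φ f), y.val = Localization.awayMap φ f x.val := by
  obtain ⟨n, a, ha, rfl⟩ := Away.mk_surjective 𝒜 hf x
  refine ⟨Away.mk ℬ (hφ _ _ hf) n (φ a) ?_, ?_⟩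
  · have := hφ _ _ ha
    rwa [smul_eq_mul, Nat.mul_left_comm] at this
  · rw [Away.val_mk, Away.val_mk, Localization.mk_eq_mk', Localization.mk_eq_mk',
      Localization.awayMap, IsLocalization.Away.map, IsLocalization.map_mk']
    congr 1
    exact Subtype.ext (map_pow φ f n).symm

/-- The map of degree zero localizations induced by a ring homomorphism multiplying degrees
by `e`. -/
def awayHom : Away 𝒜 f →+* Away ℬ (φ f) where
  toFun x := (exists_val_eq_awayMap φ hφ hf x).choose
  map_one' := val_injective _ (by
    rw [(exists_val_eq_awayMap φ hφ hf 1).choose_spec, val_one, val_one, map_one])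
  map_zero' := val_injective _ (by
    rw [(exists_val_eq_awayMap φ hφ hf 0).choose_spec, val_zero, val_zero, map_zero])
  map_mul' x y := val_injective _ (by
    refine (exists_val_eq_awayMap φ hφ hf _).choose_spec.trans ?_
    simp only [(exists_val_eq_awayMap φ hφ hf _).choose_spec, val_mul, map_mul])
  map_add' x y := val_injective _ (by
    refine (exists_val_eq_awayMap φ hφ hf _).choose_spec.trans ?_
    simp only [(exists_val_eq_awayMap φ hφ hf _).choose_spec, val_add, map_add])

theorem awayHom_mk (n : ℕ) (x : A) (hx : x ∈ 𝒜 (n • d)) (hx' : φ x ∈ ℬ (n • (e * d))) :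
    awayHom φ hφ hf (Away.mk 𝒜 hf n x hx) = Away.mk ℬ (hφ _ _ hf) n (φ x) hx' := by
  refine val_injective _ ((exists_val_eq_awayMap φ hφ hf _).choose_spec.trans ?_)
  rw [Away.val_mk, Away.val_mk, Localization.mk_eq_mk', Localization.mk_eq_mk',
    Localization.awayMap, IsLocalization.Away.map, IsLocalization.map_mk']
  congr 1
  exact Subtype.ext (map_pow φ f n)

end AwayHom

/-- The map of degree zero localizations induced by a graded ring homomorphism taking `s`
to `t`. -/
def awayMapOfEq (f : ℬ →+*ᵍ ℬ) {s t : B} (h : f s = t) : Away ℬ s →+* Away ℬ t :=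
  map f (by rintro _ ⟨n, rfl⟩; exact ⟨n, by simp [h]⟩)

theorem awayMapOfEq_mk (f : ℬ →+*ᵍ ℬ) {s t : B} (h : f s = t) {d : ℕ} (hs : s ∈ ℬ d)
    (ht : t ∈ ℬ d) (n : ℕ) (x : B) (hx : x ∈ ℬ (n • d)) :
    awayMapOfEq f h (Away.mk ℬ hs n x hx) = Away.mk ℬ ht n (f x) (f.map_mem hx) := by
  subst h
  exact Away.map_mk f s hs n x hx

end HomogeneousLocalization

/-! ### Affine charts of `Proj` over ℂ and the graded automorphisms on them. -/

namespace Hesse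

open HomogeneousLocalization

variable {B : Type} [CommRing B] [Algebra ℂ B] (ℬ : ℕ → Submodule ℂ B) [GradedAlgebra ℬ]

/-- The affine chart `s ≠ 0` of `Proj`. -/
def chart {s : B} {d : ℕ} (hs : s ∈ ℬ d) (hd : 0 < d) :
    Spec (.of (Away ℬ s)) ⟶ (projOver ℬ).left :=
  Proj.awayι ℬ s hs hd

instance {s : B} {d : ℕ} (hs : s ∈ ℬ d) (hd : 0 < d) : IsOpenImmersion (chart ℬ hs hd) :=
  inferInstanceAs (IsOpenImmersion (Proj.awayι ℬ s hs hd))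

variable {ℬ}

/-- The zero ideal is a point of `Proj` contained in every nonempty basic open set, and in
particular in the chart. -/
theorem isDominant_chart [IsDomain B] {s : B} (hs0 : s ≠ 0) {d : ℕ} (hs : s ∈ ℬ d) (hd : 0 < d) :
    IsDominant (chart ℬ hs hd) := by
  let η : Proj ℬ := ⟨⊥, Ideal.isPrime_bot, fun h =>
    hs0 (h (HomogeneousIdeal.mem_irrelevant_of_mem ℬ hd hs))⟩
  have hη {f : B} (hf : f ≠ 0) : η ∈ Proj.basicOpen ℬ f := hf
  refine ⟨(Proj.isBasis_basicOpen ℬ).dense_iff.mpr ?_⟩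
  rintro _ ⟨_, ⟨f, rfl⟩, rfl⟩ ⟨x, hx⟩
  have hf : f ≠ 0 := by
    rintro rfl
    exact hx (zero_mem _)
  refine ⟨η, hη hf, ?_⟩
  have := hη hs0
  rw [← Proj.opensRange_awayι ℬ s hs hd] at this
  exact this

theorem chart_comp_projHom {f g : ℬ →+*ᵍ ℬ} (h : f.comp g = .id ℬ)
    (hf : ∀ r : ℂ, f (algebraMap ℂ B r) = algebraMap ℂ B r) {s t : B} (hst : f s = t) {d : ℕ}
    (hs : s ∈ ℬ d) (ht : t ∈ ℬ d) (hd : 0 < d) :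
    chart ℬ ht hd ≫ (projHom f g h hf).left =
      Spec.map (CommRingCat.ofHom (awayMapOfEq f hst)) ≫ chart ℬ hs hd := by
  subst hst
  exact Proj.awayι_comp_map f (irrelevant_le_map h) hd s hs

theorem algebraMap_mem_zero (r : ℂ) : algebraMap ℂ B r ∈ ℬ 0 :=
  SetLike.algebraMap_mem_graded ℬ r

/-- The scalars in a degree zero localization. -/
def awayScalar (s : B) : ℂ →+* Away ℬ s :=
  (fromZeroRingHom ℬ _).comp (algebraMap ℂ (ℬ 0))

theorem awayScalar_apply {s : B} {d : ℕ} (hs : s ∈ ℬ d) (r : ℂ) :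
    awayScalar s r = Away.mk ℬ hs 0 (algebraMap ℂ B r)
      (by rw [zero_smul]; exact algebraMap_mem_zero r) := by
  refine val_injective _ ?_
  rw [Away.val_mk]
  change Localization.mk _ _ = _
  congr 1
  exact Subtype.ext (pow_zero s).symm

theorem chart_comp_hom {s : B} {d : ℕ} (hs : s ∈ ℬ d) (hd : 0 < d) :
    chart ℬ hs hd ≫ (projOver ℬ).hom = Spec.map (CommRingCat.ofHom (awayScalar s)) := by
  change Proj.awayι ℬ s hs hd ≫ Proj.toSpecZero ℬ ≫ _ = _
  rw [Proj.awayι_toSpecZero_assoc, ← Spec.map_comp, ← CommRingCat.ofHom_comp]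
  rfl

end Hesse

namespace Hesse

open MvPolynomial

/-! ### The coordinate rings of the double planes are domains -/

/-- Polynomials in `x, y, z, w` as polynomials in `w` over the polynomials in `x, y, z`. -/
def lastEquiv : MvPolynomial (Fin 4) ℂ ≃ₐ[ℂ] Polynomial (MvPolynomial (Fin 3) ℂ) :=
  (renameEquiv ℂ (finRotate 4)).trans (finSuccEquiv ℂ 3)

theorem lastEquiv_X_three : lastEquiv (X 3) = Polynomial.X := by
  have : finRotate 4 3 = 0 := rfl
  simp [lastEquiv, this, finSuccEquiv_X_zero]

theorem lastEquiv_rename (F : MvPolynomial (Fin 3) ℂ) :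
    lastEquiv (rename Fin.castSucc F) = Polynomial.C F := by
  have : (lastEquiv : MvPolynomial (Fin 4) ℂ →ₐ[ℂ] _).comp (rename Fin.castSucc) =
      IsScalarTower.toAlgHom ℂ (MvPolynomial (Fin 3) ℂ) (Polynomial (MvPolynomial (Fin 3) ℂ)) := by
    refine MvPolynomial.algHom_ext fun i => ?_
    have : finRotate 4 i.castSucc = i.succ := by fin_cases i <;> rfl
    simp [lastEquiv, this, finSuccEquiv_X_succ]
  exact DFunLike.congr_fun this F

/-- As a monic quadratic in `w`, the polynomial w² + F factors only if −F is a square. Then every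
partial derivative of F would vanish at each zero of F, so one smooth point of the branch curve is
enough. -/
theorem prime_coverEq {F : Sextic} (p : Fin 3 → ℂ) (hp : eval p F.1 = 0) (i : Fin 3)
    (hi : eval p (pderiv i F.1) ≠ 0) : Prime (coverEq F) := by
  have he : lastEquiv (coverEq F) = Polynomial.X ^ 2 + Polynomial.C F.1 := by
    rw [coverEq, map_add, map_pow, lastEquiv_X_three, lastEquiv_rename]
  have hm : (Polynomial.X ^ 2 + Polynomial.C F.1).Monic :=
    Polynomial.monic_X_pow_add_C _ two_ne_zero
  have hd : (Polynomial.X ^ 2 + Polynomial.C F.1).natDegree = 2 :=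
    Polynomial.natDegree_X_pow_add_C
  rw [← UniqueFactorizationMonoid.irreducible_iff_prime,
    ← MulEquiv.irreducible_iff lastEquiv, he,
    hm.irreducible_iff_roots_eq_zero_of_degree_le_three hd.ge (by omega)]
  refine Multiset.eq_zero_of_forall_notMem fun g hg => hi ?_
  have hg' : F.1 = -(g * g) := by
    have := Polynomial.isRoot_of_mem_roots hg
    simp only [Polynomial.IsRoot, Polynomial.eval_add, Polynomial.eval_pow, Polynomial.eval_X,
      Polynomial.eval_C] at this
    linear_combination this
  have h0 : eval p g = 0 := by
    rw [hg', map_neg, map_mul, neg_eq_zero, mul_self_eq_zero] at hp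
    exact hp
  rw [hg', map_neg, Derivation.leibniz, map_neg, map_add, smul_eq_mul, map_mul, h0]
  ring

theorem exists_pow_eq (c : ℂ) {n : ℕ} (hn : 0 < n) : ∃ x : ℂ, x ^ n = c :=
  IsAlgClosed.exists_pow_nat_eq c hn

theorem prime_coverEq_phiSix : Prime (coverEq phiSix) := by
  obtain ⟨s, hs⟩ := exists_pow_eq 6 two_pos
  -- At (x, 1, 0), with T = x³, the sextic is T² − 10T + 1, whose roots are 5 ± 2√6. They are
  -- simple, and the x-derivative at the chosen point is 12√6 x².
  obtain ⟨x, hx⟩ := exists_pow_eq (5 + 2 * s) three_pos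
  have hs0 : s ≠ 0 := by rintro rfl; norm_num at hs
  have hx0 : x ≠ 0 := by
    rintro rfl
    have h1 : s = -5 / 2 := by linear_combination -hx / 2
    rw [h1] at hs
    norm_num at hs
  refine prime_coverEq ![x, 1, 0] ?_ 0 ?_
  · simp [phiSix]
    linear_combination (x ^ 3 - 5 + 2 * s) * hx + 4 * hs
  · have : eval ![x, 1, 0] (pderiv 0 phiSix.1) = 12 * s * x ^ 2 := by
      have h10 : pderiv (0 : Fin 3) (10 : MvPolynomial (Fin 3) ℂ) = 0 := by
        rw [← map_ofNat (C : ℂ →+* MvPolynomial (Fin 3) ℂ) 10, pderiv_C]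
      simp [phiSix, Derivation.leibniz, Derivation.leibniz_pow, pderiv_X, h10]
      linear_combination 6 * x ^ 2 * hx
    rw [this]
    exact mul_ne_zero (mul_ne_zero (by norm_num) hs0) (pow_ne_zero 2 hx0)

theorem prime_coverEq_phiSix' : Prime (coverEq phiSix') := by
  -- At (x, 1, −1) the sextic Φ₆' reduces to x⁶ + 108.
  obtain ⟨x, hx⟩ := exists_pow_eq (-108) (n := 6) (by norm_num)
  have hx0 : x ≠ 0 := by rintro rfl; norm_num at hx
  refine prime_coverEq ![x, 1, -1] ?_ 0 ?_
  · simp [phiSix']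
    linear_combination hx
  · have : eval ![x, 1, -1] (pderiv 0 phiSix'.1) = 6 * x ^ 5 := by
      have h (n : ℕ) [n.AtLeastTwo] :
          pderiv (0 : Fin 3) (ofNat(n) : MvPolynomial (Fin 3) ℂ) = 0 := by
        rw [← map_ofNat (C : ℂ →+* MvPolynomial (Fin 3) ℂ) n, pderiv_C]
      simp [phiSix', Derivation.leibniz, Derivation.leibniz_pow, pderiv_X, h]
      ring
    rw [this]
    exact mul_ne_zero (by norm_num) (pow_ne_zero 5 hx0)

theorem coverIdeal_isPrime {F : Sextic} (h : Prime (coverEq F)) : (coverIdeal F).IsPrime :=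
  (Ideal.span_singleton_prime h.ne_zero).mpr h

/-! ### The invariants of the Heisenberg group -/

section Identities

variable {R : Type} [CommRing R]

/-- The sextic `Φ₆` evaluated in a ring. -/
def phiSixAt (x y z : R) : R :=
  x ^ 6 + y ^ 6 + z ^ 6 - 10 * (x ^ 3 * y ^ 3 + x ^ 3 * z ^ 3 + y ^ 3 * z ^ 3)

/-- The sextic `Φ₆'` evaluated in a ring. -/
def phiSixAt' (x y z : R) : R :=
  (x ^ 3 + y ^ 3 + z ^ 3) ^ 2 - 36 * y ^ 3 * z ^ 3 + 24 * (z ^ 4 * y ^ 2 + z ^ 2 * y ^ 4)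
    - 12 * (z ^ 5 * y + z * y ^ 5) - 12 * x ^ 3 * (z ^ 2 * y + z * y ^ 2)

/-- The product of the differences of the cubes. -/
def cubeDisc (x y z : R) : R :=
  (x ^ 3 - y ^ 3) * (y ^ 3 - z ^ 3) * (z ^ 3 - x ^ 3)

/-- Φ₆' is symmetric in y and z. In terms of y + z and yz it takes the shape of a cubic
discriminant. -/
theorem phiSixAt'_eq_of_sum_prod {x y z s p : R} (hs : y + z = s) (hp : y * z = p) :
    phiSixAt' x y z = (x ^ 3 + s ^ 3 - 3 * p * s) ^ 2 - 12 * p * s ^ 4 + 72 * p ^ 2 * s ^ 2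
      - 108 * p ^ 3 - 12 * x ^ 3 * p * s := by
  subst hs hp
  unfold phiSixAt'
  ring

/-- The discriminant of the cubic with roots `X, Y, Z`. -/
theorem discriminant_identity (X Y Z p t : R) (ht : 3 * t = 1)
    (hp : 3 * p = (X + Y + Z) ^ 2 - 3 * (X * Y + X * Z + Y * Z)) :
    27 * ((X - Y) * (Y - Z) * (Z - X)) ^ 2 +
      ((-27 * (X * Y * Z) + (X + Y + Z) ^ 3 - 3 * p * (X + Y + Z)) ^ 2
        - 12 * p * (X + Y + Z) ^ 4 + 72 * p ^ 2 * (X + Y + Z) ^ 2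
        - 108 * p ^ 3 + 12 * 27 * (X * Y * Z) * p * (X + Y + Z)) = 0 := by
  -- Only 3p is a polynomial in X, Y, Z. Multiplying by 27 lets every p be traded for 3p, and the
  -- inverse t of 3 removes the factor at the end.
  have key : 27 * (27 * ((X - Y) * (Y - Z) * (Z - X)) ^ 2 +
      ((-27 * (X * Y * Z) + (X + Y + Z) ^ 3 - 3 * p * (X + Y + Z)) ^ 2
        - 12 * p * (X + Y + Z) ^ 4 + 72 * p ^ 2 * (X + Y + Z) ^ 2
        - 108 * p ^ 3 + 12 * 27 * (X * Y * Z) * p * (X + Y + Z))) = 0 := by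
    generalize hP : (X + Y + Z) ^ 2 - 3 * (X * Y + X * Z + Y * Z) = P at hp
    generalize ha : X + Y + Z = a at hP
    generalize hb : X * Y * Z = b
    have h1 : 729 * ((X - Y) * (Y - Z) * (Z - X)) ^ 2 + 27 * (-27 * b + a ^ 3 - P * a) ^ 2
        - 108 * P * a ^ 4 + 216 * P ^ 2 * a ^ 2 - 108 * P ^ 3 + 2916 * b * P * a = 0 := by
      subst hP ha hb
      ring
    linear_combination h1 + (243 * a ^ 2 * (3 * p + P) - 54 * (-27 * b + a ^ 3) * a
      - 108 * a ^ 4 + 2916 * b * a - 108 * (9 * p ^ 2 + 3 * p * P + P ^ 2)) * hp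
  generalize 27 * ((X - Y) * (Y - Z) * (Z - X)) ^ 2 + _ = E at key ⊢
  linear_combination t ^ 3 * key - (9 * t ^ 2 + 3 * t + 1) * E * ht

/-- The Heisenberg invariants satisfy the equation of the cuspidal double plane. -/
theorem sq_add_phiSixAt'_eq_zero {x y z w r h t : R} (hr : r ^ 2 = 3) (hh : 2 * h = 1)
    (ht : 3 * t = 1) (hw : w ^ 2 + phiSixAt x y z = 0) :
    (3 * r * cubeDisc x y z) ^ 2 +
      phiSixAt' (-3 * (x * y * z)) (h * (x ^ 3 + y ^ 3 + z ^ 3 + r * t * w))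
        (h * (x ^ 3 + y ^ 3 + z ^ 3 - r * t * w)) = 0 := by
  have hs : h * (x ^ 3 + y ^ 3 + z ^ 3 + r * t * w) + h * (x ^ 3 + y ^ 3 + z ^ 3 - r * t * w) =
      x ^ 3 + y ^ 3 + z ^ 3 := by
    linear_combination (x ^ 3 + y ^ 3 + z ^ 3) * hh
  generalize hp : h * (x ^ 3 + y ^ 3 + z ^ 3 + r * t * w) *
    (h * (x ^ 3 + y ^ 3 + z ^ 3 - r * t * w)) = p
  -- The product of the second and third coordinates satisfies 12p = 3a² − w². On X one has w² = −Φ₆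
  -- = 12e − a², hence 3p = a² − 3e.
  have hp' : 3 * p = (x ^ 3 + y ^ 3 + z ^ 3) ^ 2
      - 3 * (x ^ 3 * y ^ 3 + x ^ 3 * z ^ 3 + y ^ 3 * z ^ 3) := by
    have h4 : 12 * p = 3 * (x ^ 3 + y ^ 3 + z ^ 3) ^ 2 - w ^ 2 := by
      rw [← hp]
      linear_combination (3 * ((x ^ 3 + y ^ 3 + z ^ 3) ^ 2 - r ^ 2 * t ^ 2 * w ^ 2)) *
        (2 * h + 1) * hh - 3 * t ^ 2 * w ^ 2 * hr - (3 * t + 1) * w ^ 2 * ht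
    have h5 : 12 * p = 4 * ((x ^ 3 + y ^ 3 + z ^ 3) ^ 2
      - 3 * (x ^ 3 * y ^ 3 + x ^ 3 * z ^ 3 + y ^ 3 * z ^ 3)) := by
      unfold phiSixAt at hw
      linear_combination h4 - hw
    linear_combination h ^ 2 * h5 - (2 * h + 1) * (3 * p - ((x ^ 3 + y ^ 3 + z ^ 3) ^ 2
      - 3 * (x ^ 3 * y ^ 3 + x ^ 3 * z ^ 3 + y ^ 3 * z ^ 3))) * hh
  rw [phiSixAt'_eq_of_sum_prod hs hp]
  have h6 := discriminant_identity (x ^ 3) (y ^ 3) (z ^ 3) p t ht hp'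
  unfold cubeDisc
  linear_combination h6 + 9 * ((x ^ 3 - y ^ 3) * (y ^ 3 - z ^ 3) * (z ^ 3 - x ^ 3)) ^ 2 * hr

end Identities

theorem map_coverEq_phiSix {R : Type} [CommRing R] [Algebra ℂ R]
    (f : MvPolynomial (Fin 4) ℂ →ₐ[ℂ] R) :
    f (coverEq phiSix) = f (X 3) ^ 2 + phiSixAt (f (X 0)) (f (X 1)) (f (X 2)) := by
  have h (n : ℕ) [n.AtLeastTwo] : f (rename Fin.castSucc ofNat(n)) = ofNat(n) :=
    map_ofNat (f.comp (rename Fin.castSucc)) n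
  simp [coverEq, phiSix, phiSixAt, h]

theorem map_coverEq_phiSix' {R : Type} [CommRing R] [Algebra ℂ R]
    (f : MvPolynomial (Fin 4) ℂ →ₐ[ℂ] R) :
    f (coverEq phiSix') = f (X 3) ^ 2 + phiSixAt' (f (X 0)) (f (X 1)) (f (X 2)) := by
  have h (n : ℕ) [n.AtLeastTwo] : f (rename Fin.castSucc ofNat(n)) = ofNat(n) :=
    map_ofNat (f.comp (rename Fin.castSucc)) n
  simp [coverEq, phiSix', phiSixAt', h]

/-- A square root of three. -/
def sqrtThree : ℂ := (Real.sqrt 3 : ℝ)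

theorem sqrtThree_sq : sqrtThree ^ 2 = 3 := by
  rw [sqrtThree, ← Complex.ofReal_pow, Real.sq_sqrt (by norm_num)]
  norm_num

/-- The sum of the cubes of `x, y, z`. -/
def cubeSum : MvPolynomial (Fin 4) ℂ := X 0 ^ 3 + X 1 ^ 3 + X 2 ^ 3

/-- The values of the coordinates of the cuspidal double plane on the invariants of the
Heisenberg group. -/
def heisVal : Fin 4 → MvPolynomial (Fin 4) ℂ :=
  ![-3 * (X 0 * X 1 * X 2), C (1 / 2) * (cubeSum + C sqrtThree * C (1 / 3) * X 3),
    C (1 / 2) * (cubeSum - C sqrtThree * C (1 / 3) * X 3),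
    3 * C sqrtThree * cubeDisc (X 0) (X 1) (X 2)]

/-- The map `X → Y'` of degree nine given by the invariants of the Heisenberg group. -/
def heisPoly : MvPolynomial (Fin 4) ℂ →ₐ[ℂ] MvPolynomial (Fin 4) ℂ :=
  aeval heisVal

section Values

variable {R : Type} [CommRing R] [Algebra ℂ R] (f : MvPolynomial (Fin 4) ℂ →ₐ[ℂ] R)

theorem map_cubeSum : f cubeSum = f (X 0) ^ 3 + f (X 1) ^ 3 + f (X 2) ^ 3 := by
  simp [cubeSum]

theorem map_heisPoly_X_zero : f (heisPoly (X 0)) = -3 * (f (X 0) * f (X 1) * f (X 2)) := by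
  have h3 : f 3 = 3 := map_ofNat f 3
  simp [heisPoly, heisVal, h3]

theorem map_heisPoly_X_one : f (heisPoly (X 1)) = algebraMap ℂ R (1 / 2) *
    (f cubeSum + algebraMap ℂ R sqrtThree * algebraMap ℂ R (1 / 3) * f (X 3)) := by
  have hC (a : ℂ) : f (C a) = algebraMap ℂ R a := f.commutes a
  rw [heisPoly, aeval_X]
  change f (C (1 / 2) * (cubeSum + C sqrtThree * C (1 / 3) * X 3)) = _
  simp only [map_mul, map_add, hC]

theorem map_heisPoly_X_two : f (heisPoly (X 2)) = algebraMap ℂ R (1 / 2) *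
    (f cubeSum - algebraMap ℂ R sqrtThree * algebraMap ℂ R (1 / 3) * f (X 3)) := by
  have hC (a : ℂ) : f (C a) = algebraMap ℂ R a := f.commutes a
  rw [heisPoly, aeval_X]
  change f (C (1 / 2) * (cubeSum - C sqrtThree * C (1 / 3) * X 3)) = _
  simp only [map_mul, map_sub, hC]

theorem map_heisPoly_X_three : f (heisPoly (X 3)) =
    3 * algebraMap ℂ R sqrtThree * cubeDisc (f (X 0)) (f (X 1)) (f (X 2)) := by
  have hC (a : ℂ) : f (C a) = algebraMap ℂ R a := f.commutes a
  have h3 : f 3 = 3 := map_ofNat f 3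
  simp [heisPoly, heisVal, cubeDisc, hC, h3]

theorem map_heisPoly_coverEq (hf : f (coverEq phiSix) = 0) :
    f (heisPoly (coverEq phiSix')) = 0 := by
  rw [map_coverEq_phiSix] at hf
  change (f.comp heisPoly) (coverEq phiSix') = 0
  rw [map_coverEq_phiSix', AlgHom.comp_apply, AlgHom.comp_apply, AlgHom.comp_apply,
    AlgHom.comp_apply, map_heisPoly_X_zero, map_heisPoly_X_one, map_heisPoly_X_two,
    map_heisPoly_X_three, map_cubeSum]
  refine sq_add_phiSixAt'_eq_zero ?_ ?_ ?_ hf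
  · rw [← map_pow, sqrtThree_sq, map_ofNat]
  · rw [← map_ofNat (algebraMap ℂ R) 2, ← map_mul, mul_one_div_cancel two_ne_zero, map_one]
  · rw [← map_ofNat (algebraMap ℂ R) 3, ← map_mul, mul_one_div_cancel three_ne_zero, map_one]

end Values

theorem heisPoly_mem_coverIdeal : heisPoly (coverEq phiSix') ∈ coverIdeal phiSix := by
  rw [← Ideal.Quotient.eq_zero_iff_mem]
  exact map_heisPoly_coverEq (Ideal.Quotient.mkₐ ℂ (coverIdeal phiSix))
    (Ideal.Quotient.eq_zero_iff_mem.mpr (Ideal.mem_span_singleton_self _))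

/-- The coordinate ring of the cuspidal double plane, as a ring of invariants. -/
def heisMap : MvPolynomial (Fin 4) ℂ ⧸ coverIdeal phiSix' →+*
    MvPolynomial (Fin 4) ℂ ⧸ coverIdeal phiSix :=
  Ideal.quotientMap (coverIdeal phiSix) heisPoly.toRingHom (by
    rw [coverIdeal, Ideal.span_le, Set.singleton_subset_iff]
    exact heisPoly_mem_coverIdeal)

theorem heisMap_mk (P : MvPolynomial (Fin 4) ℂ) :
    heisMap (Ideal.Quotient.mk _ P) = Ideal.Quotient.mk _ (heisPoly P) := rfl

theorem heisVal_mem (i : Fin 4) : IsWeightedHomogeneous weight (heisVal i) (3 * weight i) := by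
  have hX (i : Fin 3) (n : ℕ) : IsWeightedHomogeneous weight
      (X i.castSucc ^ n : MvPolynomial (Fin 4) ℂ) n := by
    have := (isWeightedHomogeneous_X ℂ weight i.castSucc).pow n
    rwa [weight_castSucc, smul_eq_mul, mul_one] at this
  have hC (a : ℂ) {P : MvPolynomial (Fin 4) ℂ} {n : ℕ} (h : IsWeightedHomogeneous weight P n) :
      IsWeightedHomogeneous weight (C a * P) n := by
    have := (isWeightedHomogeneous_C weight a).mul h
    rwa [zero_add] at this
  have hsub {P Q : MvPolynomial (Fin 4) ℂ} {n : ℕ} (hP : IsWeightedHomogeneous weight P n)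
      (hQ : IsWeightedHomogeneous weight Q n) : IsWeightedHomogeneous weight (P - Q) n :=
    Submodule.sub_mem (weightedHomogeneousSubmodule ℂ weight n) hP hQ
  have ha : IsWeightedHomogeneous weight cubeSum 3 := ((hX 0 3).add (hX 1 3)).add (hX 2 3)
  have hw : IsWeightedHomogeneous weight (X 3 : MvPolynomial (Fin 4) ℂ) 3 :=
    isWeightedHomogeneous_X ℂ weight 3
  have h3 : (3 : MvPolynomial (Fin 4) ℂ) = C 3 := (map_ofNat C 3).symm
  have hx (i : Fin 3) : IsWeightedHomogeneous weight (X i.castSucc : MvPolynomial (Fin 4) ℂ) 1 := by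
    simpa using hX i 1
  fin_cases i
  · change IsWeightedHomogeneous weight (-3 * (X 0 * X 1 * X 2)) 3
    rw [h3, ← C_neg]
    exact hC _ (((hx 0).mul (hx 1)).mul (hx 2))
  · change IsWeightedHomogeneous weight
      (C (1 / 2) * (cubeSum + C sqrtThree * C (1 / 3) * X 3)) 3
    rw [mul_assoc]
    exact hC _ (ha.add (hC _ (hC _ hw)))
  · change IsWeightedHomogeneous weight
      (C (1 / 2) * (cubeSum - C sqrtThree * C (1 / 3) * X 3)) 3
    rw [mul_assoc]
    exact hC _ (hsub ha (hC _ (hC _ hw)))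
  · change IsWeightedHomogeneous weight (3 * C sqrtThree * cubeDisc (X 0) (X 1) (X 2)) 9
    rw [h3, mul_assoc]
    exact hC _ (hC _ (((hsub (hX 0 3) (hX 1 3)).mul (hsub (hX 1 3) (hX 2 3))).mul
      (hsub (hX 2 3) (hX 0 3))))

theorem heisPoly_mem {n : ℕ} {P : MvPolynomial (Fin 4) ℂ}
    (hP : P ∈ weightedHomogeneousSubmodule ℂ weight n) :
    heisPoly P ∈ weightedHomogeneousSubmodule ℂ weight (3 * n) := by
  refine aeval_mem (v := fun i => 3 * weight i) heisVal_mem (n := 3 * n) (P := P) ?_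
  intro d hd
  have := hP hd
  rw [Finsupp.weight_apply, Finsupp.sum] at this ⊢
  rw [← this, Finset.mul_sum]
  exact Finset.sum_congr rfl fun i _ => by simp only [smul_eq_mul]; ring

theorem heisMap_mem (n : ℕ) : ∀ x ∈ coverGrading phiSix' n, heisMap x ∈ coverGrading phiSix (3 * n) := by
  rintro _ ⟨P, hP, rfl⟩
  exact ⟨_, heisPoly_mem hP, rfl⟩

/-! ### Injectivity of the comparison of coordinate rings -/

/-- Complex numbers with prescribed elementary symmetric functions. -/
theorem exists_esymm_eq (a b c : ℂ) :
    ∃ x y z : ℂ, x + y + z = a ∧ x * y + x * z + y * z = b ∧ x * y * z = c := by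
  obtain ⟨x, hx⟩ := IsAlgClosed.exists_root
    (Polynomial.X ^ 3 - Polynomial.C a * Polynomial.X ^ 2 + Polynomial.C b * Polynomial.X
      - Polynomial.C c) (by
    have : (Polynomial.X ^ 3 - Polynomial.C a * Polynomial.X ^ 2 + Polynomial.C b * Polynomial.X
      - Polynomial.C c).degree = 3 := by compute_degree!
    rw [this]
    norm_num)
  -- A square root of the discriminant of the quadratic left after dividing the cubic by its root x.
  obtain ⟨s, hs⟩ := exists_pow_eq ((a - x) ^ 2 - 4 * (b - x * (a - x))) two_pos
  simp only [Polynomial.IsRoot, Polynomial.eval_sub, Polynomial.eval_add, Polynomial.eval_mul,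
    Polynomial.eval_pow, Polynomial.eval_X, Polynomial.eval_C] at hx
  refine ⟨x, (a - x + s) / 2, (a - x - s) / 2, by ring, ?_, ?_⟩
  · linear_combination -hs / 4
  · linear_combination -x * hs / 4 + hx

/-- Complex numbers whose cubes have prescribed elementary symmetric functions. -/
theorem exists_cubes_eq (a e b : ℂ) :
    ∃ x y z : ℂ, x ^ 3 + y ^ 3 + z ^ 3 = a ∧ x ^ 3 * y ^ 3 + x ^ 3 * z ^ 3 + y ^ 3 * z ^ 3 = e ∧
      x * y * z = b := by
  obtain ⟨X, Y, Z, h1, h2, h3⟩ := exists_esymm_eq a e (b ^ 3)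
  obtain ⟨x, rfl⟩ := exists_pow_eq X three_pos
  obtain ⟨y, rfl⟩ := exists_pow_eq Y three_pos
  obtain ⟨z, rfl⟩ := exists_pow_eq Z three_pos
  -- The cubes determine xyz up to a cube root of unity. For b ≠ 0 this discrepancy is absorbed into
  -- z without changing z³.
  by_cases hb : b = 0
  · refine ⟨x, y, z, h1, h2, ?_⟩
    rw [hb, zero_pow three_ne_zero, ← mul_pow, ← mul_pow] at h3
    rw [hb]
    exact eq_zero_of_pow_eq_zero h3
  · have hz : x * y * z ≠ 0 := by
      intro h
      rw [← mul_pow, ← mul_pow, h, zero_pow three_ne_zero] at h3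
      exact hb (eq_zero_of_pow_eq_zero h3.symm)
    have hz3 : (z * b / (x * y * z)) ^ 3 = z ^ 3 := by
      rw [div_pow, mul_pow, ← h3, mul_pow, mul_pow]
      have h0 : x ^ 3 * y ^ 3 * z ^ 3 ≠ 0 := by
        rw [h3]
        exact pow_ne_zero 3 hb
      rw [mul_div_assoc, div_self h0, mul_one]
    refine ⟨x, y, z * b / (x * y * z), by rw [hz3, h1], by rw [hz3, h2], ?_⟩
    rw [mul_div_assoc', div_eq_iff hz]
    ring

/-- The map from the cone over X to the cone over Y' is surjective on points. The values of a, w and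
xyz are forced by the first three coordinates, and V is then determined up to sign. -/
theorem exists_aeval_heisPoly_eq (p : Fin 4 → ℂ) (hp : aeval p (coverEq phiSix') = 0) :
    ∃ q : Fin 4 → ℂ, aeval q (coverEq phiSix) = 0 ∧ ∀ P, aeval q (heisPoly P) = aeval p P := by
  -- The value of e is the one for which w = √3 (p₁ − p₂) satisfies w² = 12e − a².
  obtain ⟨x, y, z, h1, h2, h3⟩ := exists_cubes_eq (p 1 + p 2)
    (((p 1 + p 2) ^ 2 + 3 * (p 1 - p 2) ^ 2) / 12) (-(p 0) / 3)
  have hr := sqrtThree_sq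
  have aux (x y z : ℂ) (h1 : x ^ 3 + y ^ 3 + z ^ 3 = p 1 + p 2)
      (h2 : x ^ 3 * y ^ 3 + x ^ 3 * z ^ 3 + y ^ 3 * z ^ 3 =
        ((p 1 + p 2) ^ 2 + 3 * (p 1 - p 2) ^ 2) / 12) (h3 : x * y * z = -(p 0) / 3) :
      aeval ![x, y, z, sqrtThree * (p 1 - p 2)] (coverEq phiSix) = 0 ∧
      (3 * sqrtThree * cubeDisc x y z = p 3 →
        ∀ P, aeval ![x, y, z, sqrtThree * (p 1 - p 2)] (heisPoly P) = aeval p P) ∧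
      aeval ![x, y, z, sqrtThree * (p 1 - p 2)] (heisPoly (X 0)) = p 0 ∧
      aeval ![x, y, z, sqrtThree * (p 1 - p 2)] (heisPoly (X 1)) = p 1 ∧
      aeval ![x, y, z, sqrtThree * (p 1 - p 2)] (heisPoly (X 2)) = p 2 ∧
      aeval ![x, y, z, sqrtThree * (p 1 - p 2)] (heisPoly (X 3)) =
        3 * sqrtThree * cubeDisc x y z := by
    have e0 : aeval ![x, y, z, sqrtThree * (p 1 - p 2)] (heisPoly (X 0)) = p 0 := by
      rw [map_heisPoly_X_zero]
      simp only [aeval_X, Matrix.cons_val]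
      rw [h3]
      ring
    have e1 : aeval ![x, y, z, sqrtThree * (p 1 - p 2)] (heisPoly (X 1)) = p 1 := by
      rw [map_heisPoly_X_one, map_cubeSum]
      simp only [aeval_X, Matrix.cons_val, Algebra.algebraMap_self, RingHom.id_apply]
      rw [h1]
      linear_combination (1 / 6) * (p 1 - p 2) * hr
    have e2 : aeval ![x, y, z, sqrtThree * (p 1 - p 2)] (heisPoly (X 2)) = p 2 := by
      rw [map_heisPoly_X_two, map_cubeSum]
      simp only [aeval_X, Matrix.cons_val, Algebra.algebraMap_self, RingHom.id_apply]
      rw [h1]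
      linear_combination (-1 / 6) * (p 1 - p 2) * hr
    have e3 : aeval ![x, y, z, sqrtThree * (p 1 - p 2)] (heisPoly (X 3)) =
        3 * sqrtThree * cubeDisc x y z := by
      rw [map_heisPoly_X_three]
      simp only [aeval_X, Matrix.cons_val, Algebra.algebraMap_self, RingHom.id_apply]
    refine ⟨?_, fun h P => ?_, e0, e1, e2, e3⟩
    · rw [map_coverEq_phiSix]
      simp only [aeval_X, Matrix.cons_val]
      unfold phiSixAt
      linear_combination (p 1 - p 2) ^ 2 * hr - 12 * h2 +
        (x ^ 3 + y ^ 3 + z ^ 3 + (p 1 + p 2)) * h1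
    · have : (aeval ![x, y, z, sqrtThree * (p 1 - p 2)]).comp heisPoly = aeval (R := ℂ) p := by
        refine MvPolynomial.algHom_ext fun i => ?_
        rw [AlgHom.comp_apply, aeval_X]
        fin_cases i
        · exact e0
        · exact e1
        · exact e2
        · exact e3.trans h
      exact DFunLike.congr_fun this P
  obtain ⟨k1, k2, f0, f1, f2, f3⟩ := aux x y z h1 h2 h3
  -- Exchanging x and y keeps a, e and xyz and changes the sign of V. This supplies the other square
  -- root of the value of w'².
  obtain ⟨l1, l2, -⟩ := aux y x z (by rw [← h1]; ring) (by rw [← h2]; ring) (by rw [← h3]; ring)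
  have key := map_heisPoly_coverEq _ k1
  have key' := map_coverEq_phiSix'
    ((aeval ![x, y, z, sqrtThree * (p 1 - p 2)]).comp heisPoly : _ →ₐ[ℂ] ℂ)
  simp only [AlgHom.comp_apply, key, f0, f1, f2, f3] at key'
  rw [map_coverEq_phiSix'] at hp
  simp only [aeval_X] at hp
  have hsq : (3 * sqrtThree * cubeDisc x y z) ^ 2 = p 3 ^ 2 := by
    linear_combination -key' - hp
  rcases sq_eq_sq_iff_eq_or_eq_neg.mp hsq with h | h
  · exact ⟨_, k1, k2 h⟩
  · refine ⟨_, l1, l2 ?_⟩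
    have : cubeDisc y x z = -cubeDisc x y z := by
      unfold cubeDisc
      ring
    rw [this]
    linear_combination -h

/-- The Nullstellensatz for a prime, hence radical, ideal. -/
theorem mem_coverIdeal_iff {F : Sextic} (hF : Prime (coverEq F)) {P : MvPolynomial (Fin 4) ℂ} :
    P ∈ coverIdeal F ↔ ∀ p : Fin 4 → ℂ, aeval p (coverEq F) = 0 → aeval p P = 0 := by
  have := coverIdeal_isPrime hF
  conv_lhs => rw [← IsPrime.vanishingIdeal_zeroLocus (K := ℂ) (coverIdeal F),
    mem_vanishingIdeal_iff]
  rw [coverIdeal, zeroLocus_span]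
  simp

theorem heisMap_injective : Function.Injective heisMap := by
  rw [injective_iff_map_eq_zero]
  intro x hx
  obtain ⟨P, rfl⟩ := Ideal.Quotient.mk_surjective x
  rw [heisMap_mk, Ideal.Quotient.eq_zero_iff_mem, mem_coverIdeal_iff prime_coverEq_phiSix] at hx
  rw [Ideal.Quotient.eq_zero_iff_mem, mem_coverIdeal_iff prime_coverEq_phiSix']
  intro p hp
  obtain ⟨q, hq, hqp⟩ := exists_aeval_heisPoly_eq p hp
  rw [← hqp]
  exact hx q hq

/-- Every point (x, y, z) lifts to the double cover, because ℂ has square roots. A polynomial in x,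
y, z vanishing on the cover therefore vanishes everywhere. -/
theorem rename_mem_coverIdeal {F : Sextic} {P : MvPolynomial (Fin 3) ℂ}
    (h : rename Fin.castSucc P ∈ coverIdeal F) : P = 0 := by
  refine MvPolynomial.funext fun p => ?_
  rw [map_zero]
  obtain ⟨w, hw⟩ := exists_pow_eq (-(eval p F.1)) two_pos
  obtain ⟨Q, hQ⟩ := Ideal.mem_span_singleton.mp h
  have h3 (G : MvPolynomial (Fin 3) ℂ) :
      eval (Fin.snoc (α := fun _ => ℂ) p w) (rename Fin.castSucc G) = eval p G := by
    rw [eval_rename]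
    congr 2
    funext i
    exact Fin.snoc_castSucc (α := fun _ => ℂ) w p i
  have hl : (Fin.snoc (α := fun _ => ℂ) p w : Fin 4 → ℂ) 3 = w :=
    Fin.snoc_last (α := fun _ => ℂ) w p
  have := congrArg (eval (Fin.snoc (α := fun _ => ℂ) p w)) hQ
  rw [h3, map_mul, coverEq, map_add, h3, map_pow, eval_X, hl, hw, neg_add_cancel, zero_mul] at this
  exact this

/-- Homogeneous preimages under maps multiplying degrees by `e`. -/
theorem exists_homogeneous_preimage {A B : Type} [CommRing A] [CommRing B] [Algebra ℂ A]
    [Algebra ℂ B] {𝒜 : ℕ → Submodule ℂ A} {ℬ : ℕ → Submodule ℂ B} [GradedAlgebra 𝒜]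
    [GradedAlgebra ℬ] (φ : A →+* B) {e : ℕ} (he : 0 < e)
    (hφ : ∀ n, ∀ x ∈ 𝒜 n, φ x ∈ ℬ (e * n)) {n : ℕ} {x : A} (hx : φ x ∈ ℬ (e * n)) :
    ∃ y ∈ 𝒜 n, φ y = φ x := by
  refine ⟨DirectSum.decompose 𝒜 x n, SetLike.coe_mem _, ?_⟩
  have key (x : A) : (DirectSum.decompose ℬ (φ x) (e * n) : B) =
      φ (DirectSum.decompose 𝒜 x n) := by
    induction x using DirectSum.Decomposition.inductionOn 𝒜 with
    | zero => simp
    | @homogeneous i m =>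
      rcases eq_or_ne i n with rfl | h
      · rw [DirectSum.decompose_of_mem_same ℬ (hφ _ _ m.2),
          DirectSum.decompose_of_mem_same 𝒜 m.2]
      · rw [DirectSum.decompose_of_mem_ne ℬ (hφ _ _ m.2)
          (fun h' => h (Nat.eq_of_mul_eq_mul_left he h')),
          DirectSum.decompose_of_mem_ne 𝒜 m.2 h, map_zero]
    | add a b ha hb => simp [ha, hb]
  rw [← key, DirectSum.decompose_of_mem_same ℬ hx]

/-! ### The ring of invariants of the Heisenberg group -/

/-- The cyclic sums of the monomials in `X, Y, Z` are polynomials in the elementary symmetric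
functions and the product of the differences. -/
theorem cyclicSum_mem {R : Type} [CommRing R] (T : Subring R) (σ : R →+* R) (hσ : ∀ t ∈ T, σ t = t)
    {X Y Z h : R} (hX : σ X = Y) (hY : σ Y = Z) (hZ : σ Z = X) (hh : 2 * h = 1) (hhT : h ∈ T)
    (h1 : X + Y + Z ∈ T) (h2 : X * Y + X * Z + Y * Z ∈ T) (h3 : X * Y * Z ∈ T)
    (hV : (X - Y) * (Y - Z) * (Z - X) ∈ T) (i j k : ℕ) :
    X ^ i * Y ^ j * Z ^ k + σ (X ^ i * Y ^ j * Z ^ k) + σ (σ (X ^ i * Y ^ j * Z ^ k)) ∈ T := by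
  -- These are the standard generators of the polynomials in X, Y, Z over the symmetric ones. `M` is
  -- shown to be stable under multiplication by X, Y and Z, so it contains all monomials. As σ fixes
  -- `T`, only the cyclic sums of the six generators remain to be checked.
  let M : Submodule T R := Submodule.span T {1, X, X ^ 2, Y, X * Y, X ^ 2 * Y}
  have hT (t : R) (ht : t ∈ T) (m : R) (hm : m ∈ M) : t * m ∈ M := M.smul_mem ⟨t, ht⟩ hm
  have m0 : 1 ∈ M := Submodule.subset_span (by simp)
  have m1 : X ∈ M := Submodule.subset_span (by simp)
  have m2 : X ^ 2 ∈ M := Submodule.subset_span (by simp)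
  have m3 : Y ∈ M := Submodule.subset_span (by simp)
  have m4 : X * Y ∈ M := Submodule.subset_span (by simp)
  have m5 : X ^ 2 * Y ∈ M := Submodule.subset_span (by simp)
  generalize he1 : X + Y + Z = e1 at h1
  generalize he2 : X * Y + X * Z + Y * Z = e2 at h2
  generalize he3 : X * Y * Z = e3 at h3
  have hXM (m : R) (hm : m ∈ M) : X * m ∈ M := by
    induction hm using Submodule.span_induction with
    | zero => rw [mul_zero]; exact M.zero_mem
    | add a b _ _ ha hb => rw [mul_add]; exact M.add_mem ha hb
    | smul t a _ ha =>
      rw [Subring.smul_def, smul_eq_mul, mul_left_comm]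
      exact hT _ t.2 _ ha
    | mem a ha =>
      have hX3 : X * X ^ 2 = e1 * X ^ 2 - e2 * X + e3 * 1 := by
        rw [← he1, ← he2, ← he3]
        ring
      have hX3M : X * X ^ 2 ∈ M := by
        rw [hX3]
        exact M.add_mem (M.sub_mem (hT _ h1 _ m2) (hT _ h2 _ m1)) (hT _ h3 _ m0)
      rcases ha with rfl | rfl | rfl | rfl | rfl | rfl
      · rwa [mul_one]
      · rwa [← pow_two]
      · exact hX3M
      · exact m4
      · rwa [← mul_assoc, ← pow_two]
      · have : X * (X ^ 2 * Y) = e1 * (X ^ 2 * Y) - e2 * (X * Y) + e3 * Y := by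
          rw [← mul_assoc, hX3]
          ring
        rw [this]
        exact M.add_mem (M.sub_mem (hT _ h1 _ m5) (hT _ h2 _ m4)) (hT _ h3 _ m3)
  have hY2 : Y * Y ∈ M := by
    have : Y * Y = e1 * X + e1 * Y - X * Y - X ^ 2 - e2 * 1 := by
      rw [← he1, ← he2]
      ring
    rw [this]
    exact M.sub_mem (M.sub_mem (M.sub_mem (M.add_mem (hT _ h1 _ m1) (hT _ h1 _ m3)) m4) m2)
      (hT _ h2 _ m0)
  have hYM (m : R) (hm : m ∈ M) : Y * m ∈ M := by
    induction hm using Submodule.span_induction with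
    | zero => rw [mul_zero]; exact M.zero_mem
    | add a b _ _ ha hb => rw [mul_add]; exact M.add_mem ha hb
    | smul t a _ ha =>
      rw [Subring.smul_def, smul_eq_mul, mul_left_comm]
      exact hT _ t.2 _ ha
    | mem a ha =>
      rcases ha with rfl | rfl | rfl | rfl | rfl | rfl
      · rwa [mul_one]
      · rwa [mul_comm]
      · rwa [mul_comm]
      · exact hY2
      · rw [mul_left_comm]
        exact hXM _ hY2
      · rw [mul_left_comm, pow_two, mul_assoc]
        exact hXM _ (hXM _ hY2)
  have hZM (m : R) (hm : m ∈ M) : Z * m ∈ M := by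
    have : Z * m = e1 * m - X * m - Y * m := by
      rw [← he1]
      ring
    rw [this]
    exact M.sub_mem (M.sub_mem (hT _ h1 _ hm) (hXM _ hm)) (hYM _ hm)
  have hpow {u : R} (hu : ∀ m ∈ M, u * m ∈ M) (n : ℕ) : ∀ m ∈ M, u ^ n * m ∈ M := by
    induction n with
    | zero => intro m hm; rwa [pow_zero, one_mul]
    | succ n ih => intro m hm; rw [pow_succ', mul_assoc]; exact hu _ (ih m hm)
  have hmem : X ^ i * Y ^ j * Z ^ k ∈ M := by
    have := hpow hXM i _ (hpow hYM j _ (hpow hZM k _ m0))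
    rwa [mul_one, ← mul_assoc] at this
  generalize X ^ i * Y ^ j * Z ^ k = m at hmem
  induction hmem using Submodule.span_induction with
  | zero => simp
  | add a b _ _ ha hb =>
    have := T.add_mem ha hb
    simp only [map_add]
    convert this using 1
    ring
  | smul t a _ ha =>
    have := T.mul_mem t.2 ha
    simp only [Subring.smul_def, smul_eq_mul, map_mul, hσ _ t.2]
    convert this using 1
    ring
  | mem a ha =>
    have hs1 : X + Y + Z ∈ T := by rwa [he1]
    have hs2 : X * Y + X * Z + Y * Z ∈ T := by rwa [he2]
    have hs3 : X * Y * Z ∈ T := by rwa [he3]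
    rcases ha with rfl | rfl | rfl | rfl | rfl | rfl
    · simp only [map_one]
      exact T.add_mem (T.add_mem T.one_mem T.one_mem) T.one_mem
    · rwa [hX, hY]
    · rw [map_pow, map_pow, hX, hY]
      have := T.sub_mem (T.pow_mem hs1 2) (T.add_mem hs2 hs2)
      convert this using 1
      ring
    · rw [hY, hZ]
      convert hs1 using 1
      ring
    · rw [map_mul, map_mul, hX, hY, hZ]
      convert hs2 using 1
      ring
    -- The only generator whose cyclic sum is not symmetric: X²Y + Y²Z + Z²X = (e₁e₂ − 3e₃ − V)/2.
    · rw [map_mul, map_mul, map_pow, map_pow, hX, hY, hZ]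
      have := T.mul_mem hhT (T.sub_mem (T.sub_mem (T.mul_mem hs1 hs2)
        (T.add_mem (T.add_mem hs3 hs3) hs3)) hV)
      convert this using 1
      linear_combination -(X ^ 2 * Y + Y ^ 2 * Z + Z ^ 2 * X) * hh

/-! ### The cube root of unity and the action of g₁ and g₂ on the coordinates. -/

theorem eps_isPrimitiveRoot : IsPrimitiveRoot eps 3 := by
  have := Complex.isPrimitiveRoot_exp 3 (by norm_num)
  rwa [Nat.cast_ofNat] at this

theorem eps_pow_three : eps ^ 3 = 1 := eps_isPrimitiveRoot.pow_eq_one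

theorem eps_sq_add : eps ^ 2 + eps + 1 = 0 := by
  have h := eps_isPrimitiveRoot.ne_one (by norm_num)
  have : (eps - 1) * (eps ^ 2 + eps + 1) = 0 := by linear_combination eps_pow_three
  exact (mul_eq_zero.mp this).resolve_left (sub_ne_zero.mpr h)

theorem eps_ne_zero : eps ≠ 0 := eps_isPrimitiveRoot.ne_zero (by norm_num)

section CoverSubst

variable (A : Matrix (Fin 3) (Fin 3) ℂ) (c : ℂ)

theorem subst_X (i : Fin 3) :
    subst A (X i) = C (A i 0) * X 0 + C (A i 1) * X 1 + C (A i 2) * X 2 := by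
  rw [subst, aeval_X, linForm, Fin.sum_univ_three]

theorem coverSubst_X_castSucc (i : Fin 3) : coverSubst A c (X i.castSucc) =
    C (A i 0) * X 0 + C (A i 1) * X 1 + C (A i 2) * X 2 := by
  rw [← rename_X, coverSubst_rename, subst_X]
  simp

theorem coverSubst_X_zero : coverSubst A c (X 0) =
    C (A 0 0) * X 0 + C (A 0 1) * X 1 + C (A 0 2) * X 2 :=
  coverSubst_X_castSucc A c 0

theorem coverSubst_X_one : coverSubst A c (X 1) =
    C (A 1 0) * X 0 + C (A 1 1) * X 1 + C (A 1 2) * X 2 :=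
  coverSubst_X_castSucc A c 1

theorem coverSubst_X_two : coverSubst A c (X 2) =
    C (A 2 0) * X 0 + C (A 2 1) * X 1 + C (A 2 2) * X 2 :=
  coverSubst_X_castSucc A c 2

theorem coverSubst_C (a : ℂ) : coverSubst A c (C a) = C a :=
  (coverSubst A c).commutes a

end CoverSubst

theorem coverSubst_g1 :
    coverSubst g1.1 1 (X 0) = X 1 ∧ coverSubst g1.1 1 (X 1) = X 2 ∧ coverSubst g1.1 1 (X 2) = X 0 ∧
      coverSubst g1.1 1 (X 3) = X 3 := by
  refine ⟨?_, ?_, ?_, ?_⟩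
  · rw [coverSubst_X_zero]; simp [g1, Matrix.GeneralLinearGroup.mkOfDetNeZero]
  · rw [coverSubst_X_one]; simp [g1, Matrix.GeneralLinearGroup.mkOfDetNeZero]
  · rw [coverSubst_X_two]; simp [g1, Matrix.GeneralLinearGroup.mkOfDetNeZero]
  · rw [coverSubst_X_three]; simp

theorem coverSubst_g2 :
    coverSubst g2.1 1 (X 0) = X 0 ∧ coverSubst g2.1 1 (X 1) = C eps * X 1 ∧
      coverSubst g2.1 1 (X 2) = C (eps ^ 2) * X 2 ∧ coverSubst g2.1 1 (X 3) = X 3 := by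
  refine ⟨?_, ?_, ?_, ?_⟩
  · rw [coverSubst_X_zero]; simp [g2, Matrix.GeneralLinearGroup.mkOfDetNeZero]
  · rw [coverSubst_X_one]; simp [g2, Matrix.GeneralLinearGroup.mkOfDetNeZero]
  · rw [coverSubst_X_two]; simp [g2, Matrix.GeneralLinearGroup.mkOfDetNeZero]
  · rw [coverSubst_X_three]; simp

theorem map_phiSix {R : Type} [CommRing R] [Algebra ℂ R] (f : MvPolynomial (Fin 3) ℂ →ₐ[ℂ] R) :
    f phiSix.1 = phiSixAt (f (X 0)) (f (X 1)) (f (X 2)) := by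
  have h : f 10 = 10 := map_ofNat f 10
  simp [phiSix, phiSixAt, h]

theorem phiSix_eq : phiSix.1 = phiSixAt (X 0) (X 1) (X 2) :=
  map_phiSix (AlgHom.id ℂ _)

theorem subst_g1 : subst g1.1 (X 0) = X 1 ∧ subst g1.1 (X 1) = X 2 ∧ subst g1.1 (X 2) = X 0 := by
  refine ⟨?_, ?_, ?_⟩ <;> rw [subst_X] <;>
    simp [g1, Matrix.GeneralLinearGroup.mkOfDetNeZero]

theorem subst_g2 : subst g2.1 (X 0) = X 0 ∧ subst g2.1 (X 1) = C eps * X 1 ∧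
    subst g2.1 (X 2) = C (eps ^ 2) * X 2 := by
  refine ⟨?_, ?_, ?_⟩ <;> rw [subst_X] <;>
    simp [g2, Matrix.GeneralLinearGroup.mkOfDetNeZero]

theorem C_eps_pow_three {σ : Type} : (C eps : MvPolynomial σ ℂ) ^ 3 = 1 := by
  rw [← C_pow, eps_pow_three, C_1]

/-- The lift of `g₁` to the double plane. -/
def coverG1 : coverSymm phiSix :=
  ⟨(g1, 1), by
    change subst g1.1 phiSix.1 = C ((1 : ℂ) ^ 2) * phiSix.1
    obtain ⟨h0, h1, h2⟩ := subst_g1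
    rw [map_phiSix, h0, h1, h2, one_pow, C_1, one_mul, phiSix_eq]
    unfold phiSixAt
    ring⟩

/-- The lift of `g₂` to the double plane. -/
def coverG2 : coverSymm phiSix :=
  ⟨(g2, 1), by
    change subst g2.1 phiSix.1 = C ((1 : ℂ) ^ 2) * phiSix.1
    obtain ⟨h0, h1, h2⟩ := subst_g2
    have h3 : (C eps : MvPolynomial (Fin 3) ℂ) ^ 3 = 1 := C_eps_pow_three
    have h6 (n : ℕ) : (C eps : MvPolynomial (Fin 3) ℂ) ^ (3 * n) = 1 := by
      rw [pow_mul, h3, one_pow]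
    rw [map_phiSix, h0, h1, h2, one_pow, C_1, one_mul, phiSix_eq]
    unfold phiSixAt
    rw [C_pow]
    simp only [mul_pow, ← pow_mul]
    rw [h6 1, h6 2, h6 4]
    ring⟩

section Invariants

/-- The class of a polynomial in the coordinate ring of the double plane. -/
abbrev coverClass (F : Sextic) : MvPolynomial (Fin 4) ℂ →+* MvPolynomial (Fin 4) ℂ ⧸ coverIdeal F :=
  Ideal.Quotient.mk (coverIdeal F)

theorem heisMap_coverClass (P : MvPolynomial (Fin 4) ℂ) :
    heisMap (coverClass phiSix' P) = coverClass phiSix (heisPoly P) := rfl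

theorem heisPoly_C (c : ℂ) : heisPoly (C c) = C c := heisPoly.commutes c

theorem coverClass_C_mem (c : ℂ) : coverClass phiSix (C c) ∈ heisMap.range :=
  ⟨coverClass phiSix' (C c), by rw [heisMap_coverClass, heisPoly_C]⟩

theorem heisPoly_X (i : Fin 4) : heisPoly (X i) = heisVal i := aeval_X _ _

theorem coverClass_prod_mem : coverClass phiSix (X 0 * X 1 * X 2) ∈ heisMap.range := by
  refine ⟨coverClass phiSix' (C (-1 / 3) * X 0), ?_⟩
  rw [heisMap_coverClass, map_mul, heisPoly_C, heisPoly_X]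
  change coverClass phiSix (C (-1 / 3) * (-3 * (X 0 * X 1 * X 2))) = _
  congr 1
  have : (C (-1 / 3) * 3 : MvPolynomial (Fin 4) ℂ) = -1 := by
    rw [← map_ofNat C 3, ← C_mul, ← C_1, ← C_neg]
    norm_num
  linear_combination -(X 0 * X 1 * X 2) * this

theorem C_half_mul_two {σ : Type} : (C (1 / 2) * 2 : MvPolynomial σ ℂ) = 1 := by
  rw [← map_ofNat C 2, ← C_mul, ← C_1]
  norm_num

theorem coverClass_cubeSum_mem : coverClass phiSix cubeSum ∈ heisMap.range := by
  refine ⟨coverClass phiSix' (X 1 + X 2), ?_⟩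
  rw [heisMap_coverClass, map_add, heisPoly_X, heisPoly_X]
  change coverClass phiSix (C (1 / 2) * (cubeSum + C sqrtThree * C (1 / 3) * X 3) +
    C (1 / 2) * (cubeSum - C sqrtThree * C (1 / 3) * X 3)) = _
  congr 1
  linear_combination cubeSum * C_half_mul_two

theorem C_sqrtThree_sq {σ : Type} : (C sqrtThree : MvPolynomial σ ℂ) ^ 2 = 3 := by
  rw [← C_pow, sqrtThree_sq, map_ofNat]

theorem C_third_mul_three {σ : Type} : (C (1 / 3) * 3 : MvPolynomial σ ℂ) = 1 := by
  rw [← map_ofNat C 3, ← C_mul, ← C_1]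
  norm_num

/-- From y' − z' = w/√3 one recovers w = √3 (y' − z'). -/
theorem coverClass_X_three_mem : coverClass phiSix (X 3) ∈ heisMap.range := by
  refine ⟨coverClass phiSix' (C sqrtThree * (X 1 - X 2)), ?_⟩
  rw [heisMap_coverClass, map_mul, map_sub, heisPoly_C, heisPoly_X, heisPoly_X]
  change coverClass phiSix (C sqrtThree * (C (1 / 2) * (cubeSum + C sqrtThree * C (1 / 3) * X 3) -
    C (1 / 2) * (cubeSum - C sqrtThree * C (1 / 3) * X 3))) = _
  congr 1
  linear_combination (C sqrtThree ^ 2 * C (1 / 3) * X 3) * C_half_mul_two (σ := Fin 4)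
    + C (1 / 3) * X 3 * C_sqrtThree_sq (σ := Fin 4) + X 3 * C_third_mul_three (σ := Fin 4)

theorem coverClass_cubeDisc_mem :
    coverClass phiSix (cubeDisc (X 0) (X 1) (X 2)) ∈ heisMap.range := by
  have h (D : MvPolynomial (Fin 4) ℂ) :
      C (1 / 3) * C (1 / 3) * C sqrtThree * (3 * C sqrtThree * D) = D := by
    linear_combination (3 * C (1 / 3) ^ 2 * D) * C_sqrtThree_sq (σ := Fin 4) +
      D * (3 * C (1 / 3) + 1) * C_third_mul_three (σ := Fin 4)
  refine ⟨coverClass phiSix' (C (1 / 3) * C (1 / 3) * C sqrtThree * X 3), ?_⟩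
  rw [heisMap_coverClass]
  refine congrArg (coverClass phiSix) ?_
  simp only [map_mul heisPoly, heisPoly_C, heisPoly_X]
  exact h _

/-- This is where the equation of X enters: Φ₆ = a² − 12e gives e = (a² + w²)/12 on X. -/
theorem coverClass_esymm_mem : coverClass phiSix
    (X 0 ^ 3 * X 1 ^ 3 + X 0 ^ 3 * X 2 ^ 3 + X 1 ^ 3 * X 2 ^ 3) ∈ heisMap.range := by
  have h := heisMap.range.mul_mem (coverClass_C_mem (1 / 12))
    (heisMap.range.add_mem (heisMap.range.pow_mem coverClass_cubeSum_mem 2)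
      (heisMap.range.pow_mem coverClass_X_three_mem 2))
  rw [← map_pow, ← map_pow, ← map_add, ← map_mul] at h
  convert h using 1
  rw [Ideal.Quotient.eq]
  have : (C (1 / 12) * 12 : MvPolynomial (Fin 4) ℂ) = 1 := by
    rw [← map_ofNat C 12, ← C_mul, ← C_1]
    norm_num
  have e := map_coverEq_phiSix (AlgHom.id ℂ (MvPolynomial (Fin 4) ℂ))
  simp only [AlgHom.id_apply, phiSixAt] at e
  refine Ideal.mem_span_singleton.mpr ⟨-C (1 / 12), ?_⟩
  rw [e]
  unfold cubeSum
  linear_combination -(X 0 ^ 3 * X 1 ^ 3 + X 0 ^ 3 * X 2 ^ 3 + X 1 ^ 3 * X 2 ^ 3) * this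

end Invariants

/-! ### Averaging over Γ. -/

/-- The trace over the cyclic group generated by `g₁`. -/
def traceG1 (x : MvPolynomial (Fin 4) ℂ ⧸ coverIdeal phiSix) :
    MvPolynomial (Fin 4) ℂ ⧸ coverIdeal phiSix :=
  x + coverRingMap coverG1 x + coverRingMap coverG1 (coverRingMap coverG1 x)

/-- The trace over the cyclic group generated by `g₂`. -/
def traceG2 (x : MvPolynomial (Fin 4) ℂ ⧸ coverIdeal phiSix) :
    MvPolynomial (Fin 4) ℂ ⧸ coverIdeal phiSix :=
  x + coverRingMap coverG2 x + coverRingMap coverG2 (coverRingMap coverG2 x)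

theorem traceG1_add (x y) : traceG1 (x + y) = traceG1 x + traceG1 y := by
  simp only [traceG1, map_add]
  ring

theorem traceG2_add (x y) : traceG2 (x + y) = traceG2 x + traceG2 y := by
  simp only [traceG2, map_add]
  ring

theorem coverRingMap_g1_X :
    coverRingMap coverG1 (coverClass phiSix (X 0)) = coverClass phiSix (X 1) ∧
    coverRingMap coverG1 (coverClass phiSix (X 1)) = coverClass phiSix (X 2) ∧
    coverRingMap coverG1 (coverClass phiSix (X 2)) = coverClass phiSix (X 0) ∧
    coverRingMap coverG1 (coverClass phiSix (X 3)) = coverClass phiSix (X 3) := by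
  obtain ⟨h0, h1, h2, h3⟩ := coverSubst_g1
  exact ⟨congrArg (coverClass phiSix) h0, congrArg (coverClass phiSix) h1,
    congrArg (coverClass phiSix) h2, congrArg (coverClass phiSix) h3⟩

theorem coverRingMap_C {F : Sextic} (g : coverSymm F) (c : ℂ) :
    coverRingMap g (coverClass F (C c)) = coverClass F (C c) :=
  congrArg (coverClass F) (coverSubst_C _ _ c)

theorem coverRingMap_g1_heisMap (x) : coverRingMap coverG1 (heisMap x) = heisMap x := by
  obtain ⟨P, rfl⟩ := Ideal.Quotient.mk_surjective x
  refine congrArg (coverClass phiSix) ?_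
  change ((coverSubst g1.1 1).comp heisPoly) P = heisPoly P
  obtain ⟨h0, h1, h2, h3⟩ := coverSubst_g1
  refine DFunLike.congr_fun (MvPolynomial.algHom_ext fun i => ?_) P
  have ha : coverSubst g1.1 1 cubeSum = cubeSum := by
    rw [map_cubeSum, h0, h1, h2, cubeSum]
    ring
  rw [AlgHom.comp_apply]
  fin_cases i
  · refine (map_heisPoly_X_zero _).trans ?_
    rw [h0, h1, h2]
    refine Eq.trans ?_ (map_heisPoly_X_zero (AlgHom.id ℂ _)).symm
    simp only [AlgHom.id_apply]
    ring
  · refine (map_heisPoly_X_one _).trans ?_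
    rw [h3, ha]
    exact (map_heisPoly_X_one (AlgHom.id ℂ _)).symm
  · refine (map_heisPoly_X_two _).trans ?_
    rw [h3, ha]
    exact (map_heisPoly_X_two (AlgHom.id ℂ _)).symm
  · refine (map_heisPoly_X_three _).trans ?_
    rw [h0, h1, h2]
    refine Eq.trans ?_ (map_heisPoly_X_three (AlgHom.id ℂ _)).symm
    simp only [AlgHom.id_apply, cubeDisc]
    ring

/-- The trace of a monomial whose degree is divisible by three is a polynomial in the Heisenberg
invariants. -/
theorem trace_monomial_mem (d : Fin 4 →₀ ℕ) (c : ℂ) (hd : 3 ∣ d 0 + d 1 + d 2) :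
    traceG1 (traceG2 (coverClass phiSix (monomial d c))) ∈ heisMap.range := by
  have hmono : monomial d c = C c * (X 0 ^ d 0 * X 1 ^ d 1 * X 2 ^ d 2 * X 3 ^ d 3) := by
    rw [monomial_eq, Finsupp.prod_fintype _ _ (fun i => pow_zero _), Fin.prod_univ_four]
  obtain ⟨k0, k1, k2, k3⟩ := coverSubst_g2
  set u : ℂ := eps ^ (d 1 + 2 * d 2) with hu
  have hg2 : coverRingMap coverG2 (coverClass phiSix (monomial d c)) =
      coverClass phiSix (C u) * coverClass phiSix (monomial d c) := by
    rw [← map_mul]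
    refine congrArg (coverClass phiSix) ?_
    change coverSubst g2.1 1 (monomial d c) = _
    rw [hmono]
    simp only [map_mul, map_pow, k0, k1, k2, k3, coverSubst_C, mul_pow, hu, pow_add,
      pow_mul]
    ring
  have htr : traceG2 (coverClass phiSix (monomial d c)) =
      coverClass phiSix (C (1 + u + u ^ 2)) * coverClass phiSix (monomial d c) := by
    rw [traceG2, hg2, map_mul, coverRingMap_C, hg2]
    simp only [map_add, map_pow, map_one]
    ring
  rw [htr, hmono]
  have hu3 : u ^ 3 = 1 := by rw [hu, ← pow_mul, mul_comm, pow_mul, eps_pow_three, one_pow]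
  -- The monomial is an eigenvector of g₂ with eigenvalue u, and its trace vanishes unless u = 1. In
  -- that case 3 divides d₁ + 2d₂ as well as d₀ + d₁ + d₂, so d₀, d₁, d₂ agree modulo 3. The
  -- monomial is then a power of xyz times a power of w times a monomial in the cubes.
  by_cases hu1 : u = 1
  · have h3 : 3 ∣ d 1 + 2 * d 2 := (eps_isPrimitiveRoot.pow_eq_one_iff_dvd _).mp hu1
    obtain ⟨r, p0, p1, p2, e0, e1, e2⟩ : ∃ r p0 p1 p2, d 0 = r + 3 * p0 ∧ d 1 = r + 3 * p1 ∧
        d 2 = r + 3 * p2 :=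
      ⟨d 0 % 3, d 0 / 3, d 1 / 3, d 2 / 3, by omega, by omega, by omega⟩
    have hfac : coverClass phiSix (C (1 + u + u ^ 2)) *
        coverClass phiSix (C c * (X 0 ^ d 0 * X 1 ^ d 1 * X 2 ^ d 2 * X 3 ^ d 3)) =
        (coverClass phiSix (C (1 + u + u ^ 2)) * coverClass phiSix (C c) *
          coverClass phiSix (X 0 * X 1 * X 2) ^ r * coverClass phiSix (X 3) ^ d 3) *
        ((coverClass phiSix (X 0) ^ 3) ^ p0 * (coverClass phiSix (X 1) ^ 3) ^ p1 *
          (coverClass phiSix (X 2) ^ 3) ^ p2) := by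
      rw [e0, e1, e2]
      simp only [map_mul, map_pow, pow_add, pow_mul, mul_pow]
      ring
    rw [hfac]
    have ht : coverClass phiSix (C (1 + u + u ^ 2)) * coverClass phiSix (C c) *
          coverClass phiSix (X 0 * X 1 * X 2) ^ r * coverClass phiSix (X 3) ^ d 3 ∈
        heisMap.range :=
      mul_mem (mul_mem (mul_mem (coverClass_C_mem _) (coverClass_C_mem _))
        (pow_mem coverClass_prod_mem _)) (pow_mem coverClass_X_three_mem _)
    generalize coverClass phiSix (C (1 + u + u ^ 2)) * coverClass phiSix (C c) *
      coverClass phiSix (X 0 * X 1 * X 2) ^ r * coverClass phiSix (X 3) ^ d 3 = t at ht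
    have hσ : ∀ t ∈ heisMap.range, coverRingMap coverG1 t = t := by
      rintro _ ⟨x, rfl⟩
      exact coverRingMap_g1_heisMap x
    obtain ⟨l0, l1, l2, -⟩ := coverRingMap_g1_X
    have key := cyclicSum_mem heisMap.range (coverRingMap coverG1).toRingHom hσ
      (X := coverClass phiSix (X 0) ^ 3) (Y := coverClass phiSix (X 1) ^ 3)
      (Z := coverClass phiSix (X 2) ^ 3) (h := coverClass phiSix (C (1 / 2)))
      ((map_pow (coverRingMap coverG1) _ 3).trans (congrArg (· ^ 3) l0))
      ((map_pow (coverRingMap coverG1) _ 3).trans (congrArg (· ^ 3) l1))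
      ((map_pow (coverRingMap coverG1) _ 3).trans (congrArg (· ^ 3) l2))
      (by
        have := congrArg (coverClass phiSix) (C_half_mul_two (σ := Fin 4))
        rw [map_mul, map_one, map_ofNat] at this
        rwa [mul_comm])
      (coverClass_C_mem _)
      (by simpa [cubeSum] using coverClass_cubeSum_mem)
      (by simpa using coverClass_esymm_mem)
      (by simpa [mul_pow] using pow_mem coverClass_prod_mem 3)
      (by simpa [cubeDisc] using coverClass_cubeDisc_mem) p0 p1 p2
    have hlin (z) : traceG1 (t * z) =
        t * (z + coverRingMap coverG1 z + coverRingMap coverG1 (coverRingMap coverG1 z)) := by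
      rw [traceG1, map_mul, hσ t ht, map_mul, hσ t ht]
      ring
    rw [hlin]
    exact mul_mem ht key
  · have : 1 + u + u ^ 2 = 0 := by
      have : (u - 1) * (1 + u + u ^ 2) = 0 := by linear_combination hu3
      exact (mul_eq_zero.mp this).resolve_left (sub_ne_zero.mpr hu1)
    rw [this, C_0, map_zero, zero_mul]
    simp [traceG1]

theorem trace_mem {m : ℕ} {x : MvPolynomial (Fin 4) ℂ ⧸ coverIdeal phiSix}
    (hx : x ∈ coverGrading phiSix (3 * m)) : traceG1 (traceG2 x) ∈ heisMap.range := by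
  obtain ⟨P, hP, rfl⟩ := hx
  change traceG1 (traceG2 (coverClass phiSix P)) ∈ heisMap.range
  have hsum : ∀ s : Finset (Fin 4 →₀ ℕ), s ⊆ P.support →
      traceG1 (traceG2 (coverClass phiSix (∑ d ∈ s, monomial d (P.coeff d)))) ∈
        heisMap.range := by
    intro s
    induction s using Finset.induction_on with
    | empty => simp [traceG1, traceG2]
    | insert d s hd ih =>
      intro hs
      rw [Finset.sum_insert hd, map_add, traceG2_add, traceG1_add]
      refine add_mem (trace_monomial_mem d _ ?_)
        (ih fun x hx => hs (Finset.mem_insert_of_mem hx))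
      -- The weight is d₀ + d₁ + d₂ + 3d₃, so w does not affect divisibility by three.
      have := hP (mem_support_iff.mp (hs (Finset.mem_insert_self d s)))
      rw [Finsupp.weight_apply, Finsupp.sum_fintype _ (fun i c => c • weight i) (fun i => zero_smul _ _),
        Fin.sum_univ_four] at this
      simp only [weight, Matrix.cons_val, smul_eq_mul] at this
      omega
  have := hsum P.support subset_rfl
  rwa [← MvPolynomial.as_sum P] at this

/-- The elements of degree divisible by three fixed by the Heisenberg group come from the
coordinate ring of the cuspidal double plane. -/
theorem exists_heisMap_eq {m : ℕ} {x : MvPolynomial (Fin 4) ℂ ⧸ coverIdeal phiSix}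
    (hx : x ∈ coverGrading phiSix (3 * m)) (h1 : coverRingMap coverG1 x = x)
    (h2 : coverRingMap coverG2 x = x) : ∃ y ∈ coverGrading phiSix' m, heisMap y = x := by
  -- The double trace of a fixed element is 9x. Divided by 9, it places x in the image of `heisMap`,
  -- and a preimage can be cut down to its component of degree m.
  have h := mul_mem (coverClass_C_mem (1 / 9)) (trace_mem hx)
  have h9 : coverClass phiSix (C (1 / 9)) * 9 = 1 := by
    rw [← map_ofNat (coverClass phiSix) 9, ← map_mul, ← map_ofNat C 9, ← C_mul,
      one_div_mul_cancel (by norm_num), C_1, map_one]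
  have e2 : traceG2 x = 3 * x := by
    rw [traceG2, h2, h2]
    ring
  have e1 : traceG1 (3 * x) = 9 * x := by
    rw [traceG1, map_mul, h1, map_ofNat, map_mul, h1, map_ofNat]
    ring
  rw [e2, e1, ← mul_assoc, h9, one_mul] at h
  obtain ⟨y, rfl⟩ := h
  exact exists_homogeneous_preimage heisMap three_pos heisMap_mem hx

/-! ### The group `Γ` and the pencil -/

/-- The Fermat cubic `x³ + y³ + z³`. -/
def fermat : MvPolynomial (Fin 3) ℂ := X 0 ^ 3 + X 1 ^ 3 + X 2 ^ 3

/-- The triangle `xyz`. -/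
def triangle : MvPolynomial (Fin 3) ℂ := X 0 * X 1 * X 2

theorem subst_fermat (A : Matrix (Fin 3) (Fin 3) ℂ) :
    subst A fermat = subst A (X 0) ^ 3 + subst A (X 1) ^ 3 + subst A (X 2) ^ 3 := by
  simp [fermat]

theorem subst_triangle (A : Matrix (Fin 3) (Fin 3) ℂ) :
    subst A triangle = subst A (X 0) * subst A (X 1) * subst A (X 2) := by
  simp [triangle]

theorem subst_C (A : Matrix (Fin 3) (Fin 3) ℂ) (c : ℂ) : subst A (C c) = C c :=
  (subst A).commutes c

/-- The numbers p, q, r, s form the matrix of the substitution on the two generators of the pencil.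
Invertibility of this matrix lets both generators be recovered by Cramer's rule. -/
theorem mem_linearHessianGroup {A : GL (Fin 3) ℂ} {p q r s : ℂ}
    (ha : subst A.1 fermat = C p * fermat + C q * triangle)
    (hb : subst A.1 triangle = C r * fermat + C s * triangle) (h : p * s - q * r ≠ 0) :
    A ∈ linearHessianGroup := by
  have h1 : hessePencil = Submodule.span ℂ {fermat, triangle} := rfl
  change hessePencil.map (subst A.1).toLinearMap = hessePencil
  rw [h1, Submodule.map_span, Set.image_pair]
  change Submodule.span ℂ {subst A.1 fermat, subst A.1 triangle} = _
  rw [ha, hb]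
  refine le_antisymm (Submodule.span_le.mpr ?_) (Submodule.span_le.mpr ?_)
  · rintro _ (rfl | rfl)
    · exact Submodule.mem_span_pair.mpr ⟨p, q, by simp only [smul_eq_C_mul]⟩
    · exact Submodule.mem_span_pair.mpr ⟨r, s, by simp only [smul_eq_C_mul]⟩
  · have hC : (C p * C s - C q * C r) * C (p * s - q * r)⁻¹ =
        (1 : MvPolynomial (Fin 3) ℂ) := by
      rw [← C_mul, ← C_mul, ← C_sub, ← C_mul, mul_inv_cancel₀ h, C_1]
    rintro _ (rfl | rfl)
    · refine Submodule.mem_span_pair.mpr ⟨s * (p * s - q * r)⁻¹, -q * (p * s - q * r)⁻¹, ?_⟩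
      simp only [smul_eq_C_mul, C_mul, C_neg]
      linear_combination fermat * hC
    · refine Submodule.mem_span_pair.mpr ⟨-r * (p * s - q * r)⁻¹, p * (p * s - q * r)⁻¹, ?_⟩
      simp only [smul_eq_C_mul, C_mul, C_neg]
      linear_combination triangle * hC

theorem exists_of_mem_linearHessianGroup {A : GL (Fin 3) ℂ} (hA : A ∈ linearHessianGroup) :
    (∃ p q : ℂ, subst A.1 fermat = C p * fermat + C q * triangle) ∧
      ∃ r s : ℂ, subst A.1 triangle = C r * fermat + C s * triangle := by
  have h1 : hessePencil = Submodule.span ℂ {fermat, triangle} := rfl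
  have h : ∀ P ∈ hessePencil, ∃ p q : ℂ, subst A.1 P = C p * fermat + C q * triangle := by
    intro P hP
    have h2 : subst A.1 P ∈ hessePencil := by
      have h3 : hessePencil.map (subst A.1).toLinearMap = hessePencil := hA
      rw [← h3]
      exact Submodule.mem_map_of_mem hP
    rw [h1] at h2
    obtain ⟨p, q, h4⟩ := Submodule.mem_span_pair.mp h2
    exact ⟨p, q, by rw [← h4, smul_eq_C_mul, smul_eq_C_mul]⟩
  exact ⟨h _ (Submodule.subset_span (by left; rfl)), h _ (Submodule.subset_span (by right; rfl))⟩

/-- If the product of three linear forms is a multiple of `xyz`, then for each coordinate line some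
form vanishes on it. -/
theorem exists_row_eq_zero {A : Matrix (Fin 3) (Fin 3) ℂ} {μ : ℂ}
    (hb : subst A triangle = C μ * triangle) (j : Fin 3) : ∃ i, ∀ k, k ≠ j → A i k = 0 := by
  -- Restriction to the line x_j = 0. The product of the three forms vanishes there, so one of them
  -- does.
  let f : MvPolynomial (Fin 3) ℂ →ₐ[ℂ] MvPolynomial (Fin 3) ℂ :=
    aeval fun k => if k = j then 0 else X k
  have hf (k : Fin 3) : f (X k) = if k = j then 0 else X k := aeval_X _ _
  have h0 : f triangle = 0 := by
    rw [triangle, map_mul, map_mul, hf, hf, hf]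
    fin_cases j <;> simp
  have h : f (subst A (X 0)) * f (subst A (X 1)) * f (subst A (X 2)) = 0 := by
    rw [← map_mul, ← map_mul, ← subst_triangle, hb, map_mul, h0, mul_zero]
  have key (i : Fin 3) (hi : f (subst A (X i)) = 0) : ∀ k, k ≠ j → A i k = 0 := by
    intro k hk
    have h1 := congrArg (eval (Pi.single k 1)) hi
    rw [subst_X] at h1
    have hfC (a : ℂ) : f (C a) = C a := f.commutes a
    simp only [map_add, map_mul, hf, hfC, eval_C, map_zero] at h1
    fin_cases k <;> fin_cases j <;> simp_all
  rcases mul_eq_zero.mp h with h | h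
  · rcases mul_eq_zero.mp h with h | h
    · exact ⟨0, key 0 h⟩
    · exact ⟨1, key 1 h⟩
  · exact ⟨2, key 2 h⟩

theorem g1_val : g1.1 = !![0, 1, 0; 0, 0, 1; 1, 0, 0] := rfl

theorem g2_val : g2.1 = Matrix.diagonal ![1, eps, eps ^ 2] := by
  change !![1, 0, 0; 0, eps, 0; 0, 0, eps ^ 2] = _
  ext i j
  fin_cases i <;> fin_cases j <;> rfl

theorem mk_g1_mem : Matrix.ProjGenLinGroup.mk g1 ∈ Gam := Subgroup.subset_closure (by left; rfl)

theorem mk_g2_mem : Matrix.ProjGenLinGroup.mk g2 ∈ Gam := Subgroup.subset_closure (by right; rfl)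

theorem mk_eq_mk_of_smul {A B : GL (Fin 3) ℂ} {c : ℂ} (hc : c ≠ 0) (h : A.1 = c • B.1) :
    Matrix.ProjGenLinGroup.mk A = Matrix.ProjGenLinGroup.mk B := by
  refine (Matrix.ProjGenLinGroup.mk_eq_mk_iff.mpr ⟨Units.mk0 c hc, Units.ext ?_⟩).symm
  rw [h, Units.val_mul]
  simp [Matrix.smul_eq_mul_diagonal]

theorem exists_smul_of_mk_eq_mk {A B : GL (Fin 3) ℂ}
    (h : Matrix.ProjGenLinGroup.mk A = Matrix.ProjGenLinGroup.mk B) :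
    ∃ c : ℂ, c ≠ 0 ∧ A.1 = c • B.1 := by
  obtain ⟨u, rfl⟩ := Matrix.ProjGenLinGroup.mk_eq_mk_iff.mp h.symm
  exact ⟨u, u.ne_zero, by simp [Matrix.smul_eq_mul_diagonal]⟩

/-- After division by p the diagonal factor is (1, ε^j, ε^{2j}), a power of g₂. Its last entry is
s/p = p/q, because pqs = 1 and p³ = 1. -/
theorem mk_mem_Gam_of_diagonal_mul {A : GL (Fin 3) ℂ} {p q s : ℂ} (n : ℕ)
    (hA : A.1 = Matrix.diagonal ![p, q, s] * g1.1 ^ n) (hp : p ^ 3 = 1) (hq : q ^ 3 = 1)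
    (h : p * q * s = 1) : Matrix.ProjGenLinGroup.mk A ∈ Gam := by
  have hp0 : p ≠ 0 := by rintro rfl; norm_num at hp
  have hq0 : q ≠ 0 := by rintro rfl; norm_num at hq
  obtain ⟨j, -, hj⟩ := eps_isPrimitiveRoot.eq_pow_of_pow_eq_one (ξ := q / p)
    (by rw [div_pow, hp, hq, div_one])
  have hqj : q = p * eps ^ j := by rw [hj, mul_div_cancel₀ _ hp0]
  have hsj : s = p * (eps ^ 2) ^ j := by
    refine mul_left_cancel₀ (mul_ne_zero hp0 hq0) (h.trans ?_)
    have h3 : (eps ^ j) ^ 3 = 1 := by rw [← pow_mul, mul_comm, pow_mul, eps_pow_three, one_pow]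
    rw [hqj, ← pow_mul, mul_comm 2 j, pow_mul]
    linear_combination -(eps ^ j) ^ 3 * hp - h3
  have : Matrix.ProjGenLinGroup.mk A = Matrix.ProjGenLinGroup.mk (g2 ^ j * g1 ^ n) := by
    refine mk_eq_mk_of_smul hp0 ?_
    rw [hA, Units.val_mul, Units.val_pow_eq_pow_val, Units.val_pow_eq_pow_val, g2_val,
      Matrix.diagonal_pow, ← smul_mul_assoc, ← Matrix.diagonal_smul]
    congr 2
    ext i
    fin_cases i
    · simp
    · simpa using hqj
    · simpa using hsj
  rw [this, map_mul, map_pow, map_pow]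
  exact mul_mem (pow_mem mk_g2_mem _) (pow_mem mk_g1_mem _)

/-- A linear map of determinant one multiplying the cubics of the Hesse pencil by a cube root of
unity lies over `Γ`. -/
theorem mk_mem_Gam {A : GL (Fin 3) ℂ} (hdet : A.1.det = 1) {μ : ℂ} (hμ : μ ^ 3 = 1)
    (ha : subst A.1 fermat = C μ * fermat) (hb : subst A.1 triangle = C μ * triangle) :
    Matrix.ProjGenLinGroup.mk A ∈ Gam := by
  obtain ⟨i0, h0⟩ := exists_row_eq_zero hb 0
  obtain ⟨i1, h1⟩ := exists_row_eq_zero hb 1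
  obtain ⟨i2, h2⟩ := exists_row_eq_zero hb 2
  have ea (v : Fin 3 → ℂ) := congrArg (eval v) ha
  have eb := congrArg (eval ![1, 1, 1]) hb
  rw [subst_fermat] at ea
  rw [subst_triangle] at eb
  simp only [subst_X, fermat, triangle, map_add, map_mul, map_pow, eval_C, eval_X,
    Matrix.cons_val] at ea eb
  have ea0 := ea ![1, 0, 0]
  have ea1 := ea ![0, 1, 0]
  have ea2 := ea ![0, 0, 1]
  simp only [Matrix.cons_val] at ea0 ea1 ea2
  have hne {i j k : Fin 3} (hjk : j ≠ k) (hj : ∀ l, l ≠ j → A.1 i l = 0)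
      (hk : ∀ l, l ≠ k → A.1 i l = 0) : False := by
    rw [Matrix.det_eq_zero_of_row_eq_zero i fun l => ?_] at hdet
    · exact zero_ne_one hdet
    · by_cases hl : l = j
      · exact hk l (hl ▸ hjk)
      · exact hj l hl
  have h01 : i0 ≠ i1 := by rintro rfl; exact hne (by decide) h0 h1
  have h02 : i0 ≠ i2 := by rintro rfl; exact hne (by decide) h0 h2
  have h12 : i1 ≠ i2 := by rintro rfl; exact hne (by decide) h1 h2
  rw [Matrix.det_fin_three] at hdet
  have a0 := h0 1 (by decide)
  have b0 := h0 2 (by decide)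
  have a1 := h1 0 (by decide)
  have b1 := h1 2 (by decide)
  have a2 := h2 0 (by decide)
  have b2 := h2 1 (by decide)
  -- Each row of A has a single nonzero entry, so A is a monomial matrix. The product of its entries
  -- is μ, by evaluating xyz at (1, 1, 1), and is ±det A = ±1 according to the sign of the
  -- permutation. An odd permutation would give μ = −1, which is not a cube root of unity. An even
  -- one gives μ = 1, and the values of the Fermat cubic at the basis vectors make each entry a cube
  -- root of unity.
  have hodd (h : μ = -1) : False := by
    rw [h] at hμ
    norm_num at hμ
  have hcase : (i0 = 0 ∧ i1 = 1 ∧ i2 = 2) ∨ (i0 = 2 ∧ i1 = 0 ∧ i2 = 1) ∨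
      (i0 = 1 ∧ i1 = 2 ∧ i2 = 0) ∨ (i0 = 0 ∧ i1 = 2 ∧ i2 = 1) ∨ (i0 = 1 ∧ i1 = 0 ∧ i2 = 2) ∨
      (i0 = 2 ∧ i1 = 1 ∧ i2 = 0) := by
    clear * - h01 h02 h12
    revert i0 i1 i2
    decide
  clear h0 h1 h2 h01 h02 h12 hne ha hb ea
  rcases hcase with ⟨rfl, rfl, rfl⟩ | ⟨rfl, rfl, rfl⟩ | ⟨rfl, rfl, rfl⟩ | ⟨rfl, rfl, rfl⟩ |
    ⟨rfl, rfl, rfl⟩ | ⟨rfl, rfl, rfl⟩ <;>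
    simp only [a0, b0, a1, b1, a2, b2, zero_mul, mul_zero, add_zero, zero_add,
      sub_zero, zero_sub, mul_one, one_pow, ne_eq, OfNat.ofNat_ne_zero, not_false_eq_true,
      zero_pow] at hdet ea0 ea1 ea2 eb
  · have hμ1 : μ = 1 := by rw [← eb, ← hdet]
    refine mk_mem_Gam_of_diagonal_mul (p := A.1 0 0) (q := A.1 1 1) (s := A.1 2 2) 0 ?_
      (ea0.trans hμ1) (ea1.trans hμ1) hdet
    rw [pow_zero, mul_one]
    ext i j
    fin_cases i <;> fin_cases j <;> simp [a0, b0, a1, b1, a2, b2]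
  · have hμ1 : μ = 1 := by rw [← eb, ← hdet]
    refine mk_mem_Gam_of_diagonal_mul (p := A.1 0 1) (q := A.1 1 2) (s := A.1 2 0) 1 ?_
      (ea1.trans hμ1) (ea2.trans hμ1) hdet
    rw [pow_one, g1_val]
    ext i j
    fin_cases i <;> fin_cases j <;> simp [a0, b0, a1, b1, a2, b2]
  · have hμ1 : μ = 1 := by rw [← eb, ← hdet]
    refine mk_mem_Gam_of_diagonal_mul (p := A.1 0 2) (q := A.1 1 0) (s := A.1 2 1) 2 ?_
      (ea2.trans hμ1) (ea0.trans hμ1) (by rw [← hdet])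
    rw [pow_two, g1_val]
    ext i j
    fin_cases i <;> fin_cases j <;> simp [a0, b0, a1, b1, a2, b2]
  · exact (hodd (by linear_combination -eb - hdet)).elim
  · exact (hodd (by linear_combination -eb - hdet)).elim
  · exact (hodd (by linear_combination -eb - hdet)).elim

/-- The linear transformations of determinant one fixing the cubics of the Hesse pencil, the
sextic `Φ₆` and the product of the differences of the cubes of the coordinates. -/
def pencilStabilizer : Subgroup (GL (Fin 3) ℂ) where
  carrier := {A | A.1.det = 1 ∧ subst A.1 fermat = fermat ∧ subst A.1 triangle = triangle ∧
    subst A.1 phiSix.1 = phiSix.1 ∧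
    subst A.1 (cubeDisc (X 0) (X 1) (X 2)) = cubeDisc (X 0) (X 1) (X 2)}
  mul_mem' := by
    rintro A B ⟨h0, h1, h2, h3, h4⟩ ⟨k0, k1, k2, k3, k4⟩
    refine ⟨by rw [Units.val_mul, Matrix.det_mul, h0, k0, one_mul], ?_, ?_, ?_, ?_⟩
    · rw [Units.val_mul, subst_mul, AlgHom.comp_apply, h1, k1]
    · rw [Units.val_mul, subst_mul, AlgHom.comp_apply, h2, k2]
    · rw [Units.val_mul, subst_mul, AlgHom.comp_apply, h3, k3]
    · rw [Units.val_mul, subst_mul, AlgHom.comp_apply, h4, k4]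
  one_mem' := by simp [subst_one]
  inv_mem' := by
    rintro A ⟨h0, h1, h2, h3, h4⟩
    have h (P) (hP : subst A.1 P = P) : subst A⁻¹.1 P = P := by
      conv_lhs => rw [← hP]
      rw [← AlgHom.comp_apply, ← subst_mul, Units.mul_inv, subst_one, AlgHom.id_apply]
    refine ⟨?_, h _ h1, h _ h2, h _ h3, h _ h4⟩
    have := congrArg Matrix.det (Units.mul_inv A)
    rwa [Matrix.det_mul, h0, one_mul, Matrix.det_one] at this

theorem map_cubeDisc {σ R : Type} [CommRing R] [Algebra ℂ R] (f : MvPolynomial σ ℂ →ₐ[ℂ] R)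
    (x y z : MvPolynomial σ ℂ) : f (cubeDisc x y z) = cubeDisc (f x) (f y) (f z) := by
  simp [cubeDisc]

theorem g1_mem_pencilStabilizer : g1 ∈ pencilStabilizer := by
  obtain ⟨h0, h1, h2⟩ := subst_g1
  refine ⟨by simp [g1_val, Matrix.det_fin_three], ?_, ?_, ?_, ?_⟩
  · rw [subst_fermat, h0, h1, h2, fermat]
    ring
  · rw [subst_triangle, h0, h1, h2, triangle]
    ring
  · have : subst g1.1 phiSix.1 = C ((1 : ℂ) ^ 2) * phiSix.1 := coverG1.2
    rwa [one_pow, C_1, one_mul] at this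
  · rw [map_cubeDisc, h0, h1, h2]
    unfold cubeDisc
    ring

theorem g2_mem_pencilStabilizer : g2 ∈ pencilStabilizer := by
  obtain ⟨h0, h1, h2⟩ := subst_g2
  have h3 : (C eps : MvPolynomial (Fin 3) ℂ) ^ 3 = 1 := C_eps_pow_three
  refine ⟨?_, ?_, ?_, ?_, ?_⟩
  · rw [g2_val, Matrix.det_diagonal, Fin.prod_univ_three]
    simp only [Matrix.cons_val]
    linear_combination eps_pow_three
  · rw [subst_fermat, h0, h1, h2, fermat, C_pow]
    linear_combination (X 1 ^ 3 + (C eps ^ 3 + 1) * X 2 ^ 3) * h3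
  · rw [subst_triangle, h0, h1, h2, triangle, C_pow]
    linear_combination X 0 * X 1 * X 2 * h3
  · have : subst g2.1 phiSix.1 = C ((1 : ℂ) ^ 2) * phiSix.1 := coverG2.2
    rwa [one_pow, C_1, one_mul] at this
  · rw [map_cubeDisc, h0, h1, h2]
    unfold cubeDisc
    rw [mul_pow, mul_pow, C_pow, ← pow_mul, mul_comm 2 3, pow_mul, h3, one_pow, one_mul, one_mul]

theorem subst_smul_X (c : ℂ) (A : Matrix (Fin 3) (Fin 3) ℂ) (i : Fin 3) :
    subst (c • A) (X i) = C c * subst A (X i) := by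
  simp only [subst_X, Matrix.smul_apply, smul_eq_mul, C_mul]
  ring

theorem Gam_le_map : Gam ≤ pencilStabilizer.map Matrix.ProjGenLinGroup.mk := by
  refine (Subgroup.closure_le _).mpr ?_
  rintro _ (rfl | rfl)
  · exact ⟨g1, g1_mem_pencilStabilizer, rfl⟩
  · exact ⟨g2, g2_mem_pencilStabilizer, rfl⟩

/-- A lift of determinant one differs from a lift in the stabilizer by a scalar c with c³ = 1. The
polynomials to be fixed have degrees 3, 3, 6 and 9, so this scalar has no effect on them. -/
theorem mem_pencilStabilizer {A : GL (Fin 3) ℂ} (hdet : A.1.det = 1)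
    (h : Matrix.ProjGenLinGroup.mk A ∈ Gam) : A ∈ pencilStabilizer := by
  obtain ⟨B, ⟨h0, h1, h2, h3, h4⟩, hAB⟩ := Gam_le_map h
  obtain ⟨c, hc, hA⟩ := exists_smul_of_mk_eq_mk hAB.symm
  have hc3 : c ^ 3 = 1 := by
    rwa [hA, Matrix.det_smul, h0, mul_one, Fintype.card_fin] at hdet
  have hC : (C c : MvPolynomial (Fin 3) ℂ) ^ 3 = 1 := by rw [← C_pow, hc3, C_1]
  refine ⟨hdet, ?_, ?_, ?_, ?_⟩
  · rw [subst_fermat] at h1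
    rw [hA, subst_fermat, subst_smul_X, subst_smul_X, subst_smul_X]
    linear_combination (subst B.1 (X 0) ^ 3 + subst B.1 (X 1) ^ 3 + subst B.1 (X 2) ^ 3) * hC + h1
  · rw [subst_triangle] at h2
    rw [hA, subst_triangle, subst_smul_X, subst_smul_X, subst_smul_X]
    linear_combination (subst B.1 (X 0) * subst B.1 (X 1) * subst B.1 (X 2)) * hC + h2
  · rw [map_phiSix] at h3
    rw [hA, map_phiSix, subst_smul_X, subst_smul_X, subst_smul_X]
    unfold phiSixAt at h3 ⊢
    generalize subst B.1 (X 0) = x at h3 ⊢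
    generalize subst B.1 (X 1) = y at h3 ⊢
    generalize subst B.1 (X 2) = z at h3 ⊢
    linear_combination (x ^ 6 + y ^ 6 + z ^ 6 - 10 * (x ^ 3 * y ^ 3 + x ^ 3 * z ^ 3 + y ^ 3 * z ^ 3))
      * (C c ^ 3 + 1) * hC + h3
  · rw [map_cubeDisc] at h4
    rw [hA, map_cubeDisc, subst_smul_X, subst_smul_X, subst_smul_X]
    unfold cubeDisc at h4 ⊢
    rw [mul_pow, mul_pow, mul_pow, hC, one_mul, one_mul, one_mul, h4]

theorem pencilStabilizer_le : pencilStabilizer ≤ linearHessianGroup := fun A hA =>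
  mem_linearHessianGroup (p := 1) (q := 0) (r := 0) (s := 1) (by simp [hA.2.1])
    (by simp [hA.2.2.1]) (by norm_num)

theorem Gam_le_G216 : Gam ≤ G216 :=
  Gam_le_map.trans (Subgroup.map_mono pencilStabilizer_le)

/-- A lift of γ fixes every cubic of the pencil, and g permutes these cubics. The conjugate
therefore fixes them too and has determinant one, so `mk_mem_Gam` applies. -/
theorem conj_mem_Gam {g γ : PGL(3, ℂ)} (hg : g ∈ G216) (hγ : γ ∈ Gam) : g * γ * g⁻¹ ∈ Gam := by
  obtain ⟨A, hA, rfl⟩ := hg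
  obtain ⟨B, ⟨h0, h1, h2, -⟩, rfl⟩ := Gam_le_map hγ
  rw [← map_inv, ← map_mul, ← map_mul]
  obtain ⟨⟨p, q, ha⟩, r, s, hb⟩ := exists_of_mem_linearHessianGroup hA
  have hinv (P : MvPolynomial (Fin 3) ℂ) : subst A⁻¹.1 (subst A.1 P) = P := by
    rw [← AlgHom.comp_apply, ← subst_mul, Units.mul_inv, subst_one, AlgHom.id_apply]
  have hfix (p q : ℂ) : subst B.1 (C p * fermat + C q * triangle) =
      C p * fermat + C q * triangle := by
    rw [map_add, map_mul, map_mul, subst_C, subst_C, h1, h2]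
  refine mk_mem_Gam (μ := 1) ?_ (one_pow 3) ?_ ?_
  · rw [Units.val_mul, Units.val_mul, Matrix.det_mul, Matrix.det_mul, h0, mul_one,
      ← Matrix.det_mul, Units.mul_inv, Matrix.det_one]
  · rw [Units.val_mul, Units.val_mul, subst_mul, subst_mul, AlgHom.comp_apply, AlgHom.comp_apply,
      ha, hfix, ← ha, hinv, C_1, one_mul]
  · rw [Units.val_mul, Units.val_mul, subst_mul, subst_mul, AlgHom.comp_apply, AlgHom.comp_apply,
      hb, hfix, ← hb, hinv, C_1, one_mul]

theorem Gam_normal : (Gam.subgroupOf G216).Normal :=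
  ⟨fun _ hn g => conj_mem_Gam g.2 hn⟩

/-! ### The commutator pairing -/

/-- `A` and `B` commute up to the scalar `c`. -/
def CommuteUpTo (c : ℂ) (A B : GL (Fin 3) ℂ) : Prop := A.1 * B.1 = c • (B.1 * A.1)

namespace CommuteUpTo

variable {c d : ℂ} {A A' B B' : GL (Fin 3) ℂ}

theorem mul_right (h : CommuteUpTo c A B) (h' : CommuteUpTo d A B') :
    CommuteUpTo (c * d) A (B * B') := by
  unfold CommuteUpTo at *
  rw [Units.val_mul, ← mul_assoc, h, smul_mul_assoc, mul_assoc, h', mul_smul_comm, smul_smul,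
    mul_assoc]

theorem mul_left (h : CommuteUpTo c A B) (h' : CommuteUpTo d A' B) :
    CommuteUpTo (c * d) (A * A') B := by
  unfold CommuteUpTo at *
  rw [Units.val_mul, mul_assoc, h', mul_smul_comm, ← mul_assoc, h, smul_mul_assoc, smul_smul,
    mul_assoc, mul_comm c d]

theorem one_right (A : GL (Fin 3) ℂ) : CommuteUpTo 1 A 1 := by
  simp [CommuteUpTo]

theorem one_left (B : GL (Fin 3) ℂ) : CommuteUpTo 1 1 B := by
  simp [CommuteUpTo]

theorem refl (A : GL (Fin 3) ℂ) : CommuteUpTo 1 A A := by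
  simp [CommuteUpTo]

theorem pow_right (h : CommuteUpTo c A B) (n : ℕ) : CommuteUpTo (c ^ n) A (B ^ n) := by
  induction n with
  | zero => simpa using one_right A
  | succ n ih => simpa only [pow_succ] using ih.mul_right h

theorem pow_left (h : CommuteUpTo c A B) (n : ℕ) : CommuteUpTo (c ^ n) (A ^ n) B := by
  induction n with
  | zero => simpa using one_left B
  | succ n ih => simpa only [pow_succ] using ih.mul_left h

theorem swap (h : CommuteUpTo c A B) (hcd : d * c = 1) : CommuteUpTo d B A := by
  unfold CommuteUpTo at *
  rw [h, smul_smul, hcd, one_smul]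

theorem unique (h : CommuteUpTo c A B) (h' : CommuteUpTo d A B) : c = d := by
  have h1 : c • (B * A).1 = d • (B * A).1 := Eq.trans (Eq.symm h) h'
  have h2 := congrArg (· * (B * A)⁻¹.1) h1
  simp only [smul_mul_assoc, Units.mul_inv] at h2
  simpa using congrFun (congrFun h2 0) 0

/-- Rescaling A or B does not change c, so the commutator scalar depends only on the classes in PGL.
-/
theorem congr (h : CommuteUpTo c A B)
    (hA : Matrix.ProjGenLinGroup.mk A = Matrix.ProjGenLinGroup.mk A')
    (hB : Matrix.ProjGenLinGroup.mk B = Matrix.ProjGenLinGroup.mk B') : CommuteUpTo c A' B' := by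
  obtain ⟨a, -, ha⟩ := exists_smul_of_mk_eq_mk hA.symm
  obtain ⟨b, -, hb⟩ := exists_smul_of_mk_eq_mk hB.symm
  unfold CommuteUpTo at *
  simp only [ha, hb, smul_mul_assoc, mul_smul_comm, h, smul_smul]
  ring_nf

theorem conj (h : CommuteUpTo c A B) (g : GL (Fin 3) ℂ) :
    CommuteUpTo c (g * A * g⁻¹) (g * B * g⁻¹) := by
  have e (A B : GL (Fin 3) ℂ) :
      (g * A * g⁻¹).1 * (g * B * g⁻¹).1 = g.1 * (A.1 * B.1) * g⁻¹.1 := by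
    rw [← Units.val_mul, ← Units.val_mul, ← Units.val_mul, ← Units.val_mul]
    congr 1
    group
  unfold CommuteUpTo at *
  rw [e, e, h, mul_smul_comm, smul_mul_assoc]

theorem exists_of_mk_commute (h : Matrix.ProjGenLinGroup.mk A * Matrix.ProjGenLinGroup.mk B =
    Matrix.ProjGenLinGroup.mk B * Matrix.ProjGenLinGroup.mk A) : ∃ c, CommuteUpTo c A B := by
  rw [← map_mul, ← map_mul] at h
  obtain ⟨c, -, hc⟩ := exists_smul_of_mk_eq_mk h
  exact ⟨c, by rwa [Units.val_mul, Units.val_mul] at hc⟩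

theorem mk_commute (h : CommuteUpTo c A B) (hc : c ≠ 0) :
    Commute (Matrix.ProjGenLinGroup.mk A) (Matrix.ProjGenLinGroup.mk B) := by
  unfold Commute SemiconjBy
  rw [← map_mul, ← map_mul]
  exact mk_eq_mk_of_smul hc h

end CommuteUpTo

/-- The Heisenberg relation. It makes Γ abelian and its commutator pairing nondegenerate. -/
theorem commuteUpTo_g1_g2 : CommuteUpTo eps g1 g2 := by
  have := eps_pow_three
  unfold CommuteUpTo
  rw [g1_val, g2_val]
  ext i j
  fin_cases i <;> fin_cases j <;>
    simp [Matrix.mul_apply, Matrix.diagonal] <;>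
    first | ring1 | linear_combination -this

theorem g1_pow_three : g1 ^ 3 = 1 := by
  refine Units.ext ?_
  rw [Units.val_pow_eq_pow_val, g1_val, pow_three, Units.val_one]
  ext i j
  fin_cases i <;> fin_cases j <;> simp [Matrix.mul_apply, Fin.sum_univ_three]

theorem g2_pow_three : g2 ^ 3 = 1 := by
  refine Units.ext ?_
  rw [Units.val_pow_eq_pow_val, g2_val, Matrix.diagonal_pow, Units.val_one,
    ← Matrix.diagonal_one]
  congr 1
  ext i
  fin_cases i
  · simp
  · simpa using eps_pow_three
  · change (eps ^ 2) ^ 3 = 1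
    rw [← pow_mul, mul_comm, pow_mul, eps_pow_three, one_pow]

/-- The pairing is bimultiplicative. The coefficient 2 replaces −1 modulo 3, so that the exponent
stays a natural number. -/
theorem commuteUpTo_weyl (m n m' n' : ℕ) :
    CommuteUpTo (eps ^ (m * n' + 2 * (n * m'))) (g1 ^ m * g2 ^ n) (g1 ^ m' * g2 ^ n') := by
  have h12 := (commuteUpTo_g1_g2.pow_left m).pow_right n'
  have h21 : CommuteUpTo (eps ^ 2) g2 g1 := commuteUpTo_g1_g2.swap
    ((pow_succ eps 2).symm.trans eps_pow_three)
  have h21' := (h21.pow_left n).pow_right m'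
  have h11 := ((CommuteUpTo.refl g1).pow_left m).pow_right m'
  have h22 := ((CommuteUpTo.refl g2).pow_left n).pow_right n'
  have := (h11.mul_right h12).mul_left (h21'.mul_right h22)
  convert this using 1
  simp only [one_pow, one_mul, mul_one, ← pow_mul, pow_add, mul_assoc]

/-! ### Coordinates on `Γ` -/

theorem pow_val_add {G : Type} [Group G] {x : G} (hx : x ^ 3 = 1) (a b : ZMod 3) :
    x ^ (a + b).val = x ^ a.val * x ^ b.val := by
  rw [ZMod.val_add, ← pow_eq_pow_mod _ hx, pow_add]

/-- The class of `g₁` in `PGL(3, ℂ)`. -/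
abbrev u1 : PGL(3, ℂ) := Matrix.ProjGenLinGroup.mk g1

/-- The class of `g₂` in `PGL(3, ℂ)`. -/
abbrev u2 : PGL(3, ℂ) := Matrix.ProjGenLinGroup.mk g2

theorem u1_pow_three : u1 ^ 3 = 1 := by rw [← map_pow, g1_pow_three, map_one]

theorem u2_pow_three : u2 ^ 3 = 1 := by rw [← map_pow, g2_pow_three, map_one]

theorem u1_commute_u2 : Commute u1 u2 := commuteUpTo_g1_g2.mk_commute eps_ne_zero

/-- The element `g₁ ^ p g₂ ^ q`. -/
def weyl (v : Fin 2 → ZMod 3) : GL (Fin 3) ℂ := g1 ^ (v 0).val * g2 ^ (v 1).val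

/-- The parametrization of `Γ` by `𝔽₃²`. -/
def gamCoord : Multiplicative (Fin 2 → ZMod 3) →* PGL(3, ℂ) where
  toFun v := Matrix.ProjGenLinGroup.mk (weyl v.toAdd)
  map_one' := by simp [weyl]
  map_mul' v w := by
    simp only [weyl, map_mul, map_pow, toAdd_mul, Pi.add_apply, pow_val_add u1_pow_three,
      pow_val_add u2_pow_three]
    have := (u1_commute_u2.pow_pow (w.toAdd 0).val (v.toAdd 1).val).eq
    simp only [mul_assoc]
    rw [← mul_assoc (u1 ^ (w.toAdd 0).val), this, mul_assoc]

theorem gamCoord_apply (v : Fin 2 → ZMod 3) :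
    gamCoord (.ofAdd v) = Matrix.ProjGenLinGroup.mk (weyl v) := rfl

theorem gamCoord_e1 : gamCoord (.ofAdd ![1, 0]) = u1 := by
  have : (1 : ZMod 3).val = 1 := rfl
  simp [gamCoord_apply, weyl, this]

theorem gamCoord_e2 : gamCoord (.ofAdd ![0, 1]) = u2 := by
  have : (1 : ZMod 3).val = 1 := rfl
  simp [gamCoord_apply, weyl, this]

theorem gamCoord_range : gamCoord.range = Gam := by
  refine le_antisymm ?_ ((Subgroup.closure_le _).mpr ?_)
  · rintro _ ⟨v, rfl⟩
    change Matrix.ProjGenLinGroup.mk (weyl v.toAdd) ∈ Gam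
    rw [weyl, map_mul, map_pow, map_pow]
    exact mul_mem (pow_mem mk_g1_mem _) (pow_mem mk_g2_mem _)
  · rintro _ (rfl | rfl)
    · exact ⟨_, gamCoord_e1⟩
    · exact ⟨_, gamCoord_e2⟩

theorem exists_gamCoord_eq {γ : PGL(3, ℂ)} (h : γ ∈ Gam) :
    ∃ v : Fin 2 → ZMod 3, gamCoord (.ofAdd v) = γ := by
  rw [← gamCoord_range] at h
  obtain ⟨v, hv⟩ := h
  exact ⟨v.toAdd, hv⟩

/-- The symplectic form on `𝔽₃²`. -/
def symp (v w : Fin 2 → ZMod 3) : ZMod 3 := v 0 * w 1 - v 1 * w 0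

theorem eps_pow_eq_iff {m n : ℕ} : eps ^ m = eps ^ n ↔ (m : ZMod 3) = n := by
  rw [ZMod.natCast_eq_natCast_iff, Nat.ModEq, ← pow_mod_orderOf eps m, ← pow_mod_orderOf eps n,
    ← eps_isPrimitiveRoot.eq_orderOf]
  refine ⟨fun h => ?_, fun h => by rw [h]⟩
  exact eps_isPrimitiveRoot.pow_inj (Nat.mod_lt _ (by norm_num)) (Nat.mod_lt _ (by norm_num)) h

theorem commuteUpTo_weyl_iff {v w : Fin 2 → ZMod 3} {k : ℕ} :
    CommuteUpTo (eps ^ k) (weyl v) (weyl w) ↔ symp v w = k := by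
  have h := commuteUpTo_weyl (v 0).val (v 1).val (w 0).val (w 1).val
  have h3 : symp v w = (((v 0).val * (w 1).val + 2 * ((v 1).val * (w 0).val) : ℕ) : ZMod 3) := by
    have h2 : (2 : ZMod 3) = -1 := rfl
    simp only [symp, Nat.cast_add, Nat.cast_mul, ZMod.natCast_zmod_val, Nat.cast_ofNat, h2]
    ring
  rw [h3, ← eps_pow_eq_iff]
  refine ⟨fun h' => h.unique h', fun h' => ?_⟩
  rw [← h']
  exact h

/-- A vector mapping to the identity pairs trivially with everything, and the symplectic form is
nondegenerate. -/
theorem gamCoord_injective : Function.Injective gamCoord := by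
  rw [injective_iff_map_eq_one]
  intro v hv
  have h (w : Fin 2 → ZMod 3) : symp v.toAdd w = 0 := by
    rw [← Nat.cast_zero, ← commuteUpTo_weyl_iff, pow_zero]
    refine (CommuteUpTo.one_left (weyl w)).congr ?_ rfl
    rw [map_one]
    exact hv.symm
  have h0 := h ![0, 1]
  have h1 := h ![1, 0]
  simp [symp] at h0 h1
  have h2 : v.toAdd = 0 := by
    ext i
    fin_cases i
    · exact h0
    · exact h1
  exact congrArg Multiplicative.ofAdd h2

/-- The isomorphism of `Γ` with `𝔽₃²`. -/
def gamEquiv : Multiplicative (Fin 2 → ZMod 3) ≃* Gam :=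
  (MonoidHom.ofInjective gamCoord_injective).trans (MulEquiv.subgroupCongr gamCoord_range)

theorem nonempty_gam_mulEquiv : Nonempty (Gam ≃* Multiplicative (ZMod 3 × ZMod 3)) :=
  ⟨gamEquiv.symm.trans (AddEquiv.toMultiplicative
    (LinearEquiv.finTwoArrow (ZMod 3) (ZMod 3)).toAddEquiv)⟩

/-! ### The action of the Hessian group on `Γ` by conjugation -/

/-- The matrix `M` describes conjugation by `g` on `Γ`. -/
def ConjBy (g : PGL(3, ℂ)) (M : Matrix (Fin 2) (Fin 2) (ZMod 3)) : Prop :=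
  ∀ v, g * gamCoord (.ofAdd v) * g⁻¹ = gamCoord (.ofAdd (M.mulVec v))

theorem gamCoord_nsmul (n : ℕ) (v : Fin 2 → ZMod 3) :
    gamCoord (.ofAdd (n • v)) = gamCoord (.ofAdd v) ^ n := by
  rw [ofAdd_nsmul, map_pow]

theorem conjBy_of {g : PGL(3, ℂ)} {a b c d : ZMod 3}
    (h1 : g * u1 * g⁻¹ = gamCoord (.ofAdd ![a, c])) (h2 : g * u2 * g⁻¹ = gamCoord (.ofAdd ![b, d])) :
    ConjBy g !![a, b; c, d] := by
  intro v
  have e1 : gamCoord (.ofAdd v) = u1 ^ (v 0).val * u2 ^ (v 1).val := by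
    rw [gamCoord_apply, weyl, map_mul, map_pow, map_pow]
  have e2 : !![a, b; c, d].mulVec v = (v 0).val • ![a, c] + (v 1).val • ![b, d] := by
    ext i
    fin_cases i <;>
      simp [Matrix.mulVec, dotProduct, Fin.sum_univ_two, mul_comm]
  rw [e1, e2, ofAdd_add, map_mul, gamCoord_nsmul, gamCoord_nsmul, ← h1, ← h2, conj_pow, conj_pow]
  group

theorem exists_conjBy {g : PGL(3, ℂ)} (hg : g ∈ G216) : ∃ M, ConjBy g M := by
  obtain ⟨v, hv⟩ := exists_gamCoord_eq (conj_mem_Gam hg mk_g1_mem)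
  obtain ⟨w, hw⟩ := exists_gamCoord_eq (conj_mem_Gam hg mk_g2_mem)
  refine ⟨!![v 0, w 0; v 1, w 1], conjBy_of ?_ ?_⟩
  · rw [← hv]
    congr 2
    ext i
    fin_cases i <;> rfl
  · rw [← hw]
    congr 2
    ext i
    fin_cases i <;> rfl

namespace ConjBy

variable {g h : PGL(3, ℂ)} {M N : Matrix (Fin 2) (Fin 2) (ZMod 3)}

theorem mul (hM : ConjBy g M) (hN : ConjBy h N) : ConjBy (g * h) (M * N) := by
  intro v
  rw [← Matrix.mulVec_mulVec, ← hM, ← hN]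
  group

theorem unique (hM : ConjBy g M) (hN : ConjBy g N) : M = N := by
  refine Matrix.ext_of_mulVec_single fun i => ?_
  exact Multiplicative.ofAdd.injective (gamCoord_injective ((hM _).symm.trans (hN _)))

/-- Conjugation preserves the commutator scalar, so M preserves the symplectic form. On the standard
basis this says that the determinant is 1. -/
theorem det_eq_one (hM : ConjBy g M) : M.det = 1 := by
  obtain ⟨A, rfl⟩ := Matrix.ProjGenLinGroup.mk_surjective g
  have h : CommuteUpTo (eps ^ 1) (weyl ![1, 0]) (weyl ![0, 1]) := by
    rw [commuteUpTo_weyl_iff]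
    simp [symp]
  have h' := (h.conj A).congr (A' := weyl (M.mulVec ![1, 0])) (B' := weyl (M.mulVec ![0, 1]))
    (by rw [← gamCoord_apply, ← hM, map_mul, map_mul, map_inv, gamCoord_apply])
    (by rw [← gamCoord_apply, ← hM, map_mul, map_mul, map_inv, gamCoord_apply])
  rw [commuteUpTo_weyl_iff] at h'
  simpa [symp, Matrix.mulVec, dotProduct, Fin.sum_univ_two, Matrix.det_fin_two, mul_comm] using h'

theorem of_mem_Gam (hg : g ∈ Gam) : ConjBy g 1 := by
  obtain ⟨w, rfl⟩ := exists_gamCoord_eq hg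
  intro v
  rw [Matrix.one_mulVec, ← map_mul, mul_comm, map_mul, mul_inv_cancel_right]

end ConjBy

/-- A linear map commuting with `g₁` and `g₂` is scalar. -/
theorem mk_eq_one_of_commute {B : GL (Fin 3) ℂ} (h1 : CommuteUpTo 1 B g1)
    (h2 : CommuteUpTo 1 B g2) : Matrix.ProjGenLinGroup.mk B = 1 := by
  -- Commuting with g₂, whose eigenvalues are distinct, makes B diagonal. Commuting with the cyclic
  -- permutation g₁ then makes its diagonal entries equal.
  have hoff (i j : Fin 3) (hij : i ≠ j) : B.1 i j = 0 := by
    have := congrFun (congrFun h2 i) j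
    rw [g2_val, one_smul, Matrix.mul_diagonal, Matrix.diagonal_mul] at this
    have hinj : (![1, eps, eps ^ 2] : Fin 3 → ℂ) j - (![1, eps, eps ^ 2] : Fin 3 → ℂ) i ≠ 0 := by
      have e (k : Fin 3) : (![1, eps, eps ^ 2] : Fin 3 → ℂ) k = eps ^ (k : ℕ) := by
        fin_cases k <;> simp
      rw [e, e, sub_ne_zero]
      intro h
      exact hij (Fin.ext (eps_isPrimitiveRoot.pow_inj j.2 i.2 h)).symm
    refine (mul_eq_zero.mp (?_ : _ * B.1 i j = 0)).resolve_left hinj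
    linear_combination this
  have e01 := congrFun (congrFun h1 0) 1
  have e12 := congrFun (congrFun h1 1) 2
  simp [g1_val, Matrix.mul_apply, Matrix.vecMul, dotProduct, Fin.sum_univ_three] at e01 e12
  have hB : B.1 = B.1 0 0 • (1 : GL (Fin 3) ℂ).1 := by
    ext i j
    fin_cases i <;> fin_cases j <;> simp [hoff, e01, e12]
  have h0 : B.1 0 0 ≠ 0 := by
    intro h
    rw [h, zero_smul] at hB
    exact B.ne_zero hB
  rw [mk_eq_mk_of_smul h0 hB, map_one]

/-- A lift A commutes with g₁ and g₂ up to cube roots of unity. As the pairing is perfect, these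
scalars are cancelled by multiplying A by a word in g₁ and g₂, and what results is scalar. -/
theorem mem_Gam_of_conjBy_one {g : PGL(3, ℂ)} (h : ConjBy g 1) : g ∈ Gam := by
  obtain ⟨A, rfl⟩ := Matrix.ProjGenLinGroup.mk_surjective g
  have hc (v : Fin 2 → ZMod 3) : Matrix.ProjGenLinGroup.mk A * gamCoord (.ofAdd v) =
      gamCoord (.ofAdd v) * Matrix.ProjGenLinGroup.mk A := by
    have := h v
    rw [Matrix.one_mulVec] at this
    exact mul_inv_eq_iff_eq_mul.mp this
  have h1 := hc ![1, 0]
  have h2 := hc ![0, 1]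
  rw [gamCoord_e1] at h1
  rw [gamCoord_e2] at h2
  obtain ⟨α, hα⟩ := CommuteUpTo.exists_of_mk_commute h1
  obtain ⟨β, hβ⟩ := CommuteUpTo.exists_of_mk_commute h2
  have hα3 : α ^ 3 = 1 := by
    have := hα.pow_right 3
    rw [g1_pow_three] at this
    exact this.unique (CommuteUpTo.one_right A)
  have hβ3 : β ^ 3 = 1 := by
    have := hβ.pow_right 3
    rw [g2_pow_three] at this
    exact this.unique (CommuteUpTo.one_right A)
  obtain ⟨i, -, rfl⟩ := eps_isPrimitiveRoot.eq_pow_of_pow_eq_one hα3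
  obtain ⟨j, -, rfl⟩ := eps_isPrimitiveRoot.eq_pow_of_pow_eq_one hβ3
  have h3 (n : ℕ) : eps ^ n * eps ^ (2 * n) = 1 := by
    rw [← pow_add, show n + 2 * n = 3 * n by ring, pow_mul, eps_pow_three, one_pow]
  -- The element g₁^{2j} g₂^i has commutator scalars ε^{2i} with g₁ and ε^{2j} with g₂, inverse to
  -- the scalars ε^i and ε^j of A.
  have w1 := commuteUpTo_weyl (2 * j) i 1 0
  have w2 := commuteUpTo_weyl (2 * j) i 0 1
  simp only [pow_one, pow_zero, mul_one, one_mul, mul_zero, zero_add, add_zero] at w1 w2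
  have k1 := hα.mul_left w1
  have k2 := hβ.mul_left w2
  rw [h3] at k1 k2
  have := mk_eq_one_of_commute k1 k2
  rw [map_mul, mul_eq_one_iff_eq_inv] at this
  rw [this, map_mul, map_pow, map_pow]
  exact inv_mem (mul_mem (pow_mem mk_g1_mem _) (pow_mem mk_g2_mem _))

/-- The action of the Hessian group on `Γ` by conjugation, in coordinates. -/
def conjMatrix : G216 →* SL(2, ZMod 3) where
  toFun g := ⟨(exists_conjBy g.2).choose, (exists_conjBy g.2).choose_spec.det_eq_one⟩
  map_one' := Subtype.ext ((exists_conjBy (1 : G216).2).choose_spec.unique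
    (ConjBy.of_mem_Gam (one_mem _)))
  map_mul' g h := Subtype.ext ((exists_conjBy (g * h).2).choose_spec.unique
    ((exists_conjBy g.2).choose_spec.mul (exists_conjBy h.2).choose_spec))

theorem conjMatrix_conjBy (g : G216) : ConjBy g.1 (conjMatrix g).1 :=
  (exists_conjBy g.2).choose_spec

theorem conjMatrix_eq {g : G216} {M : SL(2, ZMod 3)} (h : ConjBy g.1 M.1) : conjMatrix g = M :=
  Subtype.ext ((conjMatrix_conjBy g).unique h)

theorem conjMatrix_ker : conjMatrix.ker = Gam.subgroupOf G216 := by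
  ext g
  rw [MonoidHom.mem_ker, Subgroup.mem_subgroupOf]
  refine ⟨fun h => mem_Gam_of_conjBy_one ?_, fun h => conjMatrix_eq (ConjBy.of_mem_Gam h)⟩
  have := conjMatrix_conjBy g
  rwa [h] at this

/-! ### Generators of the Hessian group -/

section FourierIdentities

variable {R : Type} [CommRing R] {e : R}

theorem fourier_sum_cubes (x y z : R) (h : e ^ 2 + e + 1 = 0) :
    (x + y + z) ^ 3 + (x + e * y + e ^ 2 * z) ^ 3 + (x + e ^ 2 * y + e * z) ^ 3 =
      3 * (x ^ 3 + y ^ 3 + z ^ 3) + 18 * (x * y * z) := by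
  grind

theorem fourier_prod (x y z : R) (h : e ^ 2 + e + 1 = 0) :
    (x + y + z) * (x + e * y + e ^ 2 * z) * (x + e ^ 2 * y + e * z) =
      x ^ 3 + y ^ 3 + z ^ 3 - 3 * (x * y * z) := by
  grind

theorem fourier_phiSixAt (x y z : R) (h : e ^ 2 + e + 1 = 0) :
    phiSixAt (x + y + z) (x + e * y + e ^ 2 * z) (x + e ^ 2 * y + e * z) =
      -27 * phiSixAt x y z := by
  unfold phiSixAt
  grind

/-- V is a product of nine linear forms. The transform permutes them up to constants, which is seen
by factoring each difference of cubes. -/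
theorem fourier_cubeDisc (x y z : R) (h : e ^ 2 + e + 1 = 0) :
    cubeDisc (x + y + z) (x + e * y + e ^ 2 * z) (x + e ^ 2 * y + e * z) =
      81 * (e - e ^ 2) * cubeDisc x y z := by
  have h1 : (x + y + z) ^ 3 - (x + e * y + e ^ 2 * z) ^ 3 =
      (1 - e) ^ 3 * (y - e ^ 2 * z) * (x - e ^ 2 * y) * (z - e ^ 2 * x) := by
    grind
  have h2 : (x + e * y + e ^ 2 * z) ^ 3 - (x + e ^ 2 * y + e * z) ^ 3 =
      3 * (e - e ^ 2) * (y - z) * (x - y) * (x - z) := by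
    grind
  have h3 : (x + e ^ 2 * y + e * z) ^ 3 - (x + y + z) ^ 3 =
      -(1 - e ^ 2) ^ 3 * (y - e * z) * (x - e * y) * (z - e * x) := by
    grind
  have h4 (u v : R) : u ^ 3 - v ^ 3 = (u - v) * (u - e * v) * (u - e ^ 2 * v) := by
    grind
  have h5 : ((1 - e) * (1 - e ^ 2)) = 3 := by
    grind
  unfold cubeDisc
  rw [h1, h2, h3, h4 x y, h4 y z, h4 z x]
  have h6 : ((1 - e) * (1 - e ^ 2)) ^ 3 = 27 := by
    rw [h5]
    norm_num
  linear_combination (3 * (e - e ^ 2) * ((x - y) * (x - e * y) * (x - e ^ 2 * y)) *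
    ((y - z) * (y - e * z) * (y - e ^ 2 * z)) * ((z - x) * (z - e * x) * (z - e ^ 2 * x))) * h6

end FourierIdentities

/-- The inverse of `ε - ε²`. -/
def fourierConst : ℂ := (eps ^ 2 - eps) / 3

/-- This normalization gives the Fourier matrix determinant one, and it cancels the factor −27 in
`fourier_phiSixAt`. -/
theorem fourierConst_sq : 3 * fourierConst ^ 2 = -1 := by
  unfold fourierConst
  have := eps_sq_add
  grind

theorem fourierConst_mul : fourierConst * (eps - eps ^ 2) = 1 := by
  unfold fourierConst
  have := eps_sq_add
  grind

/-- The Fourier transform. -/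
def fourier : GL (Fin 3) ℂ :=
  Matrix.GeneralLinearGroup.mkOfDetNeZero
    !![fourierConst, fourierConst, fourierConst;
      fourierConst, fourierConst * eps, fourierConst * eps ^ 2;
      fourierConst, fourierConst * eps ^ 2, fourierConst * eps] (by
    have h1 := eps_sq_add
    have h2 := fourierConst_sq
    have h3 := fourierConst_mul
    have : Matrix.det !![fourierConst, fourierConst, fourierConst;
      fourierConst, fourierConst * eps, fourierConst * eps ^ 2;
      fourierConst, fourierConst * eps ^ 2, fourierConst * eps] = 1 := by
      rw [Matrix.det_fin_three]
      simp only [Matrix.of_apply, Matrix.cons_val]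
      grind
    rw [this]
    exact one_ne_zero)

theorem fourier_val : fourier.1 = !![fourierConst, fourierConst, fourierConst;
      fourierConst, fourierConst * eps, fourierConst * eps ^ 2;
      fourierConst, fourierConst * eps ^ 2, fourierConst * eps] := rfl

theorem fourier_det : fourier.1.det = 1 := by
  have h1 := eps_sq_add
  have h2 := fourierConst_sq
  have h3 := fourierConst_mul
  rw [fourier_val, Matrix.det_fin_three]
  simp only [Matrix.of_apply, Matrix.cons_val]
  grind

theorem coverSubst_fourier (c : ℂ) :
    coverSubst fourier.1 c (X 0) = C fourierConst * (X 0 + X 1 + X 2) ∧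
    coverSubst fourier.1 c (X 1) = C fourierConst * (X 0 + C eps * X 1 + C eps ^ 2 * X 2) ∧
    coverSubst fourier.1 c (X 2) = C fourierConst * (X 0 + C eps ^ 2 * X 1 + C eps * X 2) := by
  refine ⟨?_, ?_, ?_⟩
  · rw [coverSubst_X_zero, fourier_val]
    simp only [Matrix.of_apply, Matrix.cons_val]
    ring
  · rw [coverSubst_X_one, fourier_val]
    simp only [Matrix.of_apply, Matrix.cons_val, C_mul, C_pow]
    ring
  · rw [coverSubst_X_two, fourier_val]
    simp only [Matrix.of_apply, Matrix.cons_val, C_mul, C_pow]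
    ring

theorem subst_fourier :
    subst fourier.1 (X 0) = C fourierConst * (X 0 + X 1 + X 2) ∧
    subst fourier.1 (X 1) = C fourierConst * (X 0 + C eps * X 1 + C eps ^ 2 * X 2) ∧
    subst fourier.1 (X 2) = C fourierConst * (X 0 + C eps ^ 2 * X 1 + C eps * X 2) := by
  refine ⟨?_, ?_, ?_⟩
  · rw [subst_X, fourier_val]
    simp only [Matrix.of_apply, Matrix.cons_val]
    ring
  · rw [subst_X, fourier_val]
    simp only [Matrix.of_apply, Matrix.cons_val, C_mul, C_pow]
    ring
  · rw [subst_X, fourier_val]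
    simp only [Matrix.of_apply, Matrix.cons_val, C_mul, C_pow]
    ring

theorem C_fourierConst_sq {σ : Type} : 3 * (C fourierConst : MvPolynomial σ ℂ) ^ 2 = -1 := by
  rw [← C_pow, ← map_ofNat C 3, ← C_mul, fourierConst_sq, C_neg, C_1]

theorem C_eps_sq_add {σ : Type} : (C eps : MvPolynomial σ ℂ) ^ 2 + C eps + 1 = 0 := by
  rw [← C_pow, ← C_add, ← C_1, ← C_add, eps_sq_add, C_0]

theorem C_fourierConst_mul {σ : Type} :
    (C fourierConst : MvPolynomial σ ℂ) * (C eps - C eps ^ 2) = 1 := by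
  rw [← C_pow, ← C_sub, ← C_mul, fourierConst_mul, C_1]

theorem phiSixAt_mul {R : Type} [CommRing R] (d x y z : R) :
    phiSixAt (d * x) (d * y) (d * z) = d ^ 6 * phiSixAt x y z := by
  unfold phiSixAt
  ring

theorem cubeDisc_mul {R : Type} [CommRing R] (d x y z : R) :
    cubeDisc (d * x) (d * y) (d * z) = d ^ 9 * cubeDisc x y z := by
  unfold cubeDisc
  ring

/-- The lift of the Fourier transform to the double plane. -/
def coverFourier : coverSymm phiSix :=
  ⟨(fourier, 1), by
    change subst fourier.1 phiSix.1 = C ((1 : ℂ) ^ 2) * phiSix.1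
    obtain ⟨h0, h1, h2⟩ := subst_fourier
    have hd := C_fourierConst_sq (σ := Fin 3)
    rw [map_phiSix, h0, h1, h2, phiSixAt_mul, fourier_phiSixAt _ _ _ C_eps_sq_add, one_pow, C_1,
      one_mul, phiSix_eq]
    linear_combination -phiSixAt (X 0) (X 1) (X 2) *
      (9 * C fourierConst ^ 4 - 3 * C fourierConst ^ 2 + 1) * hd⟩

/-- A cube root of `ε²`. -/
def shearConst : ℂ := (exists_pow_eq (eps ^ 2) three_pos).choose

theorem shearConst_pow_three : shearConst ^ 3 = eps ^ 2 :=
  (exists_pow_eq (eps ^ 2) three_pos).choose_spec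

theorem shear_det_eq : Matrix.det (Matrix.diagonal ![shearConst, shearConst, shearConst * eps]) =
    1 := by
  rw [Matrix.det_diagonal, Fin.prod_univ_three]
  simp only [Matrix.cons_val]
  linear_combination eps * shearConst_pow_three + eps_pow_three

/-- The diagonal transformation multiplying the last coordinate by `ε`, of determinant one. -/
def shear : GL (Fin 3) ℂ :=
  Matrix.GeneralLinearGroup.mkOfDetNeZero
    (Matrix.diagonal ![shearConst, shearConst, shearConst * eps]) (by
    rw [shear_det_eq]
    exact one_ne_zero)

theorem shear_val : shear.1 = Matrix.diagonal ![shearConst, shearConst, shearConst * eps] := rfl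

theorem subst_shear :
    subst shear.1 (X 0) = C shearConst * X 0 ∧ subst shear.1 (X 1) = C shearConst * X 1 ∧
      subst shear.1 (X 2) = C shearConst * (C eps * X 2) := by
  refine ⟨?_, ?_, ?_⟩ <;> rw [subst_X, shear_val] <;> simp [Matrix.diagonal, mul_assoc]

theorem coverSubst_shear (c : ℂ) :
    coverSubst shear.1 c (X 0) = C shearConst * X 0 ∧
      coverSubst shear.1 c (X 1) = C shearConst * X 1 ∧
      coverSubst shear.1 c (X 2) = C shearConst * (C eps * X 2) := by
  refine ⟨?_, ?_, ?_⟩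
  · rw [coverSubst_X_zero, shear_val]; simp [Matrix.diagonal]
  · rw [coverSubst_X_one, shear_val]; simp [Matrix.diagonal]
  · rw [coverSubst_X_two, shear_val]; simp [Matrix.diagonal, mul_assoc]

theorem C_shearConst_pow_three {σ : Type} :
    (C shearConst : MvPolynomial σ ℂ) ^ 3 = C eps ^ 2 := by
  rw [← C_pow, shearConst_pow_three, C_pow]

/-- The lift of the diagonal transformation to the double plane. -/
def coverShear : coverSymm phiSix :=
  ⟨(shear, Units.mk0 (eps ^ 2) (pow_ne_zero 2 eps_ne_zero)), by
    change subst shear.1 phiSix.1 = C ((eps ^ 2 : ℂ) ^ 2) * phiSix.1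
    obtain ⟨h0, h1, h2⟩ := subst_shear
    have h3 := C_eps_pow_three (σ := Fin 3)
    have hk := C_shearConst_pow_three (σ := Fin 3)
    have hk6 : (C shearConst : MvPolynomial (Fin 3) ℂ) ^ 6 = (C eps ^ 2) ^ 2 := by
      rw [← hk, ← pow_mul]
    have h6 : phiSixAt (X 0 : MvPolynomial (Fin 3) ℂ) (X 1) (C eps * X 2) =
        phiSixAt (X 0) (X 1) (X 2) := by
      unfold phiSixAt
      linear_combination (X 2 ^ 6 * (C eps ^ 3 + 1) - 10 * X 2 ^ 3 * (X 0 ^ 3 + X 1 ^ 3)) * h3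
    rw [map_phiSix, h0, h1, h2, phiSixAt_mul, h6, hk6, C_pow, C_pow, phiSix_eq]⟩

theorem fourier_mem_linearHessianGroup : fourier ∈ linearHessianGroup := by
  obtain ⟨h0, h1, h2⟩ := subst_fourier
  have hd := C_fourierConst_sq (σ := Fin 3)
  have h3 := C_third_mul_three (σ := Fin 3)
  have hC6 : (C 6 : MvPolynomial (Fin 3) ℂ) = 6 := map_ofNat C 6
  refine mem_linearHessianGroup (p := -fourierConst) (q := -(6 * fourierConst))
    (r := -(1 / 3 * fourierConst)) (s := fourierConst) ?_ ?_ ?_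
  · rw [subst_fermat, h0, h1, h2, mul_pow, mul_pow, mul_pow, ← mul_add, ← mul_add,
      fourier_sum_cubes _ _ _ C_eps_sq_add, fermat, triangle]
    simp only [C_neg, C_mul, hC6]
    linear_combination C fourierConst * (X 0 ^ 3 + X 1 ^ 3 + X 2 ^ 3 + 6 * (X 0 * X 1 * X 2)) * hd
  · have e (u v w d : MvPolynomial (Fin 3) ℂ) : d * u * (d * v) * (d * w) = d ^ 3 * (u * v * w) := by
      ring
    rw [subst_triangle, h0, h1, h2, e, fourier_prod _ _ _ C_eps_sq_add, fermat, triangle]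
    simp only [C_neg, C_mul]
    generalize (X 0 ^ 3 + X 1 ^ 3 + X 2 ^ 3 : MvPolynomial (Fin 3) ℂ) = a
    generalize (X 0 * X 1 * X 2 : MvPolynomial (Fin 3) ℂ) = b
    generalize (C (1 / 3) : MvPolynomial (Fin 3) ℂ) = t at *
    generalize (C fourierConst : MvPolynomial (Fin 3) ℂ) = d at *
    linear_combination d * (a - 3 * b) * t * hd - (d ^ 3 * (a - 3 * b)) * h3 + b * d * h3
  · have := fourierConst_sq
    have h : -fourierConst * fourierConst -
        -(6 * fourierConst) * -(1 / 3 * fourierConst) = 1 := by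
      linear_combination -this
    rw [h]
    exact one_ne_zero

theorem shear_mem_linearHessianGroup : shear ∈ linearHessianGroup := by
  obtain ⟨h0, h1, h2⟩ := subst_shear
  have hk := C_shearConst_pow_three (σ := Fin 3)
  have h3 := C_eps_pow_three (σ := Fin 3)
  refine mem_linearHessianGroup (p := eps ^ 2) (q := 0) (r := 0) (s := 1) ?_ ?_ ?_
  · rw [subst_fermat, h0, h1, h2, fermat]
    simp only [C_pow, C_0]
    linear_combination (X 0 ^ 3 + X 1 ^ 3 + C eps ^ 3 * X 2 ^ 3) * hk + C eps ^ 2 * X 2 ^ 3 * h3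
  · rw [subst_triangle, h0, h1, h2, triangle]
    simp only [C_1, C_0]
    linear_combination (C eps * X 0 * X 1 * X 2) * hk + X 0 * X 1 * X 2 * h3
  · simpa using eps_ne_zero

theorem mem_hessianLift {h : coverSymm phiSix} : h ∈ hessianLift ↔
    h.1.1.1.det = 1 ∧ liftToPGL h ∈ G216 ∧ (h.1.2 : ℂ) ^ 3 = 1 := by
  change (Matrix.GeneralLinearGroup.det h.1.1 = 1 ∧ liftToPGL h ∈ G216) ∧
    h.1.2 ∈ rootsOfUnity 3 ℂ ↔ _
  rw [mem_rootsOfUnity, Units.ext_iff, Units.ext_iff, and_assoc]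
  simp

theorem coverFourier_mem : coverFourier ∈ hessianLift :=
  mem_hessianLift.mpr ⟨fourier_det, ⟨_, fourier_mem_linearHessianGroup, rfl⟩, one_pow 3⟩

theorem coverShear_mem : coverShear ∈ hessianLift :=
  mem_hessianLift.mpr ⟨shear_det_eq, ⟨_, shear_mem_linearHessianGroup, rfl⟩, by
    change (eps ^ 2) ^ 3 = 1
    rw [← pow_mul, mul_comm, pow_mul, eps_pow_three, one_pow]⟩

theorem coverG1_mem : coverG1 ∈ hessianLift :=
  mem_hessianLift.mpr ⟨g1_mem_pencilStabilizer.1, Gam_le_G216 mk_g1_mem, one_pow 3⟩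

theorem coverG2_mem : coverG2 ∈ hessianLift :=
  mem_hessianLift.mpr ⟨g2_mem_pencilStabilizer.1, Gam_le_G216 mk_g2_mem, one_pow 3⟩

theorem mk_conj_eq {A B D : GL (Fin 3) ℂ} {c : ℂ} (hc : c ≠ 0) (h : A.1 * B.1 = c • (D.1 * A.1)) :
    Matrix.ProjGenLinGroup.mk A * Matrix.ProjGenLinGroup.mk B * (Matrix.ProjGenLinGroup.mk A)⁻¹ =
      Matrix.ProjGenLinGroup.mk D := by
  rw [mul_inv_eq_iff_eq_mul, ← map_mul, ← map_mul]
  exact mk_eq_mk_of_smul hc h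

theorem conjBy_fourier : ConjBy (Matrix.ProjGenLinGroup.mk fourier) !![0, 1; 2, 0] := by
  have h3 := eps_pow_three
  have v2 : (2 : ZMod 3).val = 2 := rfl
  refine conjBy_of ?_ ?_
  · refine mk_conj_eq one_ne_zero ?_
    have : weyl ![0, 2] = g2 ^ 2 := by simp [weyl, v2]
    change _ = (1 : ℂ) • ((weyl ![0, 2]).1 * _)
    rw [this, Units.val_pow_eq_pow_val, g1_val, g2_val, fourier_val, Matrix.diagonal_pow]
    ext i j
    fin_cases i <;> fin_cases j <;>
      simp [Matrix.mul_apply, Matrix.diagonal, Fin.sum_univ_three] <;> grind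
  · rw [gamCoord_e1]
    refine mk_conj_eq one_ne_zero ?_
    rw [g1_val, g2_val, fourier_val]
    ext i j
    fin_cases i <;> fin_cases j <;>
      simp [Matrix.mul_apply, Matrix.diagonal] <;> grind

theorem conjBy_shear : ConjBy (Matrix.ProjGenLinGroup.mk shear) !![1, 0; 2, 1] := by
  have h3 := eps_pow_three
  have v2 : (2 : ZMod 3).val = 2 := rfl
  have v1 : (1 : ZMod 3).val = 1 := rfl
  refine conjBy_of ?_ ?_
  · refine mk_conj_eq eps_ne_zero ?_
    have : weyl ![1, 2] = g1 * g2 ^ 2 := by simp [weyl, v2, v1]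
    change _ = eps • ((weyl ![1, 2]).1 * _)
    rw [this, Units.val_mul, Units.val_pow_eq_pow_val, g1_val, g2_val, shear_val,
      Matrix.diagonal_pow, mul_assoc, Matrix.diagonal_mul_diagonal]
    ext i j
    fin_cases i <;> fin_cases j <;>
      simp [Matrix.mul_apply, Matrix.diagonal, Matrix.vecHead, Matrix.vecTail] <;> grind
  · rw [gamCoord_e2]
    refine mk_conj_eq one_ne_zero ?_
    rw [g2_val, shear_val, Matrix.diagonal_mul_diagonal, Matrix.diagonal_mul_diagonal, one_smul]
    simp only [mul_comm]

/-- The matrix of conjugation by the Fourier transform. -/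
def weylMatrix : SL(2, ZMod 3) := ⟨!![0, 1; 2, 0], by decide⟩

/-- The matrix of conjugation by the diagonal transformation. -/
def shearMatrix : SL(2, ZMod 3) := ⟨!![1, 0; 2, 1], by decide⟩

/-- The Bruhat decomposition, checked by enumeration: even k gives the lower triangular matrices and
odd k the big cell. -/
theorem exists_word (M : SL(2, ZMod 3)) :
    ∃ i k j : ℕ, M = shearMatrix ^ i * weylMatrix ^ k * shearMatrix ^ j := by
  have : ∀ a b c d : ZMod 3, a * d - b * c = 1 → ∃ i k j : Fin 4,
      !![a, b; c, d] = !![1, 0; 2, 1] ^ i.1 * !![0, 1; 2, 0] ^ k.1 * !![1, 0; 2, 1] ^ j.1 := by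
    decide +kernel
  have hdet := M.2
  rw [Matrix.det_fin_two] at hdet
  obtain ⟨i, k, j, h⟩ := this _ _ _ _ hdet
  refine ⟨i, k, j, Subtype.ext ?_⟩
  rw [Matrix.SpecialLinearGroup.coe_mul, Matrix.SpecialLinearGroup.coe_mul,
    Matrix.SpecialLinearGroup.coe_pow, Matrix.SpecialLinearGroup.coe_pow,
    Matrix.SpecialLinearGroup.coe_pow]
  exact (Matrix.eta_fin_two M.1).trans h

/-- The projective transformation underlying a lift of an element of the Hessian group. -/
def liftToG216 : hessianLift →* G216 where
  toFun h := ⟨liftToPGL h.1, (mem_hessianLift.mp h.2).2.1⟩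
  map_one' := Subtype.ext (map_one liftToPGL)
  map_mul' g h := Subtype.ext (map_mul liftToPGL g.1 h.1)

theorem conjMatrix_fourier : conjMatrix (liftToG216 ⟨coverFourier, coverFourier_mem⟩) =
    weylMatrix :=
  conjMatrix_eq conjBy_fourier

theorem conjMatrix_shear : conjMatrix (liftToG216 ⟨coverShear, coverShear_mem⟩) = shearMatrix :=
  conjMatrix_eq conjBy_shear

theorem conjMatrix_surjective : Function.Surjective conjMatrix := by
  intro M
  obtain ⟨i, k, j, rfl⟩ := exists_word M
  rw [← conjMatrix_fourier, ← conjMatrix_shear]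
  simp only [← map_pow, ← map_mul]
  exact ⟨_, rfl⟩

/-- The isomorphism of `G₂₁₆ / Γ` with `SL(2, 𝔽₃)`. -/
def quotientEquiv [(Gam.subgroupOf G216).Normal] : (G216 ⧸ Gam.subgroupOf G216) ≃* SL(2, ZMod 3) :=
  (QuotientGroup.quotientMulEquivOfEq conjMatrix_ker.symm).trans
    (QuotientGroup.quotientKerEquivOfSurjective conjMatrix conjMatrix_surjective)

theorem quotientEquiv_mk [(Gam.subgroupOf G216).Normal] (g : G216) :
    quotientEquiv (QuotientGroup.mk g) = conjMatrix g := rfl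

/-! ### The action of the Hessian group on the cuspidal double plane -/

theorem heisPoly_comp_coverSubst {B : Matrix (Fin 3) (Fin 3) ℂ} {h : coverSymm phiSix}
    (hX : ∀ i : Fin 3, heisPoly (coverSubst B 1 (X i.castSucc)) =
      coverSubst h.1.1.1 h.1.2 (heisPoly (X i.castSucc)))
    (h3 : coverSubst h.1.1.1 h.1.2 (heisPoly (X 3)) = heisPoly (X 3)) :
    heisPoly.comp (coverSubst B 1) = (coverSubst h.1.1.1 h.1.2).comp heisPoly := by
  refine coverSubst_ext (fun i => ?_) ?_
  · rw [rename_X]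
    exact hX i
  · rw [AlgHom.comp_apply, AlgHom.comp_apply, coverSubst_X_three, C_1, one_mul, h3]

/-- Invariance of Φ₆' needs no expansion. The transform of w'² + Φ₆' maps to zero in the coordinate
ring of X, so by injectivity of `heisMap` it lies in the ideal of Y'. Its difference from w'² + Φ₆'
does not involve w', hence is zero. -/
theorem mem_coverSymm_of_comp {B : GL (Fin 3) ℂ} {h : coverSymm phiSix}
    (H : heisPoly.comp (coverSubst B.1 1) = (coverSubst h.1.1.1 h.1.2).comp heisPoly) :
    (B, 1) ∈ coverSymm phiSix' := by
  have h1 : coverSubst B.1 1 (coverEq phiSix') ∈ coverIdeal phiSix' := by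
    rw [← Ideal.Quotient.eq_zero_iff_mem]
    refine heisMap_injective ?_
    rw [map_zero, heisMap_mk, ← AlgHom.comp_apply, H]
    have h0 := Ideal.Quotient.eq_zero_iff_mem.mpr heisPoly_mem_coverIdeal
    exact (congrArg (coverRingMap h) h0).trans (map_zero (coverRingMap h))
  have h2 : rename Fin.castSucc (subst B.1 phiSix'.1 - phiSix'.1) ∈ coverIdeal phiSix' := by
    have := Ideal.sub_mem _ h1 (Ideal.mem_span_singleton_self (coverEq phiSix'))
    rw [coverEq, map_add, map_pow, coverSubst_X_three, coverSubst_rename, C_1, one_mul,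
      add_sub_add_left_eq_sub, ← map_sub] at this
    exact this
  change subst B.1 phiSix'.1 = C ((1 : ℂ) ^ 2) * phiSix'.1
  rw [one_pow, C_1, one_mul, sub_eq_zero.mp (rename_mem_coverIdeal h2)]

/-- Pairs of a lift to `X` of an element of the Hessian group and of a compatible symmetry of the
cuspidal double plane. -/
def compatibleLifts : Subgroup (coverSymm phiSix × coverSymm phiSix') where
  carrier := {n | n.1 ∈ hessianLift ∧ n.2.1.2 = 1 ∧
    ∀ x, heisMap (coverRingMap n.2 x) = coverRingMap n.1 (heisMap x)}
  mul_mem' := by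
    rintro m n ⟨m1, m2, m3⟩ ⟨n1, n2, n3⟩
    refine ⟨mul_mem m1 n1, ?_, fun x => ?_⟩
    · change m.2.1.2 * n.2.1.2 = 1
      rw [m2, n2, one_mul]
    · rw [Prod.fst_mul, Prod.snd_mul, coverRingMap_mul, coverRingMap_mul]
      exact (n3 _).trans (congrArg _ (m3 x))
  one_mem' := by
    refine ⟨one_mem _, rfl, fun x => ?_⟩
    rw [Prod.fst_one, Prod.snd_one, coverRingMap_one, coverRingMap_one]
    rfl
  inv_mem' := by
    rintro m ⟨m1, m2, m3⟩
    refine ⟨inv_mem m1, ?_, fun x => ?_⟩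
    · change m.2.1.2⁻¹ = 1
      rw [m2, inv_one]
    · have e1 := GradedRingHom.congr_fun (coverRingMap_comp_inv m.2) x
      have e2 := GradedRingHom.congr_fun (coverRingMap_comp_inv m.1⁻¹)
        (heisMap (coverRingMap m.2⁻¹ x))
      rw [inv_inv] at e2
      refine e2.symm.trans (congrArg (coverRingMap m.1⁻¹) ?_)
      exact (m3 _).symm.trans (congrArg heisMap e1)

theorem mem_compatibleLifts {B : GL (Fin 3) ℂ} {h : coverSymm phiSix} (hh : h ∈ hessianLift)
    (H : heisPoly.comp (coverSubst B.1 1) = (coverSubst h.1.1.1 h.1.2).comp heisPoly) :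
    ∃ k : coverSymm phiSix', (h, k) ∈ compatibleLifts := by
  refine ⟨⟨(B, 1), mem_coverSymm_of_comp H⟩, hh, rfl, fun x => ?_⟩
  obtain ⟨P, rfl⟩ := Ideal.Quotient.mk_surjective x
  exact congrArg (coverClass phiSix) (DFunLike.congr_fun H P)

theorem heisPoly_X_zero : heisPoly (X 0) = -3 * (X 0 * X 1 * X 2) := heisPoly_X 0

theorem heisPoly_X_one :
    heisPoly (X 1) = C (1 / 2) * (cubeSum + C sqrtThree * C (1 / 3) * X 3) := heisPoly_X 1

theorem heisPoly_X_two :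
    heisPoly (X 2) = C (1 / 2) * (cubeSum - C sqrtThree * C (1 / 3) * X 3) := heisPoly_X 2

theorem heisPoly_X_three :
    heisPoly (X 3) = 3 * C sqrtThree * cubeDisc (X 0) (X 1) (X 2) := heisPoly_X 3

/-- Compatibility is reduced to the effect of h on a, xyz, V and w. Invariance of V is what permits
w' to be fixed. -/
theorem heisPoly_comp_of_invariants {B : Matrix (Fin 3) (Fin 3) ℂ} {h : coverSymm phiSix}
    {a b : MvPolynomial (Fin 4) ℂ}
    (ha : coverSubst h.1.1.1 h.1.2 cubeSum = a)
    (hb : coverSubst h.1.1.1 h.1.2 (X 0 * X 1 * X 2) = b)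
    (hD : coverSubst h.1.1.1 h.1.2 (cubeDisc (X 0) (X 1) (X 2)) = cubeDisc (X 0) (X 1) (X 2))
    (h0 : heisPoly (coverSubst B 1 (X 0)) = -3 * b)
    (h1 : heisPoly (coverSubst B 1 (X 1)) =
      C (1 / 2) * (a + C sqrtThree * C (1 / 3) * (C (h.1.2 : ℂ) * X 3)))
    (h2 : heisPoly (coverSubst B 1 (X 2)) =
      C (1 / 2) * (a - C sqrtThree * C (1 / 3) * (C (h.1.2 : ℂ) * X 3))) :
    heisPoly.comp (coverSubst B 1) = (coverSubst h.1.1.1 h.1.2).comp heisPoly := by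
  have h3 : coverSubst h.1.1.1 h.1.2 3 = 3 := map_ofNat _ 3
  refine heisPoly_comp_coverSubst (fun i => ?_) ?_
  · fin_cases i
    · change _ = coverSubst h.1.1.1 h.1.2 (heisPoly (X 0))
      rw [heisPoly_X_zero, map_mul, map_neg, h3, hb]
      exact h0
    · change _ = coverSubst h.1.1.1 h.1.2 (heisPoly (X 1))
      rw [heisPoly_X_one, map_mul, map_add, map_mul, map_mul, ha, coverSubst_C, coverSubst_C,
        coverSubst_C, coverSubst_X_three]
      exact h1
    · change _ = coverSubst h.1.1.1 h.1.2 (heisPoly (X 2))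
      rw [heisPoly_X_two, map_mul, map_sub, map_mul, map_mul, ha, coverSubst_C, coverSubst_C,
        coverSubst_C, coverSubst_X_three]
      exact h2
  · rw [heisPoly_X_three, map_mul, map_mul, coverSubst_C, h3, hD]

theorem exists_compatible_fourier :
    ∃ k : coverSymm phiSix', (coverFourier, k) ∈ compatibleLifts := by
  obtain ⟨h0, h1, h2⟩ := coverSubst_fourier 1
  have hd := C_fourierConst_sq (σ := Fin 4)
  have hde := C_fourierConst_mul (σ := Fin 4)
  have h3 := C_third_mul_three (σ := Fin 4)
  have hh := C_half_mul_two (σ := Fin 4)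
  -- With d = `fourierConst`, the transform sends a to −d(a + 6xyz) and xyz to −d(a − 3xyz)/3, and
  -- fixes w. In the new coordinates x' goes to d(x' + y' + z'), y' + z' goes to 2dx' − d(y' + z'),
  -- and y' − z' is fixed. Solving for y' and z' gives this matrix.
  have hdet : Matrix.det !![fourierConst, fourierConst, fourierConst;
      fourierConst, (1 - fourierConst) * (1 / 2), (-1 - fourierConst) * (1 / 2);
      fourierConst, (-1 - fourierConst) * (1 / 2), (1 - fourierConst) * (1 / 2)] ≠ 0 := by
    have hs := fourierConst_sq
    have : Matrix.det !![fourierConst, fourierConst, fourierConst;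
      fourierConst, (1 - fourierConst) * (1 / 2), (-1 - fourierConst) * (1 / 2);
      fourierConst, (-1 - fourierConst) * (1 / 2), (1 - fourierConst) * (1 / 2)] = 1 := by
      rw [Matrix.det_fin_three]
      simp only [Matrix.of_apply, Matrix.cons_val]
      linear_combination -hs
    rw [this]
    exact one_ne_zero
  refine mem_compatibleLifts (B := .mkOfDetNeZero _ hdet) coverFourier_mem
    (heisPoly_comp_of_invariants (a := -C fourierConst * (cubeSum + 6 * (X 0 * X 1 * X 2)))
      (b := -C (1 / 3) * C fourierConst * (cubeSum - 3 * (X 0 * X 1 * X 2))) ?_ ?_ ?_ ?_ ?_ ?_)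
  · change coverSubst fourier.1 1 cubeSum = _
    rw [map_cubeSum, h0, h1, h2, mul_pow, mul_pow, mul_pow, ← mul_add, ← mul_add,
      fourier_sum_cubes _ _ _ C_eps_sq_add, cubeSum]
    linear_combination C fourierConst * (X 0 ^ 3 + X 1 ^ 3 + X 2 ^ 3 + 6 * (X 0 * X 1 * X 2)) * hd
  · change coverSubst fourier.1 1 (X 0 * X 1 * X 2) = _
    have e (u v w d : MvPolynomial (Fin 4) ℂ) : d * u * (d * v) * (d * w) = d ^ 3 * (u * v * w) := by
      ring
    rw [map_mul, map_mul, h0, h1, h2, e, fourier_prod _ _ _ C_eps_sq_add, cubeSum]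
    linear_combination C fourierConst * (X 0 ^ 3 + X 1 ^ 3 + X 2 ^ 3 - 3 * (X 0 * X 1 * X 2)) *
      (C (1 / 3) * hd - C fourierConst ^ 2 * h3)
  · change coverSubst fourier.1 1 (cubeDisc (X 0) (X 1) (X 2)) = _
    rw [map_cubeDisc, h0, h1, h2, cubeDisc_mul, fourier_cubeDisc _ _ _ C_eps_sq_add]
    generalize cubeDisc (X 0 : MvPolynomial (Fin 4) ℂ) (X 1) (X 2) = D
    generalize (C fourierConst : MvPolynomial (Fin 4) ℂ) = d at *
    linear_combination 81 * d ^ 8 * D * hde +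
      D * (3 * d ^ 2 - 1) * (9 * d ^ 4 + 1) * hd
  · change heisPoly (coverSubst (.of _) 1 (X 0)) = _
    rw [coverSubst_X_zero]
    simp only [Matrix.of_apply, Matrix.cons_val, map_add, map_mul, heisPoly_C, heisPoly_X_zero,
      heisPoly_X_one, heisPoly_X_two]
    linear_combination C fourierConst * cubeSum * hh - C fourierConst * cubeSum * h3 +
      3 * C fourierConst * X 0 * X 1 * X 2 * h3
  · change heisPoly (coverSubst (.of _) 1 (X 1)) = C (1 / 2) * (_ + _ * (C 1 * X 3))
    rw [coverSubst_X_one]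
    simp only [Matrix.of_apply, Matrix.cons_val, map_add, map_mul, heisPoly_C, heisPoly_X_zero,
      heisPoly_X_one, heisPoly_X_two, map_sub, map_neg, map_one]
    linear_combination (3 * C fourierConst * X 0 * X 1 * X 2 - C (1 / 2) * C fourierConst * cubeSum + C (1 / 2) * C sqrtThree * C (1 / 3) * X 3) * hh
  · change heisPoly (coverSubst (.of _) 1 (X 2)) = C (1 / 2) * (_ - _ * (C 1 * X 3))
    rw [coverSubst_X_two]
    simp only [Matrix.of_apply, Matrix.cons_val, map_add, map_mul, heisPoly_C, heisPoly_X_zero,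
      heisPoly_X_one, heisPoly_X_two, map_sub, map_neg, map_one]
    linear_combination (3 * C fourierConst * X 0 * X 1 * X 2 - C (1 / 2) * C fourierConst * cubeSum - C (1 / 2) * C sqrtThree * C (1 / 3) * X 3) * hh

theorem exists_compatible_shear :
    ∃ k : coverSymm phiSix', (coverShear, k) ∈ compatibleLifts := by
  obtain ⟨h0, h1, h2⟩ := coverSubst_shear (eps ^ 2)
  have hk := C_shearConst_pow_three (σ := Fin 4)
  have he := C_eps_pow_three (σ := Fin 4)
  -- Both a and w are multiplied by ε², hence so are y' and z', while xyz is fixed.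
  have hdet : Matrix.det (Matrix.diagonal ![1, eps ^ 2, eps ^ 2]) ≠ 0 := by
    rw [Matrix.det_diagonal, Fin.prod_univ_three]
    simp [eps_ne_zero]
  refine mem_compatibleLifts (B := .mkOfDetNeZero _ hdet) coverShear_mem
    (heisPoly_comp_of_invariants (a := C eps ^ 2 * cubeSum)
      (b := X 0 * X 1 * X 2) ?_ ?_ ?_ ?_ ?_ ?_)
  · change coverSubst shear.1 (eps ^ 2) cubeSum = _
    rw [map_cubeSum, h0, h1, h2, cubeSum]
    linear_combination (X 0 ^ 3 + X 1 ^ 3 + C eps ^ 3 * X 2 ^ 3) * hk + C eps ^ 2 * X 2 ^ 3 * he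
  · change coverSubst shear.1 (eps ^ 2) (X 0 * X 1 * X 2) = _
    rw [map_mul, map_mul, h0, h1, h2]
    linear_combination (C eps * X 0 * X 1 * X 2) * hk + X 0 * X 1 * X 2 * he
  · change coverSubst shear.1 (eps ^ 2) (cubeDisc (X 0) (X 1) (X 2)) = _
    have e9 : (C shearConst : MvPolynomial (Fin 4) ℂ) ^ 9 = 1 := by
      linear_combination (C shearConst ^ 6 + C eps ^ 2 * C shearConst ^ 3 + C eps ^ 4) * hk +
        (C eps ^ 3 + 1) * he
    rw [map_cubeDisc, h0, h1, h2, cubeDisc_mul, e9, one_mul]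
    unfold cubeDisc
    rw [mul_pow, he, one_mul]
  · change heisPoly (coverSubst (.diagonal _) 1 (X 0)) = _
    rw [coverSubst_X_zero]
    simp [Matrix.diagonal, heisPoly_X_zero]
  · change heisPoly (coverSubst (.diagonal _) 1 (X 1)) = C (1 / 2) * (_ + _ * (C (eps ^ 2) * X 3))
    rw [coverSubst_X_one]
    simp only [Matrix.diagonal_apply_eq, Matrix.diagonal_apply_ne _ (show (1 : Fin 3) ≠ 0 by decide),
      Matrix.diagonal_apply_ne _ (show (1 : Fin 3) ≠ 2 by decide), C_0, zero_mul, zero_add,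
      add_zero, Matrix.cons_val, map_mul, map_pow, heisPoly_C, heisPoly_X_one]
    ring
  · change heisPoly (coverSubst (.diagonal _) 1 (X 2)) = C (1 / 2) * (_ - _ * (C (eps ^ 2) * X 3))
    rw [coverSubst_X_two]
    simp only [Matrix.diagonal_apply_eq, Matrix.diagonal_apply_ne _ (show (2 : Fin 3) ≠ 0 by decide),
      Matrix.diagonal_apply_ne _ (show (2 : Fin 3) ≠ 1 by decide), C_0, zero_mul, zero_add,
      add_zero, Matrix.cons_val, map_mul, map_pow, heisPoly_C, heisPoly_X_two]
    ring

/-! ### Trivial action of Γ on the invariants, and the action of SL(2, 𝔽₃). -/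

theorem phiSix_ne_zero : phiSix.1 ≠ 0 := by
  intro h
  have := congrArg (eval ![1, 0, 0]) h
  rw [phiSix_eq] at this
  simp [phiSixAt] at this

/-- A determinant-one lift of an element of Γ fixes Φ₆, so c² = 1. Together with c³ = 1 this gives c
= 1. -/
theorem eq_one_of_mem_Gam {h : coverSymm phiSix} (hh : h ∈ hessianLift)
    (hΓ : liftToPGL h ∈ Gam) : h.1.2 = 1 := by
  obtain ⟨hdet, -, hc3⟩ := mem_hessianLift.mp hh
  obtain ⟨-, -, -, h3, -⟩ := mem_pencilStabilizer hdet hΓ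
  have h4 : subst h.1.1.1 phiSix.1 = C ((h.1.2 : ℂ) ^ 2) * phiSix.1 := h.2
  have h5 : (h.1.2 : ℂ) ^ 2 = 1 := by
    refine C_injective (Fin 3) ℂ (mul_right_cancel₀ phiSix_ne_zero ?_)
    rw [← h4, h3, C_1, one_mul]
  refine Units.ext ?_
  rw [Units.val_one]
  linear_combination hc3 - (h.1.2 : ℂ) * h5

/-- The group `Γ` acts trivially on the ring of invariants. -/
theorem coverRingMap_heisMap_of_mem_Gam {h : coverSymm phiSix} (hh : h ∈ hessianLift)
    (hΓ : liftToPGL h ∈ Gam) (x) : coverRingMap h (heisMap x) = heisMap x := by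
  have hc := eq_one_of_mem_Gam hh hΓ
  obtain ⟨-, h1, h2, -, h3⟩ := mem_pencilStabilizer (mem_hessianLift.mp hh).1 hΓ
  have hr (P : MvPolynomial (Fin 3) ℂ) (hP : subst h.1.1.1 P = P) :
      coverSubst h.1.1.1 h.1.2 (rename Fin.castSucc P) = rename Fin.castSucc P := by
    rw [coverSubst_rename, hP]
  have H : heisPoly.comp (coverSubst 1 1) = (coverSubst h.1.1.1 h.1.2).comp heisPoly := by
    refine heisPoly_comp_of_invariants (a := cubeSum) (b := X 0 * X 1 * X 2) ?_ ?_ ?_ ?_ ?_ ?_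
    · simpa [fermat, cubeSum] using hr _ h1
    · simpa [triangle] using hr _ h2
    · have := hr _ h3
      rw [map_cubeDisc (rename Fin.castSucc), rename_X, rename_X, rename_X] at this
      exact this
    · rw [coverSubst_one, AlgHom.id_apply, heisPoly_X_zero]
    · rw [coverSubst_one, AlgHom.id_apply, heisPoly_X_one, hc, Units.val_one, C_1, one_mul]
    · rw [coverSubst_one, AlgHom.id_apply, heisPoly_X_two, hc, Units.val_one, C_1, one_mul]
  rw [coverSubst_one, AlgHom.comp_id] at H
  obtain ⟨P, rfl⟩ := Ideal.Quotient.mk_surjective x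
  exact congrArg (coverClass phiSix) (DFunLike.congr_fun H P).symm

/-- The projective transformation underlying a compatible pair of symmetries. -/
def compatibleToG216 : compatibleLifts →* G216 where
  toFun n := liftToG216 ⟨n.1.1, n.2.1⟩
  map_one' := rfl
  map_mul' _ _ := rfl

theorem mem_compatibleLifts_of_mem_Gam {h : coverSymm phiSix} (hh : h ∈ hessianLift)
    (hΓ : liftToPGL h ∈ Gam) : (h, 1) ∈ compatibleLifts := by
  refine ⟨hh, rfl, fun x => ?_⟩
  rw [coverRingMap_one]
  exact (coverRingMap_heisMap_of_mem_Gam hh hΓ x).symm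

/-- The image contains Γ, each element of which is paired with the identity of Y', and it contains
elements mapping to generators of SL(2, 𝔽₃). As Γ is the kernel of `conjMatrix`, the image is
everything. -/
theorem compatibleToG216_surjective : Function.Surjective compatibleToG216 := by
  obtain ⟨kS, hS⟩ := exists_compatible_fourier
  obtain ⟨kT, hT⟩ := exists_compatible_shear
  let R : Subgroup G216 := compatibleToG216.range
  have hΓ : Gam.subgroupOf G216 ≤ R := by
    have hΓ' : Gam ≤ R.map G216.subtype := by
      refine (Subgroup.closure_le _).mpr ?_
      rintro _ (rfl | rfl)
      · exact ⟨_, ⟨⟨_, mem_compatibleLifts_of_mem_Gam coverG1_mem mk_g1_mem⟩, rfl⟩, rfl⟩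
      · exact ⟨_, ⟨⟨_, mem_compatibleLifts_of_mem_Gam coverG2_mem mk_g2_mem⟩, rfl⟩, rfl⟩
    intro g hg
    obtain ⟨g', hg', hgg'⟩ := hΓ' hg
    rwa [← Subtype.ext hgg']
  have hSR : liftToG216 ⟨coverFourier, coverFourier_mem⟩ ∈ R := ⟨⟨_, hS⟩, rfl⟩
  have hTR : liftToG216 ⟨coverShear, coverShear_mem⟩ ∈ R := ⟨⟨_, hT⟩, rfl⟩
  have hw (M : SL(2, ZMod 3)) : ∃ g ∈ R, conjMatrix g = M := by
    obtain ⟨i, k, j, rfl⟩ := exists_word M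
    rw [← conjMatrix_fourier, ← conjMatrix_shear]
    simp only [← map_pow, ← map_mul]
    refine ⟨_, ?_, rfl⟩
    simp only [map_pow, map_mul]
    exact mul_mem (mul_mem (pow_mem hTR _) (pow_mem hSR _)) (pow_mem hTR _)
  intro g
  obtain ⟨g', hg', h⟩ := hw (conjMatrix g)
  have h1 : g'⁻¹ * g ∈ conjMatrix.ker := by
    rw [MonoidHom.mem_ker, map_mul, map_inv, h, inv_mul_cancel]
  rw [conjMatrix_ker] at h1
  have h2 : g' * (g'⁻¹ * g) ∈ R := mul_mem hg' (hΓ h1)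
  rwa [mul_inv_cancel_left] at h2

theorem coverAct_eq_one {F : Sextic} {k : coverSymm F} (h : ∀ x, coverRingMap k x = x) :
    coverAct F k = 1 := by
  have : coverRingMap k = coverRingMap 1 := GradedRingHom.ext fun x => by
    rw [h, coverRingMap_one]
    rfl
  rw [← map_one (coverAct F)]
  exact Iso.ext (Over.OverMorphism.ext (projMap_congr this _ _))

/-- The action of compatible pairs on the cuspidal double plane. -/
def compatibleAct : compatibleLifts →* Aut cuspidalDoublePlane :=
  (coverAct phiSix').comp ((MonoidHom.snd _ _).comp compatibleLifts.subtype)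

/-- Over Γ the first component fixes the image of `heisMap`, so by injectivity the second component
acts as the identity on Y'. -/
theorem ker_le_ker_compatibleAct :
    (conjMatrix.comp compatibleToG216).ker ≤ compatibleAct.ker := by
  intro n hn
  have h1 : compatibleToG216 n ∈ conjMatrix.ker := hn
  rw [conjMatrix_ker] at h1
  refine coverAct_eq_one fun x => heisMap_injective ?_
  refine (n.2.2.2 x).trans ?_
  exact coverRingMap_heisMap_of_mem_Gam n.2.1 h1 _

theorem conjMatrix_comp_surjective : Function.Surjective (conjMatrix.comp compatibleToG216) :=
  conjMatrix_surjective.comp compatibleToG216_surjective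

/-- The action of `SL(2, 𝔽₃)` on the cuspidal double plane. -/
def slAct : SL(2, ZMod 3) →* Aut cuspidalDoublePlane :=
  (conjMatrix.comp compatibleToG216).liftOfSurjective conjMatrix_comp_surjective
    ⟨compatibleAct, ker_le_ker_compatibleAct⟩

theorem slAct_apply (n : compatibleLifts) :
    slAct (conjMatrix (compatibleToG216 n)) = compatibleAct n :=
  MonoidHom.liftOfRightInverse_comp_apply _ _ _ ⟨compatibleAct, ker_le_ker_compatibleAct⟩ n

theorem weyl_det (v : Fin 2 → ZMod 3) : (weyl v).1.det = 1 :=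
  (mul_mem (pow_mem g1_mem_pencilStabilizer _) (pow_mem g2_mem_pencilStabilizer _) :
    weyl v ∈ pencilStabilizer).1

/-- Each lift is a cube root of unity times one of the nine matrices `weyl v`, and its scalar c is
1. -/
instance finite_gamLift : Finite ↥(hessianLift ⊓ Gam.comap liftToPGL) := by
  have h1 : (Set.image2 (fun (c : ℂ) (v : Fin 2 → ZMod 3) => c • (weyl v).1)
      {c | c ^ 3 = 1} Set.univ).Finite := by
    refine Set.Finite.image2 _ ?_ Set.finite_univ
    refine (Polynomial.nthRoots 3 (1 : ℂ)).toFinset.finite_toSet.subset fun c hc => ?_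
    simpa [Polynomial.mem_nthRoots] using hc
  have h2 (h : ↥(hessianLift ⊓ Gam.comap liftToPGL)) : h.1.1.1.1 ∈
      Set.image2 (fun (c : ℂ) (v : Fin 2 → ZMod 3) => c • (weyl v).1) {c | c ^ 3 = 1}
        Set.univ := by
    obtain ⟨v, hv⟩ := exists_gamCoord_eq h.2.2
    obtain ⟨c, -, hc⟩ := exists_smul_of_mk_eq_mk hv.symm
    refine ⟨c, ?_, v, trivial, hc.symm⟩
    have := (mem_hessianLift.mp h.2.1).1
    have hc' : h.1.1.1.1 = c • (weyl v).1 := hc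
    rwa [hc', Matrix.det_smul, weyl_det, mul_one, Fintype.card_fin] at this
  have := h1.to_subtype
  refine Finite.of_injective (fun h => (⟨_, h2 h⟩ : Set.image2 (fun (c : ℂ)
    (v : Fin 2 → ZMod 3) => c • (weyl v).1) {c | c ^ 3 = 1} Set.univ)) fun h h' e => ?_
  refine Subtype.ext (Subtype.ext (Prod.ext (Units.ext (congrArg Subtype.val e)) ?_))
  exact (eq_one_of_mem_Gam h.2.1 h.2.2).trans (eq_one_of_mem_Gam h'.2.1 h'.2.2).symm

instance finite_gamOnX : Finite gamOnX :=
  Finite.of_surjective _ ((coverAct phiSix).subgroupMap_surjective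
    (hessianLift ⊓ Gam.comap liftToPGL))

/-- The action of compatible pairs on `X`. -/
def surfaceAct : compatibleLifts →* Aut surfaceX :=
  (coverAct phiSix).comp ((MonoidHom.fst _ _).comp compatibleLifts.subtype)

theorem conj_mem_gamOnX (n : compatibleLifts) {g : Aut surfaceX} (hg : g ∈ gamOnX) :
    surfaceAct n * g * (surfaceAct n)⁻¹ ∈ gamOnX := by
  obtain ⟨k, ⟨hk, hk'⟩, rfl⟩ := hg
  have hn : n.1.1 ∈ hessianLift := n.2.1
  refine ⟨n.1.1 * k * n.1.1⁻¹, ⟨hessianLift.mul_mem (hessianLift.mul_mem hn hk)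
    (hessianLift.inv_mem hn), ?_⟩, ?_⟩
  · change liftToPGL (n.1.1 * k * n.1.1⁻¹) ∈ Gam
    rw [map_mul, map_mul, map_inv]
    exact conj_mem_Gam (mem_hessianLift.mp hn).2.1 hk'
  · exact (map_mul (coverAct phiSix) _ _).trans (congrArg₂ (· * ·)
      (map_mul (coverAct phiSix) _ _) (map_inv (coverAct phiSix) _))

/-! ### The faithfulness of the action -/

theorem coverClass_rename_injective {F : Sextic} {P Q : MvPolynomial (Fin 3) ℂ}
    (h : coverClass F (rename Fin.castSucc P) = coverClass F (rename Fin.castSucc Q)) : P = Q := by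
  rw [Ideal.Quotient.eq, ← map_sub] at h
  exact sub_eq_zero.mp (rename_mem_coverIdeal h)

/-- From y₀³ = x₀³ one gets y₀ = eⁿx₀. Then y₀²yᵢ = x₀²xᵢ forces the same factor e^{−2n} = eⁿ on
every coordinate. -/
theorem exists_eq_mul_of_mul_eq {R : Type} [CommRing R] [IsDomain R] {e : R}
    (he : e ^ 2 + e + 1 = 0) {x y : Fin 4 → R} (hx : x 0 ≠ 0)
    (h : ∀ i : Fin 3, y 0 * y 0 * y i.castSucc = x 0 * x 0 * x i.castSucc) :
    ∃ n : ℕ, ∀ i : Fin 3, y i.castSucc = e ^ n * x i.castSucc := by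
  have h0 := h 0
  change y 0 * y 0 * y 0 = x 0 * x 0 * x 0 at h0
  have h1 : ∃ n : ℕ, y 0 = e ^ n * x 0 := by
    have : (y 0 - x 0) * ((y 0 - e * x 0) * (y 0 - e ^ 2 * x 0)) = 0 := by
      have he3 : e ^ 3 = 1 := by linear_combination (e - 1) * he
      linear_combination h0 - x 0 ^ 3 * he3 + (x 0 ^ 2 * y 0 * e - x 0 * y 0 ^ 2) * he
    rcases mul_eq_zero.mp this with h | h
    · exact ⟨0, by linear_combination h⟩
    rcases mul_eq_zero.mp h with h | h
    · exact ⟨1, by linear_combination h⟩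
    · exact ⟨2, by linear_combination h⟩
  obtain ⟨n, hn⟩ := h1
  refine ⟨n, fun i => ?_⟩
  have hi := h i
  refine mul_left_cancel₀ (pow_ne_zero 3 hx) ?_
  linear_combination y 0 * hi - y i.castSucc * h0 + x 0 ^ 2 * x i.castSucc * hn

theorem rename_castSucc_fermat : rename Fin.castSucc fermat = cubeSum := by
  simp [fermat, cubeSum]

theorem rename_castSucc_triangle : rename Fin.castSucc triangle = X 0 * X 1 * X 2 := by
  simp [triangle]

instance isDomain_coverRing : IsDomain (MvPolynomial (Fin 4) ℂ ⧸ coverIdeal phiSix) :=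
  (Ideal.Quotient.isDomain_iff_prime _).mpr (coverIdeal_isPrime prime_coverEq_phiSix)

instance isDomain_coverRing' : IsDomain (MvPolynomial (Fin 4) ℂ ⧸ coverIdeal phiSix') :=
  (Ideal.Quotient.isDomain_iff_prime _).mpr (coverIdeal_isPrime prime_coverEq_phiSix')

theorem coverClass_X_mem {F : Sextic} (i : Fin 4) :
    coverClass F (X i) ∈ coverGrading F (weight i) :=
  ⟨X i, isWeightedHomogeneous_X ℂ weight i, rfl⟩

theorem coverClass_X_ne_zero {F : Sextic} (i : Fin 3) : coverClass F (X i.castSucc) ≠ 0 := by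
  rw [← rename_X, Ne, Ideal.Quotient.eq_zero_iff_mem]
  exact fun h => X_ne_zero i (rename_mem_coverIdeal h)

/-- Fixing the cubic forms of Y' only shows that x', y', z' are multiplied by a common cube root of
unity. Pulled back to X, this holds for a = y' + z' and xyz = −x'/3, and `mk_mem_Gam` allows for
such a factor. -/
theorem mem_Gam_of_coverRingMap_eq {n : coverSymm phiSix × coverSymm phiSix'}
    (hn : n ∈ compatibleLifts) (h : ∀ x ∈ coverGrading phiSix' 3, coverRingMap n.2 x = x) :
    liftToPGL n.1 ∈ Gam := by
  have he : coverClass phiSix' (C eps) ^ 2 + coverClass phiSix' (C eps) + 1 = 0 := by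
    have := congrArg (coverClass phiSix') (C_eps_sq_add (σ := Fin 4))
    simpa only [map_add, map_pow, map_one, map_zero] using this
  obtain ⟨m, hm⟩ := exists_eq_mul_of_mul_eq he (x := fun i => coverClass phiSix' (X i))
    (y := fun i => coverRingMap n.2 (coverClass phiSix' (X i))) (coverClass_X_ne_zero 0)
    (fun i => by
      rw [← map_mul, ← map_mul]
      refine h _ (SetLike.mul_mem_graded (i := 2) (j := 1)
        (SetLike.mul_mem_graded (i := 1) (j := 1) (coverClass_X_mem 0) (coverClass_X_mem 0)) ?_)
      have := coverClass_X_mem (F := phiSix') i.castSucc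
      rwa [weight_castSucc] at this)
  rw [← map_pow, ← C_pow] at hm
  have hm' (i : Fin 3) : coverClass phiSix (coverSubst n.1.1.1.1 n.1.1.2 (heisPoly (X i.castSucc))) =
      coverClass phiSix (C (eps ^ m) * heisPoly (X i.castSucc)) := by
    change coverRingMap n.1 (heisMap (coverClass phiSix' (X i.castSucc))) = _
    rw [← hn.2.2, hm i, map_mul, heisMap_coverClass, heisMap_coverClass, heisPoly_C, map_mul]
  have hμ : (eps ^ m) ^ 3 = 1 := by rw [← pow_mul, mul_comm, pow_mul, eps_pow_three, one_pow]
  refine mk_mem_Gam (A := n.1.1.1) (mem_hessianLift.mp hn.1).1 hμ ?_ ?_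
  · refine coverClass_rename_injective (F := phiSix) ?_
    rw [← coverSubst_rename _ n.1.1.2, map_mul, rename_C, rename_castSucc_fermat]
    have e : cubeSum = heisPoly (X (1 : Fin 3).castSucc) + heisPoly (X (2 : Fin 3).castSucc) := by
      change cubeSum = heisPoly (X 1) + heisPoly (X 2)
      rw [heisPoly_X_one, heisPoly_X_two]
      linear_combination -cubeSum * C_half_mul_two (σ := Fin 4)
    rw [e, map_add, map_add, hm', hm', ← map_add, mul_add]
  · refine coverClass_rename_injective (F := phiSix) ?_
    rw [← coverSubst_rename _ n.1.1.2, map_mul, rename_C, rename_castSucc_triangle]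
    have e : X 0 * X 1 * X 2 = C (-(1 / 3)) * heisPoly (X (0 : Fin 3).castSucc) := by
      change X 0 * X 1 * X 2 = C (-(1 / 3)) * heisPoly (X 0)
      rw [heisPoly_X_zero, C_neg]
      linear_combination -(X 0 * X 1 * X 2) * C_third_mul_three (σ := Fin 4)
    rw [e, map_mul, map_mul, hm', coverSubst_C, ← map_mul]
    congr 1
    ring

/-! ### The invariant affine charts -/

/-- The coordinate `w` of the cuspidal double plane. -/
def cuspW : MvPolynomial (Fin 4) ℂ ⧸ coverIdeal phiSix' := coverClass phiSix' (X 3)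

theorem cuspW_mem : cuspW ∈ coverGrading phiSix' 3 := coverClass_X_mem 3

theorem heisMap_cuspW_mem : heisMap cuspW ∈ coverGrading phiSix (3 * 3) := heisMap_mem 3 _ cuspW_mem

theorem cuspW_ne_zero : cuspW ≠ 0 := by
  intro h
  rw [cuspW, Ideal.Quotient.eq_zero_iff_mem, mem_coverIdeal_iff prime_coverEq_phiSix'] at h
  have := h ![1, 0, 0, Complex.I] (by
    rw [map_coverEq_phiSix']
    simp [phiSixAt'])
  simp at this

theorem heisMap_cuspW_ne_zero : heisMap cuspW ≠ 0 := fun h =>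
  cuspW_ne_zero (heisMap_injective (h.trans (map_zero _).symm))

/-- The condition c = 1 in `compatibleLifts` is what makes the chart w' ≠ 0 stable under all
compatible symmetries. -/
theorem coverRingMap_cuspW {n : coverSymm phiSix × coverSymm phiSix'} (hn : n ∈ compatibleLifts) :
    coverRingMap n.2 cuspW = cuspW := by
  refine congrArg (coverClass phiSix') ?_
  change coverSubst n.2.1.1.1 n.2.1.2 (X 3) = X 3
  rw [coverSubst_X_three, hn.2.1, Units.val_one, C_1, one_mul]

theorem coverRingMap_heisMap_cuspW {n : coverSymm phiSix × coverSymm phiSix'}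
    (hn : n ∈ compatibleLifts) : coverRingMap n.1 (heisMap cuspW) = heisMap cuspW := by
  rw [← hn.2.2, coverRingMap_cuspW hn]

open HomogeneousLocalization

theorem chart_comp_coverAct {F : Sextic} (h : coverSymm F)
    {s : MvPolynomial (Fin 4) ℂ ⧸ coverIdeal F} (hfix : coverRingMap h s = s) {d : ℕ}
    (hs : s ∈ coverGrading F d) (hd : 0 < d) :
    chart (coverGrading F) hs hd ≫ (coverAct F h).hom.left =
      Spec.map (CommRingCat.ofHom (awayMapOfEq (coverRingMap h) hfix)) ≫
        chart (coverGrading F) hs hd :=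
  chart_comp_projHom (coverRingMap_comp_inv h) (coverRingMap_C h) hfix hs hs hd

end Hesse

namespace Hesse

open MvPolynomial HomogeneousLocalization

/-- The affine chart `w ≠ 0` of the cuspidal double plane. -/
def cuspChart : Spec (.of (Away (coverGrading phiSix') cuspW)) ⟶ cuspidalDoublePlane.left :=
  chart (coverGrading phiSix') cuspW_mem three_pos

instance : IsOpenImmersion cuspChart :=
  inferInstanceAs (IsOpenImmersion (chart (coverGrading phiSix') cuspW_mem three_pos))

/-- The preimage in `X` of the affine chart `w ≠ 0` of the cuspidal double plane. -/
def surfaceChart : Spec (.of (Away (coverGrading phiSix) (heisMap cuspW))) ⟶ surfaceX.left :=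
  chart (coverGrading phiSix) heisMap_cuspW_mem (by norm_num)

instance : IsOpenImmersion surfaceChart :=
  inferInstanceAs (IsOpenImmersion (chart (coverGrading phiSix) heisMap_cuspW_mem _))

/-- The inclusion of the ring of functions on the affine chart `w ≠ 0` of the cuspidal double
plane. -/
def invariantHom : CommRingCat.of (Away (coverGrading phiSix') cuspW) ⟶
    CommRingCat.of (Away (coverGrading phiSix) (heisMap cuspW)) :=
  CommRingCat.ofHom (awayHom heisMap heisMap_mem cuspW_mem)

theorem heisMap_mem_smul {n : ℕ} {x : MvPolynomial (Fin 4) ℂ ⧸ coverIdeal phiSix'}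
    (hx : x ∈ coverGrading phiSix' (n • 3)) : heisMap x ∈ coverGrading phiSix (n • (3 * 3)) := by
  have := heisMap_mem _ _ hx
  rwa [smul_eq_mul, Nat.mul_left_comm] at this

theorem invariantHom_mk {n : ℕ} {x : MvPolynomial (Fin 4) ℂ ⧸ coverIdeal phiSix'}
    (hx : x ∈ coverGrading phiSix' (n • 3)) :
    invariantHom (Away.mk _ cuspW_mem n x hx) =
      Away.mk _ heisMap_cuspW_mem n (heisMap x) (heisMap_mem_smul hx) :=
  awayHom_mk heisMap heisMap_mem cuspW_mem n x hx _

theorem invariantHom_injective : Function.Injective invariantHom := by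
  rw [injective_iff_map_eq_zero]
  intro r hr
  obtain ⟨n, x, hx, rfl⟩ := Away.mk_surjective _ cuspW_mem r
  rw [invariantHom_mk] at hr
  have h0 : Away.mk _ heisMap_cuspW_mem n (heisMap x) (heisMap_mem_smul hx) =
      Away.mk _ heisMap_cuspW_mem n 0 (zero_mem _) := by
    refine hr.trans (val_injective _ ?_)
    rw [Away.val_mk, val_zero, Localization.mk_zero]
  rw [away_mk_eq_mk_iff heisMap_cuspW_ne_zero] at h0
  have h1 : x = 0 := heisMap_injective (h0.trans (map_zero _).symm)
  subst h1
  refine val_injective _ ?_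
  rw [Away.val_mk, val_zero, Localization.mk_zero]

theorem surfaceChart_comp_hom :
    surfaceChart ≫ surfaceX.hom =
      Spec.map invariantHom ≫ cuspChart ≫ cuspidalDoublePlane.hom := by
  refine (chart_comp_hom heisMap_cuspW_mem _).trans ?_
  refine Eq.trans ?_ (congrArg (Spec.map invariantHom ≫ ·) (chart_comp_hom cuspW_mem _).symm)
  refine Eq.trans ?_ (Spec.map_comp _ _)
  congr 1
  refine CommRingCat.hom_ext (RingHom.ext fun r => ?_)
  change awayScalar (heisMap cuspW) r = invariantHom (awayScalar cuspW r)
  rw [awayScalar_apply heisMap_cuspW_mem, awayScalar_apply cuspW_mem, invariantHom_mk,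
    away_mk_eq_mk_iff heisMap_cuspW_ne_zero]
  exact (congrArg (coverClass phiSix) (heisPoly_C r)).symm

/-- The action of a symmetry of `X` on the functions on the chart. -/
def surfaceChartMap (h : coverSymm phiSix) (hw : coverRingMap h (heisMap cuspW) = heisMap cuspW) :
    CommRingCat.of (Away (coverGrading phiSix) (heisMap cuspW)) ⟶
      CommRingCat.of (Away (coverGrading phiSix) (heisMap cuspW)) :=
  CommRingCat.ofHom (awayMapOfEq (coverRingMap h) hw)

theorem surfaceChartMap_mk {h : coverSymm phiSix}
    (hw : coverRingMap h (heisMap cuspW) = heisMap cuspW) {n : ℕ}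
    {x : MvPolynomial (Fin 4) ℂ ⧸ coverIdeal phiSix} (hx : x ∈ coverGrading phiSix (n • (3 * 3))) :
    surfaceChartMap h hw (Away.mk _ heisMap_cuspW_mem n x hx) =
      Away.mk _ heisMap_cuspW_mem n (coverRingMap h x) ((coverRingMap h).map_mem hx) :=
  awayMapOfEq_mk _ hw _ _ n x hx

theorem surfaceChart_comp_coverAct (h : coverSymm phiSix)
    (hw : coverRingMap h (heisMap cuspW) = heisMap cuspW) :
    surfaceChart ≫ (coverAct phiSix h).hom.left =
      Spec.map (surfaceChartMap h hw) ≫ surfaceChart :=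
  chart_comp_coverAct h hw _ _

/-- The action of a symmetry of the cuspidal double plane on the functions on the chart. -/
def cuspChartMap (k : coverSymm phiSix') (hw : coverRingMap k cuspW = cuspW) :
    CommRingCat.of (Away (coverGrading phiSix') cuspW) ⟶
      CommRingCat.of (Away (coverGrading phiSix') cuspW) :=
  CommRingCat.ofHom (awayMapOfEq (coverRingMap k) hw)

theorem cuspChartMap_mk {k : coverSymm phiSix'} (hw : coverRingMap k cuspW = cuspW) {n : ℕ}
    {x : MvPolynomial (Fin 4) ℂ ⧸ coverIdeal phiSix'} (hx : x ∈ coverGrading phiSix' (n • 3)) :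
    cuspChartMap k hw (Away.mk _ cuspW_mem n x hx) =
      Away.mk _ cuspW_mem n (coverRingMap k x) ((coverRingMap k).map_mem hx) :=
  awayMapOfEq_mk _ hw _ _ n x hx

theorem cuspChart_comp_coverAct (k : coverSymm phiSix') (hw : coverRingMap k cuspW = cuspW) :
    cuspChart ≫ (coverAct phiSix' k).hom.left = Spec.map (cuspChartMap k hw) ≫ cuspChart :=
  chart_comp_coverAct k hw _ _

theorem invariantHom_comp_apply {n : coverSymm phiSix × coverSymm phiSix'}
    (hn : n ∈ compatibleLifts) (r : CommRingCat.of (Away (coverGrading phiSix') cuspW)) :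
    surfaceChartMap n.1 (coverRingMap_heisMap_cuspW hn) (invariantHom r) =
      invariantHom (cuspChartMap n.2 (coverRingMap_cuspW hn) r) := by
  obtain ⟨m, x, hx, rfl⟩ := Away.mk_surjective _ cuspW_mem r
  rw [invariantHom_mk, surfaceChartMap_mk, cuspChartMap_mk, invariantHom_mk,
    away_mk_eq_mk_iff heisMap_cuspW_ne_zero]
  exact (hn.2.2 x).symm

theorem invariantHom_comp {n : coverSymm phiSix × coverSymm phiSix'} (hn : n ∈ compatibleLifts) :
    invariantHom ≫ surfaceChartMap n.1 (coverRingMap_heisMap_cuspW hn) =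
      cuspChartMap n.2 (coverRingMap_cuspW hn) ≫ invariantHom :=
  CommRingCat.hom_ext (RingHom.ext (invariantHom_comp_apply hn))

theorem exists_gamLift (g : gamOnX) : ∃ h : coverSymm phiSix, (h ∈ hessianLift ∧
    liftToPGL h ∈ Gam) ∧ coverAct phiSix h = g.1 := by
  obtain ⟨_, h, ⟨h1, h2⟩, rfl⟩ := g
  exact ⟨h, ⟨h1, h2⟩, rfl⟩

/-- The action of `Γ` on the functions on the chart of `X`. -/
def gamChartMap (g : gamOnX) : CommRingCat.of (Away (coverGrading phiSix) (heisMap cuspW)) ⟶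
    CommRingCat.of (Away (coverGrading phiSix) (heisMap cuspW)) :=
  surfaceChartMap (exists_gamLift g).choose
    (coverRingMap_heisMap_of_mem_Gam (exists_gamLift g).choose_spec.1.1
      (exists_gamLift g).choose_spec.1.2 cuspW)

theorem surfaceChart_comp_gam (g : gamOnX) :
    surfaceChart ≫ g.1.hom.left = Spec.map (gamChartMap g) ≫ surfaceChart := by
  have h : g.1.hom = (coverAct phiSix (exists_gamLift g).choose).hom :=
    congrArg Iso.hom (exists_gamLift g).choose_spec.2.symm
  rw [h]
  exact surfaceChart_comp_coverAct _ _

theorem gamChartMap_eq {h : coverSymm phiSix} (hh : h ∈ hessianLift) (hΓ : liftToPGL h ∈ Gam) :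
    gamChartMap ⟨coverAct phiSix h, h, ⟨hh, hΓ⟩, rfl⟩ =
      surfaceChartMap h (coverRingMap_heisMap_of_mem_Gam hh hΓ cuspW) := by
  refine Spec.map_injective ?_
  rw [← cancel_mono surfaceChart, ← surfaceChart_comp_gam]
  exact surfaceChart_comp_coverAct _ _

/-- The denominator is a power of an invariant, so a fraction is fixed exactly when its numerator
is. The numerator has degree 9n, divisible by three, and `exists_heisMap_eq` descends it to Y'. -/
theorem gamChartMap_fixed_iff (r : CommRingCat.of (Away (coverGrading phiSix) (heisMap cuspW))) :
    (∀ g, gamChartMap g r = r) ↔ ∃ r', invariantHom r' = r := by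
  refine ⟨fun h => ?_, ?_⟩
  · obtain ⟨n, x, hx, rfl⟩ := Away.mk_surjective _ heisMap_cuspW_mem r
    have hfix {k : coverSymm phiSix} (hk : k ∈ hessianLift) (hΓ : liftToPGL k ∈ Gam) :
        coverRingMap k x = x := by
      have := h ⟨coverAct phiSix k, k, ⟨hk, hΓ⟩, rfl⟩
      rwa [gamChartMap_eq hk hΓ, surfaceChartMap_mk,
        away_mk_eq_mk_iff heisMap_cuspW_ne_zero] at this
    have hx' : x ∈ coverGrading phiSix (3 * (n • 3)) := by
      rwa [smul_eq_mul, ← Nat.mul_left_comm]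
    obtain ⟨y, hy, rfl⟩ := exists_heisMap_eq hx' (hfix coverG1_mem mk_g1_mem)
      (hfix coverG2_mem mk_g2_mem)
    exact ⟨Away.mk _ cuspW_mem n y hy, invariantHom_mk hy⟩
  · rintro ⟨r', rfl⟩ g
    obtain ⟨n, x, hx, rfl⟩ := Away.mk_surjective _ cuspW_mem r'
    rw [invariantHom_mk, gamChartMap, surfaceChartMap_mk,
      away_mk_eq_mk_iff heisMap_cuspW_ne_zero]
    exact coverRingMap_heisMap_of_mem_Gam (exists_gamLift g).choose_spec.1.1
      (exists_gamLift g).choose_spec.1.2 x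

/-! ### Passage to the minimal resolution and comparison with the quotient. -/

theorem lift_slAct_injective {Z : Over (Spec (.of ℂ))} {π : Z ⟶ cuspidalDoublePlane}
    (hπ : IsMinimalResolution π) : Function.Injective (hπ.lift.comp slAct) := by
  have := away_isDomain (ℬ := coverGrading phiSix') cuspW_ne_zero
  rw [injective_iff_map_eq_one]
  intro M hM
  obtain ⟨n, rfl⟩ := conjMatrix_comp_surjective M
  have h1 : hπ.lift (compatibleAct n) = 1 := by
    rw [← slAct_apply]
    exact hM
  have h2 := hπ.eq_id_of_lift_eq_one cuspChart
    (cuspChart_comp_coverAct n.1.2 (coverRingMap_cuspW n.2)) h1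
  -- A trivial lift to the resolution acts trivially on the functions of the chart w' ≠ 0. Fractions
  -- x/w' with x of degree three suffice to conclude.
  have h3 : liftToPGL n.1.1 ∈ Gam := by
    refine mem_Gam_of_coverRingMap_eq n.2 fun x hx => ?_
    have hx' : x ∈ coverGrading phiSix' (1 • 3) := by rwa [one_smul]
    have h4 := congrArg (fun b => b (Away.mk _ cuspW_mem 1 x hx')) h2
    change cuspChartMap _ _ _ = _ at h4
    rw [cuspChartMap_mk] at h4
    exact (away_mk_eq_mk_iff cuspW_ne_zero _ _ _).mp h4
  have h5 : compatibleToG216 n ∈ conjMatrix.ker := by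
    rw [conjMatrix_ker]
    exact h3
  exact h5

theorem exists_partialIso_of_isQuotientBy {Q : Over (Spec (.of ℂ))} {q : surfaceX ⟶ Q}
    (hq : IsQuotientBy gamOnX q) {Z : Over (Spec (.of ℂ))} {π : Z ⟶ cuspidalDoublePlane}
    (hπ : IsMinimalResolution π) :
    ∃ f : Q.left.PartialIso Z.left, f.IsOver Q.hom Z.hom ∧ ∀ n : compatibleLifts,
      ∃ c : Aut Q, (surfaceAct n).hom ≫ q = q ≫ c.hom ∧
        Intertwines f c (hπ.lift (compatibleAct n)) := by
  have := away_isDomain (ℬ := coverGrading phiSix') cuspW_ne_zero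
  have hd : IsDominant surfaceChart :=
    isDominant_chart heisMap_cuspW_ne_zero heisMap_cuspW_mem _
  exact exists_partialIso_intertwines hq hπ surfaceChart cuspChart invariantHom
    invariantHom_injective surfaceChart_comp_hom gamChartMap surfaceChart_comp_gam
    gamChartMap_fixed_iff surfaceAct compatibleAct (fun n _ hg => conj_mem_gamOnX n hg)
    (fun n => surfaceChartMap n.1.1 (coverRingMap_heisMap_cuspW n.2))
    (fun n => surfaceChart_comp_coverAct _ _)
    (fun n => cuspChartMap n.1.2 (coverRingMap_cuspW n.2))
    (fun n => cuspChart_comp_coverAct _ _) fun n => invariantHom_comp n.2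

end Hesse

end

theorem mainTheorem4 :
    Hesse.Gam ≤ Hesse.G216 ∧
    Nonempty (Hesse.Gam ≃* Multiplicative (ZMod 3 × ZMod 3)) ∧
    ∃ (_ : (Hesse.Gam.subgroupOf Hesse.G216).Normal)
      (θ : (Hesse.G216 ⧸ Hesse.Gam.subgroupOf Hesse.G216) ≃* SL(2, ZMod 3)),
      ∀ (Q : Over (Spec (.of ℂ))) (q : Hesse.surfaceX ⟶ Q) (_ : IsQuotientBy Hesse.gamOnX q)
        (X' : Over (Spec (.of ℂ))) (π : X' ⟶ Hesse.cuspidalDoublePlane)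
        (_ : IsMinimalResolution π),
        ∃ f : Q.left.PartialIso X'.left, f.IsOver Q.hom X'.hom ∧
        ∃ ρ : SL(2, ZMod 3) →* Aut X', Function.Injective ρ ∧
          ∀ g : Hesse.G216, ∃ h ∈ Hesse.hessianLift, Hesse.liftToPGL h = g ∧
            ∃ a : Aut Q, (Hesse.coverAct Hesse.phiSix h).hom ≫ q = q ≫ a.hom ∧
              Intertwines f a (ρ (θ (QuotientGroup.mk g))) := by
  refine ⟨Hesse.Gam_le_G216, Hesse.nonempty_gam_mulEquiv, Hesse.Gam_normal, ?_⟩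
  have := Hesse.Gam_normal
  refine ⟨Hesse.quotientEquiv, fun Q q hq X' π hπ => ?_⟩
  obtain ⟨f, hf, hfn⟩ := Hesse.exists_partialIso_of_isQuotientBy hq hπ
  refine ⟨f, hf, hπ.lift.comp Hesse.slAct, Hesse.lift_slAct_injective hπ, fun g => ?_⟩
  -- The first component of a compatible pair over g is the required lift to X. The second acts on
  -- the cuspidal double plane through the class of g in SL(2, 𝔽₃).
  obtain ⟨n, rfl⟩ := Hesse.compatibleToG216_surjective g
  obtain ⟨a, ha, hfa⟩ := hfn n
  refine ⟨n.1.1, n.2.1, rfl, a, ha, ?_⟩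
  rw [Hesse.quotientEquiv_mk, MonoidHom.comp_apply, Hesse.slAct_apply]
  exact hfa
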